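/- Let $X,U,V$ be real Hilbert spaces, let $A:D(A)\subset X\to X$ generate a $C_0$ semigroup $(e^{tA})_{t\ge 0}$ on $X$, let $B\in L(U,X)$ and $C\in L(X,V)$, and let $Q\in L(U,U)$ be self-adjoint, positive definite and boundedly invertible. Let $\Pi>0$, and let $y_d\in C([0,+\infty);X)$ and $u_d\in L^2_{loc}([0,+\infty);U)$ satisfy $y_d(t+\Pi)=y_d(t)$ and $u_d(t+\Pi)=u_d(t)$ for a.e. $t>0$. For $T>0$, put $$J^T(y,u)=\frac12\int_0^T\Big(\|C(y(t)-y_d(t))\|_V^2+\|Q^{1/2}(u(t)-u_d(t))\|_U^2\Big)\,dt .$$ For $y_0\in X$, $(LQ^T)$ is the problem of minimizing $J^T(y,u)$ over all $(y,u)\in C([0,T];X)\times L^2(0,T;U)$ such that $y$ is the mild solution of $\dot y=Ay+Bu$, $y(0)=y_0$. The problem $(LQ^\Pi)$ is that of minimizing $J^\Pi(y,u)$ over all $(y,u)\in C([0,\Pi];X)\times L^2(0,\Pi;U)$ such that $y$ is a mild solution of $\dot y=Ay+Bu$ on $[0,\Pi]$ with $y(0)=y(\Pi)$. An extremal lift of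 a pair $(y,u)$ on $[0,T]$ is a triple $(y,u,\lambda)$ with $\lambda\in C([0,T];X)$ such that, in the mild sense on $[0,T]$, $$\dot y=Ay+BQ^{-1}B^*\lambda+Bu_d,\qquad \dot\lambda=C^*Cy-A^*\lambda-C^*Cy_d,\qquad u=u_d+Q^{-1}B^*\lambda\ \text{ a.e. on }[0,T],$$ together with the boundary conditions $y(0)=y_0$, $\lambda(T)=0$ for $(LQ^T)$, respectively (with $T=\Pi$) $y(0)=y(\Pi)$, $\lambda(0)=\lambda(\Pi)$ for $(LQ^\Pi)$. Assume that $(A,B)$ is exponentially stabilizable, i.e. there is $K\in L(X,U)$ such that $A+BK$ generates a $C_0$ semigroup whose operator norm is at most $ce^{-\nu t}$ for all $t\ge0$, for some $c,\nu>0$, and that $(A,C)$ is exponentially detectable, i.e. $(A^*,C^*)$ is exponentially stabilizable. Then: 1. The problem $(LQ^\Pi)$ has a unique optimal solution $(y^\Pi,u^\Pi)$, and it has a unique extremal lift $(y^\Pi,u^\Pi,\lambda^\Pi)$. 2. There is a unique bounded nonnegative self-adjoint operator $P$ on $X$ solving the Riccati equation $A^*P+PA-PBQ^{-1}B^*P+C^*C=0$,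 in the sense that $$2\langle PAx,x\rangle_X-\langle PBQ^{-1}B^*Px,x\rangle_X+\|Cx\|_V^2=0\qquad\forall x\in D(A).$$ The operator $A-BQ^{-1}B^*P$ generates an exponentially stable $C_0$ semigroup $(S(t))_{t\ge0}$, the operators $I-S(\Pi)$ and $I-S(\Pi)^*$ are boundedly invertible, the integral $$Ex=-\int_0^{+\infty}S(t)BQ^{-1}B^*S(t)^*x\,dt\qquad(x\in X)$$ converges absolutely and defines $E\in L(X,X)$, and $$y^\Pi(t)=z(t)-Eq(t),\qquad \lambda^\Pi(t)=-Pz(t)+(I+PE)q(t)\qquad\forall t\in[0,\Pi],$$ $$u^\Pi(t)=u_d(t)+Q^{-1}B^*\lambda^\Pi(t)\qquad\text{for a.e. }t\in[0,\Pi],$$ where, with $f=(I+EP)Bu_d-EC^*Cy_d$ and $g=-PBu_d+C^*Cy_d$, for $t\in[0,\Pi]$, $$z(t)=S(t)(I-S(\Pi))^{-1}\int_0^\Pi S(\Pi-\tau)f(\tau)\,d\tau+\int_0^tS(t-\tau)f(\tau)\,d\tau,$$ $$q(t)=S(\Pi-t)^*(I-S(\Pi)^*)^{-1}\int_0^\Pi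 S(\Pi-\tau)^*g(\Pi-\tau)\,d\tau+\int_0^{\Pi-t}S(\Pi-t-\tau)^*g(\Pi-\tau)\,d\tau .$$ 3. Extend $(y^\Pi,u^\Pi,\lambda^\Pi)$ by $\Pi$-periodicity to $[0,+\infty)$. For every $y_0\in X$ there exist constants $c>0$ and $\nu>0$ such that for every $T>0$ the problem $(LQ^T)$ has a unique optimal solution $(y^T,u^T)$, it has a unique extremal lift $(y^T,u^T,\lambda^T)$, and $$\|y^T(t)-y^\Pi(t)\|_X+\|u^T(t)-u^\Pi(t)\|_U+\|\lambda^T(t)-\lambda^\Pi(t)\|_X\le c\big(e^{-\nu t}+e^{-\nu(T-t)}\big)$$ for almost every $t\in[0,T]$. -/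

import Mathlib

open MeasureTheory Set Filter Topology

open scoped RealInnerProductSpace

noncomputable section

namespace PeriodicLQ

variable {X U V : Type*}
  [NormedAddCommGroup X] [InnerProductSpace ℝ X] [CompleteSpace X]
  [NormedAddCommGroup U] [InnerProductSpace ℝ U] [CompleteSpace U]
  [NormedAddCommGroup V] [InnerProductSpace ℝ V] [CompleteSpace V]

/-- `(S t)` for `t ≥ 0` is a strongly continuous one-parameter semigroup of bounded operators
on `X` (the values of `S` at negative times play no role). -/
structure IsC0Semigroup (S : ℝ → X →L[ℝ] X) : Prop where
  map_zero : S 0 = ContinuousLinearMap.id ℝ X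
  map_add : ∀ s t : ℝ, 0 ≤ s → 0 ≤ t → S (s + t) = (S s).comp (S t)
  tendsto_zero : ∀ x : X, Tendsto (fun t => S t x) (𝓝[>] 0) (𝓝 x)

/-- The unbounded operator `A` (with its domain) is the infinitesimal generator of the
`C₀` semigroup `S`. -/
def Generates (A : X →ₗ.[ℝ] X) (S : ℝ → X →L[ℝ] X) : Prop :=
  IsC0Semigroup S ∧
    ∀ x y : X, (x, y) ∈ A.graph ↔ Tendsto (fun t : ℝ => t⁻¹ • (S t x - x)) (𝓝[>] 0) (𝓝 y)

/-- The operator `A + L`, with domain `D(A)`, for a bounded operator `L`. -/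
def addBounded (A : X →ₗ.[ℝ] X) (L : X →L[ℝ] X) : X →ₗ.[ℝ] X :=
  (L : X →ₗ[ℝ] X) +ᵥ A

/-- `‖S t‖ ≤ c e^{-ν t}` for all `t ≥ 0`, for some `c, ν > 0`. -/
def IsExpStable (S : ℝ → X →L[ℝ] X) : Prop :=
  ∃ c > 0, ∃ ν > 0, ∀ t : ℝ, 0 ≤ t → ‖S t‖ ≤ c * Real.exp (-ν * t)

/-- `(A, B)` is exponentially stabilizable: some `A + B K`, with `K` bounded, generates an
exponentially stable `C₀` semigroup. -/
def IsExpStabilizable (A : X →ₗ.[ℝ] X) (B : U →L[ℝ] X) : Prop :=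
  ∃ K : X →L[ℝ] U, ∃ S : ℝ → X →L[ℝ] X,
    Generates (addBounded A (B.comp K)) S ∧ IsExpStable S

/-- `(A, C)` is exponentially detectable: `(A*, C*)` is exponentially stabilizable. -/
def IsExpDetectable (A : X →ₗ.[ℝ] X) (C : X →L[ℝ] V) : Prop :=
  IsExpStabilizable A.adjoint C.adjoint

/-- `y ∈ C([0,T];X)` is a mild solution of `y' = A y + f` on `[0,T]`, where `S t = e^{tA}`. -/
def IsMildSolution (S : ℝ → X →L[ℝ] X) (T : ℝ) (f y : ℝ → X) : Prop :=
  ContinuousOn y (Icc 0 T) ∧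
    ∀ t ∈ Icc 0 T, y t = S t (y 0) + ∫ s in (0 : ℝ)..t, S (t - s) (f s)

/-- `l ∈ C([0,T];X)` is a mild solution of `l' = -A* l + g` on `[0,T]`, where `S t = e^{tA}`,
so that `(S t)* = e^{tA*}`; the equation is solved backwards from time `T`. -/
def IsBackwardMildSolution (S : ℝ → X →L[ℝ] X) (T : ℝ) (g l : ℝ → X) : Prop :=
  ContinuousOn l (Icc 0 T) ∧
    ∀ t ∈ Icc 0 T,
      l t = (S (T - t)).adjoint (l T) - ∫ s in t..T, (S (s - t)).adjoint (g s)

/-- `(y, u) ∈ C([0,T];X) × L²(0,T;U)` and `y` is a mild solution of `y' = A y + B u`. -/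
def IsTrajectory (S : ℝ → X →L[ℝ] X) (B : U →L[ℝ] X) (T : ℝ) (y : ℝ → X) (u : ℝ → U) : Prop :=
  MemLp u 2 (volume.restrict (Ioc 0 T)) ∧ IsMildSolution S T (fun t => B (u t)) y

/-- The tracking cost
`½ ∫₀ᵀ (‖C (y - y_d)‖² + ‖Q^{1/2} (u - u_d)‖²) dt`; here `‖Q^{1/2} v‖²` is written `⟪Q v, v⟫`,
see `norm_sq_sqrt`. -/
def cost (C : X →L[ℝ] V) (Q : U ≃L[ℝ] U) (yd : ℝ → X) (ud : ℝ → U) (T : ℝ)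
    (y : ℝ → X) (u : ℝ → U) : ℝ :=
  1 / 2 * ∫ t in (0 : ℝ)..T,
    (‖C (y t - yd t)‖ ^ 2 + ⟪Q (u t - ud t), u t - ud t⟫)

/-- If `R` is a symmetric square root of `Q` then `‖R v‖² = ⟪Q v, v⟫`. -/
theorem norm_sq_sqrt {W : Type*} [NormedAddCommGroup W] [InnerProductSpace ℝ W]
    (Q : W ≃L[ℝ] W) (R : W →L[ℝ] W) (hR : R.IsPositive)
    (hRQ : R.comp R = (Q : W →L[ℝ] W)) (v : W) : ‖R v‖ ^ 2 = ⟪Q v, v⟫ := by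
  have h1 : Q v = R (R v) := by
    have h := congrArg (fun L : W →L[ℝ] W => L v) hRQ
    simpa using h.symm
  have h2 : ⟪R (R v), v⟫ = ⟪R v, R v⟫ := hR.isSymmetric (R v) v
  rw [h1, h2, real_inner_self_eq_norm_sq]

/-- `(y, u)` is optimal for the problem on `[0,T]` with initial condition `y 0 = y0`. -/
def IsOptimalOn (S : ℝ → X →L[ℝ] X) (B : U →L[ℝ] X) (C : X →L[ℝ] V) (Q : U ≃L[ℝ] U)
    (yd : ℝ → X) (ud : ℝ → U) (y0 : X) (T : ℝ) (y : ℝ → X) (u : ℝ → U) : Prop :=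
  (IsTrajectory S B T y u ∧ y 0 = y0) ∧
    ∀ (y' : ℝ → X) (u' : ℝ → U), IsTrajectory S B T y' u' → y' 0 = y0 →
      cost C Q yd ud T y u ≤ cost C Q yd ud T y' u'

/-- `(y, u)` is optimal for the periodic problem on `[0,p]` with constraint `y 0 = y p`. -/
def IsPeriodicOptimal (S : ℝ → X →L[ℝ] X) (B : U →L[ℝ] X) (C : X →L[ℝ] V) (Q : U ≃L[ℝ] U)
    (yd : ℝ → X) (ud : ℝ → U) (p : ℝ) (y : ℝ → X) (u : ℝ → U) : Prop :=
  (IsTrajectory S B p y u ∧ y 0 = y p) ∧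
    ∀ (y' : ℝ → X) (u' : ℝ → U), IsTrajectory S B p y' u' → y' 0 = y' p →
      cost C Q yd ud p y u ≤ cost C Q yd ud p y' u'

/-- The operator `B Q⁻¹ B*`. -/
def gramian (B : U →L[ℝ] X) (Q : U ≃L[ℝ] U) : X →L[ℝ] X :=
  B.comp ((Q.symm : U →L[ℝ] U).comp B.adjoint)

/-- The Hamiltonian system on `[0,T]`, in the mild sense:
`y' = A y + B Q⁻¹ B* l + B u_d`, `l' = C* C y - A* l - C* C y_d`, and
`u = u_d + Q⁻¹ B* l` almost everywhere. -/
def IsExtremal (S : ℝ → X →L[ℝ] X) (B : U →L[ℝ] X) (C : X →L[ℝ] V) (Q : U ≃L[ℝ] U)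
    (yd : ℝ → X) (ud : ℝ → U) (T : ℝ) (y : ℝ → X) (u : ℝ → U) (l : ℝ → X) : Prop :=
  IsMildSolution S T (fun t => gramian B Q (l t) + B (ud t)) y ∧
  IsBackwardMildSolution S T (fun t => C.adjoint (C (y t)) - C.adjoint (C (yd t))) l ∧
  ∀ᵐ t ∂volume.restrict (Ioc 0 T), u t = ud t + Q.symm (B.adjoint (l t))

/-- `l` is an adjoint state (extremal lift) of `(y, u)` for the problem on `[0,T]`. -/
def IsLiftOn (S : ℝ → X →L[ℝ] X) (B : U →L[ℝ] X) (C : X →L[ℝ] V) (Q : U ≃L[ℝ] U)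
    (yd : ℝ → X) (ud : ℝ → U) (y0 : X) (T : ℝ) (y : ℝ → X) (u : ℝ → U) (l : ℝ → X) : Prop :=
  IsExtremal S B C Q yd ud T y u l ∧ y 0 = y0 ∧ l T = 0

/-- `l` is an adjoint state (extremal lift) of `(y, u)` for the periodic problem. -/
def IsPeriodicLift (S : ℝ → X →L[ℝ] X) (B : U →L[ℝ] X) (C : X →L[ℝ] V) (Q : U ≃L[ℝ] U)
    (yd : ℝ → X) (ud : ℝ → U) (p : ℝ) (y : ℝ → X) (u : ℝ → U) (l : ℝ → X) : Prop :=
  IsExtremal S B C Q yd ud p y u l ∧ y 0 = y p ∧ l 0 = l p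

/-- On `[0,T]`, `(y, u)` is the unique optimal pair (`Opt`) and `l` is its unique
lift (`Lift`); states and adjoint states are compared pointwise on `[0,T]`, controls
almost everywhere. -/
def IsUniqueOptimalTriple (T : ℝ) (Opt : (ℝ → X) → (ℝ → U) → Prop)
    (Lift : (ℝ → X) → (ℝ → U) → (ℝ → X) → Prop)
    (y : ℝ → X) (u : ℝ → U) (l : ℝ → X) : Prop :=
  (Opt y u ∧ ∀ y' u', Opt y' u' →
    EqOn y' y (Icc 0 T) ∧ u' =ᵐ[volume.restrict (Ioc 0 T)] u) ∧
  (Lift y u l ∧ ∀ l', Lift y u l' → EqOn l' l (Icc 0 T))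

/-- `P` is a bounded nonnegative self-adjoint solution of the Riccati equation
`A* P + P A - P B Q⁻¹ B* P + C* C = 0`, tested on `D(A)`. -/
def IsRiccatiSolution (A : X →ₗ.[ℝ] X) (B : U →L[ℝ] X) (C : X →L[ℝ] V) (Q : U ≃L[ℝ] U)
    (P : X →L[ℝ] X) : Prop :=
  P.IsPositive ∧
    ∀ x : A.domain,
      2 * ⟪P (A x), (x : X)⟫ - ⟪P (gramian B Q (P x)), (x : X)⟫
        + ⟪C (x : X), C (x : X)⟫ = 0

/-- `E = -∫₀^∞ S(t) B Q⁻¹ B* S(t)* dt`, the integral being absolutely convergent in the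
strong sense (the integrand need not be measurable for the operator norm). -/
def IsLyapunovOperator (S : ℝ → X →L[ℝ] X) (B : U →L[ℝ] X) (Q : U ≃L[ℝ] U)
    (E : X →L[ℝ] X) : Prop :=
  ∀ x : X,
    IntegrableOn (fun t => S t (gramian B Q ((S t).adjoint x))) (Ioi 0) ∧
    E x = -∫ t in Ioi (0 : ℝ), S t (gramian B Q ((S t).adjoint x))

/-- The forcing term `(I + E P) B u_d - E C* C y_d`. -/
def zForcing (B : U →L[ℝ] X) (C : X →L[ℝ] V) (P E : X →L[ℝ] X) (yd : ℝ → X) (ud : ℝ → U)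
    (t : ℝ) : X :=
  (B (ud t) + E (P (B (ud t)))) - E (C.adjoint (C (yd t)))

/-- The forcing term `-P B u_d + C* C y_d`. -/
def qForcing (B : U →L[ℝ] X) (C : X →L[ℝ] V) (P : X →L[ℝ] X) (yd : ℝ → X) (ud : ℝ → U)
    (t : ℝ) : X :=
  -P (B (ud t)) + C.adjoint (C (yd t))

/-- `z(t) = S(t) (I - S(p))⁻¹ ∫₀ᵖ S(p-τ) f(τ) dτ + ∫₀ᵗ S(t-τ) f(τ) dτ` with
`f = (I + E P) B u_d - E C* C y_d`. -/
def zTraj (S : ℝ → X →L[ℝ] X) (B : U →L[ℝ] X) (C : X →L[ℝ] V) (P E : X →L[ℝ] X)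
    (yd : ℝ → X) (ud : ℝ → U) (p t : ℝ) : X :=
  S t (Ring.inverse (1 - S p) (∫ τ in (0 : ℝ)..p, S (p - τ) (zForcing B C P E yd ud τ)))
    + ∫ τ in (0 : ℝ)..t, S (t - τ) (zForcing B C P E yd ud τ)

/-- `q(t) = S(p-t)* (I - S(p)*)⁻¹ ∫₀ᵖ S(p-τ)* g(p-τ) dτ + ∫₀^{p-t} S(p-t-τ)* g(p-τ) dτ` with
`g = -P B u_d + C* C y_d`. -/
def qTraj (S : ℝ → X →L[ℝ] X) (B : U →L[ℝ] X) (C : X →L[ℝ] V) (P : X →L[ℝ] X)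
    (yd : ℝ → X) (ud : ℝ → U) (p t : ℝ) : X :=
  (S (p - t)).adjoint (Ring.inverse (1 - (S p).adjoint)
      (∫ τ in (0 : ℝ)..p, (S (p - τ)).adjoint (qForcing B C P yd ud (p - τ))))
    + ∫ τ in (0 : ℝ)..(p - t), (S (p - t - τ)).adjoint (qForcing B C P yd ud (p - τ))

/-- The `p`-periodic extension of the restriction of `f` to `[0,p)`. -/
def periodicExt {Z : Type*} (p : ℝ) (f : ℝ → Z) (t : ℝ) : Z :=
  f (t - ⌊t / p⌋ * p)

end PeriodicLQ

end

/-! Write N = BQ⁻¹B*. The Hamiltonian system is decoupled by two changes of unknown. If P solves the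
Riccati equation and w = λ + Py, then y disappears from the equation for w, which becomes the
backward equation of the closed-loop semigroup R of A − NP with forcing −g, while y' = (A − NP)y +
Nw + Bu_d. If moreover E solves the Lyapunov equation of R, then z = y + Ew satisfies z' = (A − NP)z
+ f. Each equation is exponentially stable in its own direction of time, so I − R(Π) and its adjoint
are invertible and the periodic solutions z and q = w are given by explicit formulas.
`IsLQSetting.hamiltonian` and `mildOn_sub_qTraj` carry these changes of unknown for mild solutions,
through `MildOn.change_semigroup` and `MildOn.conjugate`, both of which rest on Fubini on a
triangle.

Optimal pairs are not obtained by minimization: an extremal is constructed and then shown to be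
optimal. The cost is quadratic and the duality formula `BackMildOn.inner_sub_inner` turns its first
variation into a boundary term that vanishes, so the excess cost of a competitor is exactly half the
second variation (`IsExtremalOn.cost_eq`). If the excess is zero, the two controls agree and the
difference of states is unobserved; it is then an orbit of the stable semigroup of A + GC, hence
zero under either kind of boundary condition.

The operator P is the strong limit of Kleinman's iteration (`exists_kleinman_step`,
`exists_solvesRiccati`). Stability of every closed loop met on the way, including the final one,
comes from `isStabilizing_of_dissipation`, which adds a multiple of the cost functional to a
Lyapunov functional of A + GC.

For the turnpike estimate, the finite-horizon extremal is sought as the periodic one plus a solution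
of the homogeneous decoupled system: dw(t) = R(T − t)*ω and dy(t) = R(t)x plus the response to dw.
These decay from the two ends of the interval. The terminal condition λ(T) = 0 becomes (I − PG_T)ω =
known, where G_T is the controllability Gramian of the horizon. The essential point is that I − PG_T
is boundedly invertible uniformly in T. `IsLQSetting.exists_norm_le` proves the lower bound by an
energy estimate using the detector semigroup, and `surjective_one_sub` turns it into solvability. -/

set_option linter.unusedSectionVars false

noncomputable section

namespace PeriodicLQ

/-! ### Strongly continuous semigroups on a Hilbert space, their orbits, generators and adjoints. -/

section Semigroup

variable {X Y : Type*}
  [NormedAddCommGroup X] [InnerProductSpace ℝ X] [CompleteSpace X]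
  [NormedAddCommGroup Y] [InnerProductSpace ℝ Y] [CompleteSpace Y]

/-- A `C₀` semigroup extended by the identity to negative times. -/
structure IsClampedSemigroup (S : ℝ → X →L[ℝ] X) : Prop extends IsC0Semigroup S where
  clamp : ∀ t ≤ 0, S t = ContinuousLinearMap.id ℝ X

/-- `x` belongs to the domain of the generator of `S`, which maps it to `y`. -/
def HasGenerator (S : ℝ → X →L[ℝ] X) (x y : X) : Prop :=
  Tendsto (fun t : ℝ => t⁻¹ • (S t x - x)) (𝓝[>] 0) (𝓝 y)

/-- If the norms were unbounded near 0, they would blow up along some sequence of positive times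
tending to 0. Orbits converge along that sequence, hence are bounded, which contradicts the uniform
boundedness principle. -/
theorem IsC0Semigroup.exists_bound_Icc {S : ℝ → X →L[ℝ] X} (hS : IsC0Semigroup S) :
    ∃ δ > 0, ∃ M ≥ 1, ∀ t ∈ Icc (0 : ℝ) δ, ‖S t‖ ≤ M := by
  by_contra! h
  have hpos : ∀ n : ℕ, (0 : ℝ) < 1 / ((n : ℝ) + 1) := fun n => Nat.one_div_pos_of_nat
  have h1 : ∀ n : ℕ, (1 : ℝ) ≤ (n : ℝ) + 1 := fun n => by
    have := Nat.cast_nonneg (α := ℝ) n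
    linarith
  choose t ht hlt using fun n : ℕ => h (1 / ((n : ℝ) + 1)) (hpos n) ((n : ℝ) + 1) (h1 n)
  have htpos : ∀ n, 0 < t n := by
    intro n
    rcases (ht n).1.lt_or_eq with h0 | h0
    · exact h0
    · have h2 := hlt n
      rw [← h0, hS.map_zero] at h2
      have h3 := (ContinuousLinearMap.norm_id_le (𝕜 := ℝ) (E := X))
      have := h1 n
      linarith
  have hlim : Tendsto t atTop (𝓝[>] 0) := by
    rw [tendsto_nhdsWithin_iff]
    refine ⟨squeeze_zero (fun n => (ht n).1) (fun n => (ht n).2)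
      tendsto_one_div_add_atTop_nhds_zero_nat, Eventually.of_forall htpos⟩
  obtain ⟨c, hc⟩ := banach_steinhaus (g := fun n => S (t n)) (fun x => by
    obtain ⟨c, hc⟩ := (((hS.tendsto_zero x).comp hlim).norm).bddAbove_range
    exact ⟨c, fun n => hc ⟨n, rfl⟩⟩)
  obtain ⟨n, hn⟩ := exists_nat_gt c
  have := hc n
  have := hlt n
  linarith

theorem IsC0Semigroup.exists_exp_bound {S : ℝ → X →L[ℝ] X} (hS : IsC0Semigroup S) :
    ∃ M ≥ 1, ∃ ω ≥ 0, ∀ t : ℝ, 0 ≤ t → ‖S t‖ ≤ M * Real.exp (ω * t) := by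
  obtain ⟨δ, hδ, M, hM, hb⟩ := hS.exists_bound_Icc
  have hM0 : 0 < M := by linarith
  refine ⟨M, hM, Real.log M / δ, div_nonneg (Real.log_nonneg hM) hδ.le, ?_⟩
  have hω : 0 ≤ Real.log M / δ := div_nonneg (Real.log_nonneg hM) hδ.le
  -- With this rate M = e^{ωδ}, so each further step of length δ costs exactly the factor that the
  -- exponential gains.
  set ω := Real.log M / δ with hωdef
  have hMexp : M = Real.exp (ω * δ) := by
    rw [hωdef, div_mul_cancel₀ _ hδ.ne', Real.exp_log hM0]
  have key : ∀ n : ℕ, ∀ t : ℝ, 0 ≤ t → t ≤ ((n : ℝ) + 1) * δ → ‖S t‖ ≤ M * Real.exp (ω * t) := by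
    intro n
    induction n with
    | zero =>
      intro t h0 h1
      refine (hb t ⟨h0, by simpa using h1⟩).trans ?_
      exact le_mul_of_one_le_right hM0.le (Real.one_le_exp (by positivity))
    | succ n ih =>
      intro t h0 h1
      rcases le_total t δ with h | h
      · refine (hb t ⟨h0, h⟩).trans ?_
        exact le_mul_of_one_le_right hM0.le (Real.one_le_exp (by positivity))
      · have h2 := ih (t - δ) (by linarith) (by push_cast at h1; linarith)
        have h3 : S t = (S δ).comp (S (t - δ)) := by
          rw [← hS.map_add δ (t - δ) hδ.le (by linarith)]
          congr 1; ring
        rw [h3]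
        refine (ContinuousLinearMap.opNorm_comp_le _ _).trans ?_
        have h4 : M * (M * Real.exp (ω * (t - δ))) = M * Real.exp (ω * t) := by
          nth_rewrite 2 [hMexp]
          rw [← Real.exp_add]
          congr 2; ring
        rw [← h4]
        exact mul_le_mul (hb δ ⟨hδ.le, le_rfl⟩) h2 (norm_nonneg _) hM0.le
  intro t ht
  obtain ⟨n, hn⟩ := exists_nat_gt (t / δ)
  refine key n t ht ?_
  rw [div_lt_iff₀ hδ] at hn
  nlinarith

/-- The extension of a semigroup by its value at `0` to negative times. -/
def clampSemigroup (S : ℝ → X →L[ℝ] X) (t : ℝ) : X →L[ℝ] X := S (max t 0)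

theorem clampSemigroup_of_nonneg (S : ℝ → X →L[ℝ] X) {t : ℝ} (ht : 0 ≤ t) :
    clampSemigroup S t = S t := by
  rw [clampSemigroup, max_eq_left ht]

theorem IsC0Semigroup.isClampedSemigroup {S : ℝ → X →L[ℝ] X} (hS : IsC0Semigroup S) :
    IsClampedSemigroup (clampSemigroup S) where
  map_zero := by rw [clampSemigroup_of_nonneg S le_rfl, hS.map_zero]
  map_add s t hs ht := by
    rw [clampSemigroup_of_nonneg S hs, clampSemigroup_of_nonneg S ht,
      clampSemigroup_of_nonneg S (add_nonneg hs ht), hS.map_add s t hs ht]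
  tendsto_zero x := by
    refine (hS.tendsto_zero x).congr' ?_
    filter_upwards [self_mem_nhdsWithin] with t ht
    rw [clampSemigroup_of_nonneg S (le_of_lt ht)]
  clamp t ht := by rw [clampSemigroup, max_eq_right ht, hS.map_zero]

theorem hasGenerator_clampSemigroup {S : ℝ → X →L[ℝ] X} {x y : X} :
    HasGenerator (clampSemigroup S) x y ↔ HasGenerator S x y := by
  refine tendsto_congr' ?_
  filter_upwards [self_mem_nhdsWithin] with t ht
  rw [clampSemigroup_of_nonneg S (le_of_lt ht)]

theorem IsExpStable.clampSemigroup {S : ℝ → X →L[ℝ] X} (hS : IsExpStable S) :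
    IsExpStable (clampSemigroup S) := by
  obtain ⟨c, hc, ν, hν, h⟩ := hS
  exact ⟨c, hc, ν, hν, fun t ht => by rw [clampSemigroup_of_nonneg S ht]; exact h t ht⟩

namespace IsClampedSemigroup

variable {S : ℝ → X →L[ℝ] X}

theorem apply_max (hS : IsClampedSemigroup S) (t : ℝ) : S (max t 0) = S t := by
  rcases le_total t 0 with h | h
  · rw [max_eq_right h, hS.map_zero, hS.clamp t h]
  · rw [max_eq_left h]

theorem add_apply (hS : IsClampedSemigroup S) {s t : ℝ} (hs : 0 ≤ s) (ht : 0 ≤ t) (x : X) :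
    S (s + t) x = S s (S t x) := by
  rw [hS.map_add s t hs ht]; rfl

theorem zero_apply (hS : IsClampedSemigroup S) (x : X) : S 0 x = x := by
  rw [hS.map_zero]; rfl

theorem continuousAt_zero (hS : IsClampedSemigroup S) (x : X) :
    ContinuousAt (fun t => S t x) 0 := by
  rw [continuousAt_iff_continuous_left'_right']
  constructor
  · refine (continuousWithinAt_const (b := x)).congr (fun t ht => ?_) (hS.zero_apply x)
    rw [hS.clamp t (le_of_lt ht)]; rfl
  · have := hS.tendsto_zero x
    rw [ContinuousWithinAt, hS.zero_apply]
    exact this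

theorem norm_le_of_le (hS : IsClampedSemigroup S) (T : ℝ) :
    ∃ M ≥ 1, ∀ t ≤ T, ‖S t‖ ≤ M := by
  obtain ⟨M, hM, ω, hω, hb⟩ := hS.toIsC0Semigroup.exists_exp_bound
  refine ⟨M * Real.exp (ω * max T 0), ?_, fun t ht => ?_⟩
  · exact one_le_mul_of_one_le_of_one_le hM (Real.one_le_exp (by positivity))
  · rw [← hS.apply_max]
    refine (hb _ (le_max_right _ _)).trans ?_
    gcongr

/-- The operator at the smaller of the two times factors out of the difference, and its norm is
locally bounded; continuity at 0 is therefore enough. -/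
theorem continuous_orbit (hS : IsClampedSemigroup S) (x : X) : Continuous fun t => S t x := by
  rw [continuous_iff_continuousAt]
  intro t₀
  obtain ⟨M, hM, hb⟩ := hS.norm_le_of_le (t₀ + 1)
  have key : ∀ t, t < t₀ + 1 →
      ‖S t x - S t₀ x‖ ≤ M * ‖S |max t 0 - max t₀ 0| x - x‖ := by
    intro t ht
    have aux : ∀ a b : ℝ, 0 ≤ a → a ≤ b → ‖S b x - S a x‖ ≤ ‖S a‖ * ‖S (b - a) x - x‖ := by
      intro a b ha hab
      have h1 : S b x = S a (S (b - a) x) := by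
        rw [← hS.add_apply ha (by linarith)]; congr 2; ring
      rw [h1, ← map_sub]
      exact (S a).le_opNorm _
    rw [← hS.apply_max t, ← hS.apply_max t₀]
    rcases le_total (max t 0) (max t₀ 0) with h | h
    · rw [norm_sub_rev, abs_sub_comm, abs_of_nonneg (sub_nonneg.2 h)]
      refine (aux _ _ (le_max_right _ _) h).trans ?_
      gcongr
      rw [hS.apply_max]; exact hb _ ht.le
    · rw [abs_of_nonneg (sub_nonneg.2 h)]
      refine (aux _ _ (le_max_right _ _) h).trans ?_
      gcongr
      rw [hS.apply_max]; exact hb _ (by linarith)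
  rw [ContinuousAt, tendsto_iff_norm_sub_tendsto_zero]
  have hlim : Tendsto (fun t => M * ‖S |max t 0 - max t₀ 0| x - x‖) (𝓝 t₀) (𝓝 0) := by
    have h1 : Tendsto (fun t : ℝ => |max t 0 - max t₀ 0|) (𝓝 t₀) (𝓝 0) := by
      have : Continuous fun t : ℝ => |max t 0 - max t₀ 0| := by fun_prop
      simpa using this.tendsto t₀
    have h2 := (hS.continuousAt_zero x).tendsto.comp h1
    rw [hS.zero_apply] at h2
    have h3 := ((h2.sub_const x).norm).const_mul M
    simpa using h3
  refine squeeze_zero' (Eventually.of_forall fun t => norm_nonneg _) ?_ hlim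
  filter_upwards [Iio_mem_nhds (show t₀ < t₀ + 1 by linarith)] with t ht using key t ht

/-- Joint continuity on all of ℝ × X is what extending by the identity buys: integrands such as S(t
− r)f(r) are measurable without any restriction on the sign of t − r. -/
theorem continuous_uncurry (hS : IsClampedSemigroup S) :
    Continuous fun p : ℝ × X => S p.1 p.2 := by
  rw [continuous_iff_continuousAt]
  rintro ⟨t₀, x₀⟩
  obtain ⟨M, hM, hb⟩ := hS.norm_le_of_le (t₀ + 1)
  rw [ContinuousAt, tendsto_iff_norm_sub_tendsto_zero]
  have hlim : Tendsto (fun p : ℝ × X => M * ‖p.2 - x₀‖ + ‖S p.1 x₀ - S t₀ x₀‖)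
      (𝓝 (t₀, x₀)) (𝓝 0) := by
    have h1 : Continuous fun p : ℝ × X => M * ‖p.2 - x₀‖ + ‖S p.1 x₀ - S t₀ x₀‖ := by
      have h2 : Continuous fun p : ℝ × X => S p.1 x₀ :=
        (hS.continuous_orbit x₀).comp (continuous_fst (X := ℝ) (Y := X))
      exact (continuous_const.mul (continuous_snd.sub continuous_const).norm).add
        (h2.sub continuous_const).norm
    simpa using h1.tendsto (t₀, x₀)
  refine squeeze_zero' (Eventually.of_forall fun t => norm_nonneg _) ?_ hlim
  have h2 : ∀ᶠ p : ℝ × X in 𝓝 (t₀, x₀), p.1 < t₀ + 1 :=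
    continuous_fst.tendsto (t₀, x₀) (Iio_mem_nhds (show t₀ < t₀ + 1 by linarith))
  filter_upwards [h2] with p hp
  have h3 : S p.1 p.2 - S t₀ x₀ = S p.1 (p.2 - x₀) + (S p.1 x₀ - S t₀ x₀) := by
    rw [map_sub]; abel
  rw [h3]
  refine (norm_add_le _ _).trans ?_
  gcongr
  exact (S p.1).le_of_opNorm_le (hb _ hp.le) _

theorem continuous_comp (hS : IsClampedSemigroup S) {Z : Type*} [TopologicalSpace Z]
    {f : Z → ℝ} {g : Z → X} (hf : Continuous f) (hg : Continuous g) :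
    Continuous fun z => S (f z) (g z) :=
  hS.continuous_uncurry.comp (hf.prodMk hg)

theorem intervalIntegrable (hS : IsClampedSemigroup S) (x : X) (a b : ℝ) :
    IntervalIntegrable (fun s => S s x) volume a b :=
  (hS.continuous_orbit x).intervalIntegrable a b

/-- The integrated semigroup `v ↦ ∫₀ʳ S(s) v ds`. -/
def integrated (hS : IsClampedSemigroup S) (r : ℝ) : X →L[ℝ] X :=
  LinearMap.mkContinuousOfExistsBound
    { toFun := fun v => ∫ s in (0 : ℝ)..r, S s v
      map_add' := fun v w => by
        simp only [map_add]
        exact intervalIntegral.integral_add (hS.intervalIntegrable v 0 r)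
          (hS.intervalIntegrable w 0 r)
      map_smul' := fun c v => by
        simp only [map_smul, RingHom.id_apply]
        exact intervalIntegral.integral_smul c _ }
    (by
      obtain ⟨M, hM, hb⟩ := hS.norm_le_of_le |r|
      refine ⟨M * |r|, fun v => ?_⟩
      have := intervalIntegral.norm_integral_le_of_norm_le_const (a := 0) (b := r)
        (f := fun s => S s v) (C := M * ‖v‖) (fun s hs => by
          refine (S s).le_of_opNorm_le (hb _ ?_) _
          have h1 := hs.2
          refine h1.trans (max_le (abs_nonneg _) (le_abs_self _)))
      simp only [sub_zero] at this
      refine this.trans (le_of_eq ?_)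
      ring)

theorem integrated_apply (hS : IsClampedSemigroup S) (r : ℝ) (v : X) :
    hS.integrated r v = ∫ s in (0 : ℝ)..r, S s v := rfl

theorem integral_shift (hS : IsClampedSemigroup S) {r t : ℝ} (hr : 0 ≤ r) (ht : 0 ≤ t) (x : X) :
    ∫ s in (0 : ℝ)..r, S s (S t x) = ∫ s in t..(r + t), S s x := by
  have h1 : ∀ s ∈ uIcc 0 r, S s (S t x) = (fun s => S s x) (s + t) := by
    intro s hs
    rw [uIcc_of_le hr] at hs
    exact (hS.add_apply hs.1 ht x).symm
  rw [intervalIntegral.integral_congr h1,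
    intervalIntegral.integral_comp_add_right (fun s => S s x), zero_add]

theorem apply_integrated (hS : IsClampedSemigroup S) {r t : ℝ} (hr : 0 ≤ r) (ht : 0 ≤ t) (x : X) :
    S t (∫ s in (0 : ℝ)..r, S s x) = ∫ s in t..(r + t), S s x := by
  rw [← ContinuousLinearMap.intervalIntegral_comp_comm _ (hS.intervalIntegrable x 0 r),
    ← hS.integral_shift hr ht]
  refine intervalIntegral.integral_congr fun s hs => ?_
  rw [uIcc_of_le hr] at hs
  change S t (S s x) = S s (S t x)
  rw [← hS.add_apply hs.1 ht, ← hS.add_apply ht hs.1, add_comm]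

theorem integral_shift_sub (hS : IsClampedSemigroup S) (r t : ℝ) (x : X) :
    (∫ s in t..(r + t), S s x) - ∫ s in (0 : ℝ)..r, S s x
      = (∫ s in r..(r + t), S s x) - ∫ s in (0 : ℝ)..t, S s x := by
  have h := hS.intervalIntegrable x
  have h1 := intervalIntegral.integral_add_adjacent_intervals (h 0 t) (h t (r + t))
  have h2 := intervalIntegral.integral_add_adjacent_intervals (h 0 r) (h r (r + t))
  rw [sub_eq_sub_iff_add_eq_add, add_comm, h1, ← h2, add_comm]

theorem tendsto_integral_div (hS : IsClampedSemigroup S) (r : ℝ) (x : X) :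
    Tendsto (fun t : ℝ => t⁻¹ • ∫ s in r..(r + t), S s x) (𝓝[>] 0) (𝓝 (S r x)) := by
  have h1 := intervalIntegral.integral_hasDerivAt_right (hS.intervalIntegrable x r r)
    ((hS.continuous_orbit x).stronglyMeasurableAtFilter _ _) (hS.continuous_orbit x).continuousAt
  have h2 := h1.tendsto_slope_zero_right
  simpa using h2

theorem hasGenerator_integral (hS : IsClampedSemigroup S) {r : ℝ} (hr : 0 ≤ r) (x : X) :
    HasGenerator S (∫ s in (0 : ℝ)..r, S s x) (S r x - x) := by
  have h1 := hS.tendsto_integral_div r x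
  have h2 := hS.tendsto_integral_div 0 x
  rw [hS.zero_apply] at h2
  refine (h1.sub h2).congr' ?_
  filter_upwards [self_mem_nhdsWithin] with t ht
  rw [hS.apply_integrated hr (le_of_lt ht), hS.integral_shift_sub, zero_add, smul_sub]

/-- The averages of an orbit over [0, t] lie in the domain of the generator and converge to its
starting point. -/
theorem dense_domain (hS : IsClampedSemigroup S) : Dense {x | ∃ y, HasGenerator S x y} := by
  intro x
  have h2 := hS.tendsto_integral_div 0 x
  rw [hS.zero_apply] at h2
  refine mem_closure_of_tendsto h2 ?_
  filter_upwards [self_mem_nhdsWithin] with t ht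
  rw [zero_add]
  refine ⟨t⁻¹ • (S t x - x), ?_⟩
  have h3 := (hS.hasGenerator_integral (le_of_lt ht) x).const_smul t⁻¹
  refine h3.congr fun s => ?_
  rw [map_smul, ← smul_sub, smul_comm]

/-- On a Hilbert space the adjoints of a `C₀` semigroup form a `C₀` semigroup. -/
theorem adjoint (hS : IsClampedSemigroup S) :
    IsClampedSemigroup fun t => (S t).adjoint where
  map_zero := by rw [hS.map_zero, ContinuousLinearMap.adjoint_id]
  map_add s t hs ht := by
    rw [add_comm, hS.map_add t s ht hs, ContinuousLinearMap.adjoint_comp]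
  clamp t ht := by rw [hS.clamp t ht, ContinuousLinearMap.adjoint_id]
  tendsto_zero := by
    obtain ⟨M, hM, hb⟩ := hS.norm_le_of_le 1
    -- W collects the vectors whose adjoint orbit is continuous at 0. It is closed by boundedness of
    -- the norms and, as shown below, its orthogonal complement is trivial, so it is everything.
    let W : Submodule ℝ X :=
      { carrier := {x | Tendsto (fun t => (S t).adjoint x) (𝓝[>] 0) (𝓝 x)}
        add_mem' := fun {a b} ha hb => by
          simp only [mem_ofPred_eq, map_add] at *
          exact ha.add hb
        zero_mem' := by simp
        smul_mem' := fun c x hx => by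
          simp only [mem_ofPred_eq, map_smul] at *
          exact hx.const_smul c }
    have hcl : ∀ x ∈ closure (W : Set X), x ∈ W := by
      intro x hx
      change Tendsto (fun t => (S t).adjoint x) (𝓝[>] 0) (𝓝 x)
      rw [Metric.tendsto_nhds]
      intro ε hε
      obtain ⟨w, hw, hd⟩ := Metric.mem_closure_iff.1 hx (ε / (4 * M)) (by positivity)
      have hw' := (Metric.tendsto_nhds.1 (hw : Tendsto _ _ _)) (ε / 2) (by positivity)
      filter_upwards [hw', mem_nhdsWithin_of_mem_nhds (Iio_mem_nhds (zero_lt_one' ℝ))]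
        with t ht ht1
      rw [dist_eq_norm] at *
      have h1 : (S t).adjoint x - x
          = (S t).adjoint (x - w) + ((S t).adjoint w - w) - (x - w) := by
        rw [map_sub]; abel
      have h2 : ‖(S t).adjoint (x - w)‖ ≤ M * ‖x - w‖ := by
        refine ((S t).adjoint).le_of_opNorm_le ?_ _
        rw [LinearIsometryEquiv.norm_map]
        exact hb _ (le_of_lt ht1)
      have h3 : M * ‖x - w‖ < ε / 4 := by
        rw [lt_div_iff₀ (by positivity)] at hd
        linarith
      have h4 : ‖x - w‖ ≤ M * ‖x - w‖ := le_mul_of_one_le_left (norm_nonneg _) hM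
      rw [h1]
      refine (norm_sub_le _ _).trans_lt ?_
      have := norm_add_le ((S t).adjoint (x - w)) ((S t).adjoint w - w)
      linarith
    -- With J the integrated semigroup up to time r, (S(t)* − I)J* is the adjoint of JS(t) − J. The
    -- latter is a difference of two integrals over intervals of length t, hence O(t) in norm.
    have hmem : ∀ r : ℝ, 0 < r → r < 1 → ∀ x, (hS.integrated r).adjoint x ∈ W := by
      intro r hr hr1 x
      obtain ⟨M', hM', hb'⟩ := hS.norm_le_of_le 2
      change Tendsto _ _ _
      rw [tendsto_iff_norm_sub_tendsto_zero]
      have hlim : Tendsto (fun t : ℝ => (2 * M' * t) * ‖x‖) (𝓝[>] 0) (𝓝 0) := by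
        have : Continuous fun t : ℝ => (2 * M' * t) * ‖x‖ := by fun_prop
        simpa using (this.tendsto 0).mono_left nhdsWithin_le_nhds
      refine squeeze_zero' (Eventually.of_forall fun t => norm_nonneg _) ?_ hlim
      filter_upwards [self_mem_nhdsWithin, mem_nhdsWithin_of_mem_nhds (Iio_mem_nhds
        (zero_lt_one' ℝ))] with t ht ht1
      have ht0 : 0 < t := ht
      have ht1' : t < 1 := ht1
      have h1 : (S t).adjoint ((hS.integrated r).adjoint x) - (hS.integrated r).adjoint x
          = ((hS.integrated r).comp (S t) - hS.integrated r).adjoint x := by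
        rw [map_sub, ContinuousLinearMap.adjoint_comp]; rfl
      rw [h1]
      refine ContinuousLinearMap.le_of_opNorm_le _ ?_ _
      rw [LinearIsometryEquiv.norm_map]
      refine ContinuousLinearMap.opNorm_le_bound _ (by positivity) fun v => ?_
      have h2 : ((hS.integrated r).comp (S t) - hS.integrated r) v
          = (∫ s in r..(r + t), S s v) - ∫ s in (0 : ℝ)..t, S s v := by
        rw [← hS.integral_shift_sub, ← hS.integral_shift hr.le ht0.le]; rfl
      have h3 : ‖∫ s in r..(r + t), S s v‖ ≤ M' * ‖v‖ * t := by
        have := intervalIntegral.norm_integral_le_of_norm_le_const (a := r) (b := r + t)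
          (f := fun s => S s v) (C := M' * ‖v‖) (fun s hs => by
            refine (S s).le_of_opNorm_le (hb' _ ?_) _
            rw [uIoc_of_le (by linarith)] at hs
            linarith [hs.2])
        rwa [add_sub_cancel_left, abs_of_pos ht0] at this
      have h4 : ‖∫ s in (0 : ℝ)..t, S s v‖ ≤ M' * ‖v‖ * t := by
        have := intervalIntegral.norm_integral_le_of_norm_le_const (a := 0) (b := t)
          (f := fun s => S s v) (C := M' * ‖v‖) (fun s hs => by
            refine (S s).le_of_opNorm_le (hb' _ ?_) _
            rw [uIoc_of_le (by linarith)] at hs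
            linarith [hs.2])
        rwa [sub_zero, abs_of_pos ht0] at this
      rw [h2]
      refine (norm_sub_le _ _).trans ?_
      linarith
    -- A vector v orthogonal to W is tested against J*Jv, which gives Jv = 0 for all small r;
    -- dividing by r and letting r tend to 0 gives v = 0.
    have hperp : Wᗮ = ⊥ := by
      rw [Submodule.eq_bot_iff]
      intro v hv
      have h0 : ∀ r : ℝ, 0 < r → r < 1 → hS.integrated r v = 0 := by
        intro r hr hr1
        have h1 := (Submodule.mem_orthogonal _ _).1 hv _ (hmem r hr hr1 (hS.integrated r v))
        rw [ContinuousLinearMap.adjoint_inner_left] at h1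
        exact inner_self_eq_zero.1 h1
      have h2 := hS.tendsto_integral_div 0 v
      rw [hS.zero_apply] at h2
      refine tendsto_nhds_unique h2 (tendsto_const_nhds.congr' ?_)
      filter_upwards [self_mem_nhdsWithin, mem_nhdsWithin_of_mem_nhds (Iio_mem_nhds
        (zero_lt_one' ℝ))] with t ht ht1
      rw [zero_add, ← hS.integrated_apply, h0 t ht ht1, smul_zero]
    intro x
    refine hcl x ?_
    have := (Submodule.topologicalClosure_eq_top_iff (K := W)).2 hperp
    rw [← Submodule.topologicalClosure_coe, this]
    trivial

theorem hasDerivWithinAt_orbit (hS : IsClampedSemigroup S) {x y : X} (h : HasGenerator S x y)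
    {t : ℝ} (ht : 0 ≤ t) : HasDerivWithinAt (fun s => S s x) (S t y) (Ioi t) t := by
  rw [hasDerivWithinAt_iff_tendsto_slope' (by simp)]
  have h1 : Tendsto (fun s : ℝ => s - t) (𝓝[>] t) (𝓝[>] 0) := by
    rw [tendsto_nhdsWithin_iff]
    constructor
    · have : Continuous fun s : ℝ => s - t := by fun_prop
      simpa using (this.tendsto t).mono_left nhdsWithin_le_nhds
    · filter_upwards [self_mem_nhdsWithin] with s hs
      exact sub_pos.2 (mem_Ioi.1 hs)
  have h2 := ((S t).continuous.tendsto y).comp (h.comp h1)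
  refine h2.congr' ?_
  filter_upwards [self_mem_nhdsWithin] with s hs
  have hs' : t < s := hs
  simp only [Function.comp_apply, slope, vsub_eq_sub]
  rw [map_smul, map_sub, ← hS.add_apply ht (by linarith)]
  congr 3
  ring_nf

theorem hasGenerator_apply (hS : IsClampedSemigroup S) {x y : X} (h : HasGenerator S x y)
    {t : ℝ} (ht : 0 ≤ t) : HasGenerator S (S t x) (S t y) := by
  have h2 := ((S t).continuous.tendsto y).comp h
  refine h2.congr' ?_
  filter_upwards [self_mem_nhdsWithin] with s hs
  have hs' : 0 < s := hs
  simp only [Function.comp_apply]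
  rw [map_smul, map_sub, ← hS.add_apply ht hs'.le, ← hS.add_apply hs'.le ht, add_comm]

theorem apply_sub_self (hS : IsClampedSemigroup S) {x y : X} (h : HasGenerator S x y)
    {t : ℝ} (ht : 0 ≤ t) : S t x - x = ∫ s in (0 : ℝ)..t, S s y := by
  rw [intervalIntegral.integral_eq_sub_of_hasDeriv_right_of_le ht
    (hS.continuous_orbit x).continuousOn
    (fun s hs => hS.hasDerivWithinAt_orbit h hs.1.le) (hS.intervalIntegrable y 0 t),
    hS.zero_apply]

/-- The semigroup law gives only a right derivative directly. That suffices for the integral formula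
`apply_sub_self`, whose right-hand side is differentiable from both sides. -/
theorem hasDerivAt_orbit (hS : IsClampedSemigroup S) {x y : X} (h : HasGenerator S x y)
    {t : ℝ} (ht : 0 < t) : HasDerivAt (fun s => S s x) (S t y) t := by
  have h1 := intervalIntegral.integral_hasDerivAt_right (hS.intervalIntegrable y 0 t)
    ((hS.continuous_orbit y).stronglyMeasurableAtFilter _ _) (hS.continuous_orbit y).continuousAt
  refine (h1.const_add x).congr_of_eventuallyEq ?_
  filter_upwards [Ioi_mem_nhds ht] with s hs
  rw [← hS.apply_sub_self h (le_of_lt hs), add_sub_cancel]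

end IsClampedSemigroup

/-- The fundamental theorem of calculus along two orbits; all Lyapunov-type identities below are
read off from it on the domains of the generators. -/
theorem integral_inner_orbits {S : ℝ → X →L[ℝ] X} {R : ℝ → Y →L[ℝ] Y}
    (hS : IsClampedSemigroup S) (hR : IsClampedSemigroup R) (M : X →L[ℝ] Y) {x y : X} {x' y' : Y}
    (h : HasGenerator S x y) (h' : HasGenerator R x' y') {t : ℝ} (ht : 0 ≤ t) :
    ⟪M (S t x), R t x'⟫ - ⟪M x, x'⟫
      = ∫ s in (0 : ℝ)..t, (⟪M (S s x), R s y'⟫ + ⟪M (S s y), R s x'⟫) := by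
  have hx := hS.continuous_orbit x
  have hy := hS.continuous_orbit y
  have hx' := hR.continuous_orbit x'
  have hy' := hR.continuous_orbit y'
  rw [intervalIntegral.integral_eq_sub_of_hasDeriv_right_of_le
    (f := fun s => ⟪M (S s x), R s x'⟫) ht]
  · rw [hS.zero_apply, hR.zero_apply]
  · exact Continuous.continuousOn (by fun_prop)
  · intro s hs
    exact ((M.hasFDerivAt.comp_hasDerivWithinAt s (hS.hasDerivWithinAt_orbit h hs.1.le)).inner ℝ
      (hR.hasDerivWithinAt_orbit h' hs.1.le))
  · exact Continuous.intervalIntegrable (by fun_prop) _ _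

end Semigroup

/-! ### Mild solutions forward and backward in time: splitting, change of semigroup, conjugation,
duality. -/

section Mild

variable {X Z : Type*}
  [NormedAddCommGroup X] [InnerProductSpace ℝ X] [CompleteSpace X]
  [NormedAddCommGroup Z] [NormedSpace ℝ Z]

theorem intervalIntegrable_of_bound {φ : ℝ → X → Z} (hφ : Continuous fun p : ℝ × X => φ p.1 p.2)
    {f : ℝ → X} {a b M : ℝ} (hf : IntervalIntegrable f volume a b)
    (hM : ∀ r ∈ uIoc a b, ∀ x, ‖φ r x‖ ≤ M * ‖x‖) :
    IntervalIntegrable (fun r => φ r (f r)) volume a b := by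
  rw [intervalIntegrable_iff] at hf ⊢
  refine (hf.norm.const_mul M).mono' ?_ ?_
  · exact hφ.comp_aestronglyMeasurable (aestronglyMeasurable_id.prodMk hf.aestronglyMeasurable)
  · filter_upwards [ae_restrict_mem measurableSet_uIoc] with r hr using hM r hr _

/-- Fubini on the triangle a ≤ r ≤ s ≤ b. The forcing is only integrable in time; joint continuity
of the kernel gives measurability and its linear growth in the last variable gives integrability on
the square. -/
theorem integral_swap_triangle {φ : ℝ → ℝ → X → Z}
    (hφ : Continuous fun p : ℝ × ℝ × X => φ p.1 p.2.1 p.2.2) {f : ℝ → X} {a b M : ℝ}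
    (hab : a ≤ b) (hf : IntervalIntegrable f volume a b)
    (hM : ∀ s ∈ Icc a b, ∀ r ∈ Icc a b, ∀ x, ‖φ s r x‖ ≤ M * ‖x‖) :
    ∫ s in a..b, ∫ r in a..s, φ s r (f r) = ∫ r in a..b, ∫ s in r..b, φ s r (f r) := by
  have hf' : Integrable f (volume.restrict (Ioc a b)) :=
    (intervalIntegrable_iff_integrableOn_Ioc_of_le hab).1 hf
  set μ := (volume : Measure ℝ).restrict (Ioc a b) with hμ
  let D : Set (ℝ × ℝ) := {p | p.2 ≤ p.1}
  have hD : MeasurableSet D := (isClosed_le continuous_snd continuous_fst).measurableSet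
  let k : ℝ → ℝ → Z := fun s r => D.indicator (fun p => φ p.1 p.2 (f p.2)) (s, r)
  have hmem : ∀ᵐ p ∂μ.prod μ, p ∈ Ioc a b ×ˢ Ioc a b := by
    rw [hμ, Measure.prod_restrict]
    exact ae_restrict_mem (measurableSet_Ioc.prod measurableSet_Ioc)
  have hk : Integrable (Function.uncurry k) (μ.prod μ) := by
    have h1 : AEStronglyMeasurable (fun p : ℝ × ℝ => φ p.1 p.2 (f p.2)) (μ.prod μ) :=
      hφ.comp_aestronglyMeasurable (measurable_fst.aestronglyMeasurable.prodMk
        (measurable_snd.aestronglyMeasurable.prodMk hf'.aestronglyMeasurable.comp_snd))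
    refine (((hf'.norm.const_mul M).comp_snd μ)).mono' (h1.indicator hD) ?_
    filter_upwards [hmem] with p hp
    refine le_trans (norm_indicator_le_norm_self (fun p : ℝ × ℝ => φ p.1 p.2 (f p.2)) p) ?_
    exact hM _ (Ioc_subset_Icc_self hp.1) _ (Ioc_subset_Icc_self hp.2) _
  have hswap := integral_integral_swap hk
  rw [intervalIntegral.integral_of_le hab, intervalIntegral.integral_of_le hab]
  have hl : ∀ s ∈ Ioc a b, ∫ r, k s r ∂μ = ∫ r in a..s, φ s r (f r) := by
    intro s hs
    have h1 : ∀ r, k s r = (Iic s).indicator (fun r => φ s r (f r)) r := fun r => rfl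
    simp_rw [h1]
    rw [integral_indicator measurableSet_Iic, intervalIntegral.integral_of_le hs.1.le, hμ,
      Measure.restrict_restrict measurableSet_Iic]
    congr 2
    ext r
    simp only [mem_inter_iff, mem_Iic, mem_Ioc]
    constructor
    · rintro ⟨h1, h2, h3⟩; exact ⟨h2, h1⟩
    · rintro ⟨h1, h2⟩; exact ⟨h2, h1, h2.trans hs.2⟩
  have hr : ∀ r ∈ Ioc a b, ∫ s, k s r ∂μ = ∫ s in r..b, φ s r (f r) := by
    intro r hr
    have h1 : ∀ s, k s r = (Ici r).indicator (fun s => φ s r (f r)) s := fun r => rfl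
    simp_rw [h1]
    rw [integral_indicator measurableSet_Ici, intervalIntegral.integral_of_le hr.2, hμ,
      Measure.restrict_restrict measurableSet_Ici, ← integral_Icc_eq_integral_Ioc]
    congr 2
    ext s
    simp only [mem_inter_iff, mem_Ici, mem_Ioc, mem_Icc]
    constructor
    · rintro ⟨h1, h2, h3⟩; exact ⟨h1, h3⟩
    · rintro ⟨h1, h2⟩; exact ⟨h1, hr.1.trans_le h1, h2⟩
  rw [← setIntegral_congr_fun measurableSet_Ioc hl, ← setIntegral_congr_fun measurableSet_Ioc hr]
  exact hswap

namespace IsClampedSemigroup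

variable {S : ℝ → X →L[ℝ] X}

theorem intervalIntegrable_conv (hS : IsClampedSemigroup S) {f : ℝ → X} {a b : ℝ}
    (hf : IntervalIntegrable f volume a b) (t : ℝ) :
    IntervalIntegrable (fun r => S (t - r) (f r)) volume a b := by
  obtain ⟨M, hM, hb⟩ := hS.norm_le_of_le (t - min a b)
  refine intervalIntegrable_of_bound (φ := fun r x => S (t - r) x)
    (hS.continuous_comp (by fun_prop) (by fun_prop)) hf (M := M) fun r hr x => ?_
  exact (S _).le_of_opNorm_le (hb _ (by linarith [hr.1])) _

theorem intervalIntegrable_corr (hS : IsClampedSemigroup S) {f : ℝ → X} {a b : ℝ}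
    (hf : IntervalIntegrable f volume a b) (t : ℝ) :
    IntervalIntegrable (fun r => S (r - t) (f r)) volume a b := by
  obtain ⟨M, hM, hb⟩ := hS.norm_le_of_le (max a b - t)
  refine intervalIntegrable_of_bound (φ := fun r x => S (r - t) x)
    (hS.continuous_comp (by fun_prop) (by fun_prop)) hf (M := M) fun r hr x => ?_
  exact (S _).le_of_opNorm_le (hb _ (by linarith [hr.2])) _

theorem continuousOn_conv (hS : IsClampedSemigroup S) {f : ℝ → X} {a b : ℝ}
    (hf : IntervalIntegrable f volume a b) :
    ContinuousOn (fun t => ∫ r in a..t, S (t - r) (f r)) (Icc a b) := by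
  rcases lt_or_ge b a with hab | hab
  · rw [Icc_eq_empty (not_le.2 hab)]; exact continuousOn_empty _
  obtain ⟨M, hM, hb⟩ := hS.norm_le_of_le (b - a)
  -- For r ≥ t the clamped S(t − r) is the identity, so the convolution up to t equals the integral
  -- over the fixed interval [a, b] minus the tail of f. The first is continuous by dominated
  -- convergence, the second as a primitive.
  have h1 : ContinuousOn (fun t => ∫ r in a..b, S (t - r) (f r)) (Icc a b) := by
    have hf' := (intervalIntegrable_iff_integrableOn_Ioc_of_le hab).1 hf
    simp only [intervalIntegral.integral_of_le hab]
    refine continuousOn_of_dominated (bound := fun r => M * ‖f r‖) ?_ ?_ ?_ ?_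
    · intro t ht
      exact ((intervalIntegrable_iff_integrableOn_Ioc_of_le hab).1
        (hS.intervalIntegrable_conv hf t)).aestronglyMeasurable
    · intro t ht
      filter_upwards [ae_restrict_mem measurableSet_Ioc] with r hr
      exact (S _).le_of_opNorm_le (hb _ (by linarith [hr.1, ht.2])) _
    · exact hf'.norm.const_mul M
    · exact Eventually.of_forall fun r =>
        (hS.continuous_comp (by fun_prop) continuous_const).continuousOn
  have h2 : ContinuousOn (fun t => ∫ r in t..b, f r) (Icc a b) := by
    have := intervalIntegral.continuousOn_primitive_interval_left (a := a) (b := b) (f := f)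
      (μ := volume) (by rw [uIcc_of_le hab]; exact (intervalIntegrable_iff_integrableOn_Icc_of_le hab).1 hf)
    rwa [uIcc_of_le hab] at this
  refine (h1.sub h2).congr fun t ht => ?_
  have hsub : ∀ c d, c ∈ Icc a b → d ∈ Icc a b → IntervalIntegrable f volume c d := fun c d hc hd =>
    hf.mono_set (by rw [uIcc_of_le hab]; exact uIcc_subset_Icc hc hd)
  have ha : a ∈ Icc a b := ⟨le_rfl, hab⟩
  have hb' : b ∈ Icc a b := ⟨hab, le_rfl⟩
  have h3 := intervalIntegral.integral_add_adjacent_intervals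
    (hS.intervalIntegrable_conv (hsub a t ha ht) t) (hS.intervalIntegrable_conv (hsub t b ht hb') t)
  have h4 : ∫ r in t..b, S (t - r) (f r) = ∫ r in t..b, f r := by
    refine intervalIntegral.integral_congr fun r hr => ?_
    rw [uIcc_of_le ht.2] at hr
    rw [hS.clamp _ (by linarith [hr.1])]; rfl
  change _ = (∫ r in a..b, S (t - r) (f r)) - ∫ r in t..b, f r
  rw [← h3, h4, add_sub_cancel_right]

end IsClampedSemigroup

/-- `y` is a mild solution of `y' = A y + f` on `[a, b]`, in two-parameter form. -/
def MildOn (S : ℝ → X →L[ℝ] X) (f y : ℝ → X) (a b : ℝ) : Prop :=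
  ContinuousOn y (Icc a b) ∧ ∀ s ∈ Icc a b, ∀ t ∈ Icc s b,
    y t = S (t - s) (y s) + ∫ r in s..t, S (t - r) (f r)

/-- `l` is a mild solution of `l' = -A* l + g` on `[a, b]`. -/
def BackMildOn (S : ℝ → X →L[ℝ] X) (g l : ℝ → X) (a b : ℝ) : Prop :=
  MildOn (fun t => (S t).adjoint) (fun r => -g (-r)) (fun r => l (-r)) (-b) (-a)

theorem intervalIntegrable_sub {f : ℝ → X} {a b s t : ℝ} (hf : IntervalIntegrable f volume a b)
    (hs : s ∈ Icc a b) (ht : t ∈ Icc a b) : IntervalIntegrable f volume s t :=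
  hf.mono_set (by rw [uIcc_of_le (hs.1.trans hs.2)]; exact uIcc_subset_Icc hs ht)

variable {S R : ℝ → X →L[ℝ] X}

theorem integral_conv_split (hS : IsClampedSemigroup S) {f : ℝ → X} {a s t : ℝ} (has : a ≤ s)
    (hst : s ≤ t) (hf : IntervalIntegrable f volume a t) :
    ∫ r in a..t, S (t - r) (f r)
      = S (t - s) (∫ r in a..s, S (s - r) (f r)) + ∫ r in s..t, S (t - r) (f r) := by
  have ha : a ∈ Icc a t := ⟨le_rfl, has.trans hst⟩
  have hs : s ∈ Icc a t := ⟨has, hst⟩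
  have ht : t ∈ Icc a t := ⟨has.trans hst, le_rfl⟩
  have h1 := intervalIntegrable_sub hf ha hs
  rw [← intervalIntegral.integral_add_adjacent_intervals (hS.intervalIntegrable_conv h1 t)
    (hS.intervalIntegrable_conv (intervalIntegrable_sub hf hs ht) t),
    ← ContinuousLinearMap.intervalIntegral_comp_comm _ (hS.intervalIntegrable_conv h1 s)]
  congr 1
  refine intervalIntegral.integral_congr fun r hr => ?_
  rw [uIcc_of_le has] at hr
  change S (t - r) (f r) = S (t - s) (S (s - r) (f r))
  rw [← hS.add_apply (by linarith) (by linarith [hr.2])]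
  congr 2; ring

/-- Splitting the convolution at s removes the privileged role of the initial time. In the
two-parameter form, restriction, concatenation and time shifts become immediate. -/
theorem mildOn_of_initial (hS : IsClampedSemigroup S) {f y : ℝ → X} {a b : ℝ}
    (hf : IntervalIntegrable f volume a b) (hc : ContinuousOn y (Icc a b))
    (h : ∀ t ∈ Icc a b, y t = S (t - a) (y a) + ∫ r in a..t, S (t - r) (f r)) :
    MildOn S f y a b := by
  refine ⟨hc, fun s hs t ht => ?_⟩
  have hat : t ∈ Icc a b := ⟨hs.1.trans ht.1, ht.2⟩
  have ha : a ∈ Icc a b := ⟨le_rfl, hs.1.trans hs.2⟩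
  rw [h t hat, h s hs, integral_conv_split hS hs.1 ht.1 (intervalIntegrable_sub hf ha hat), map_add,
    ← hS.add_apply (by linarith [ht.1]) (by linarith [hs.1]), ← add_assoc]
  congr 4; ring

theorem mildOn_iff (hS : IsClampedSemigroup S) {f y : ℝ → X} {T : ℝ} (hT : 0 ≤ T)
    (hf : IntervalIntegrable f volume 0 T) : IsMildSolution S T f y ↔ MildOn S f y 0 T := by
  constructor
  · rintro ⟨hc, h⟩
    exact mildOn_of_initial hS hf hc fun t ht => by rw [sub_zero]; exact h t ht
  · rintro ⟨hc, h⟩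
    refine ⟨hc, fun t ht => ?_⟩
    have := h 0 ⟨le_rfl, hT⟩ t ht
    rwa [sub_zero] at this

theorem MildOn.mono {f y : ℝ → X} {a b a' b' : ℝ} (h : MildOn S f y a b) (ha : a ≤ a')
    (hb : b' ≤ b) : MildOn S f y a' b' :=
  ⟨h.1.mono (Icc_subset_Icc ha hb), fun s hs t ht =>
    h.2 s ⟨ha.trans hs.1, hs.2.trans hb⟩ t ⟨ht.1, ht.2.trans hb⟩⟩

theorem MildOn.concat (hS : IsClampedSemigroup S) {f y : ℝ → X} {a b c : ℝ}
    (hab : a ≤ b) (hbc : b ≤ c) (hf : IntervalIntegrable f volume a c)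
    (h : MildOn S f y a b) (h' : MildOn S f y b c) : MildOn S f y a c := by
  have ha : a ∈ Icc a c := ⟨le_rfl, hab.trans hbc⟩
  have hb : b ∈ Icc a c := ⟨hab, hbc⟩
  refine mildOn_of_initial hS hf ?_ fun t ht => ?_
  · rw [← Icc_union_Icc_eq_Icc hab hbc]
    exact h.1.union_of_isClosed h'.1 isClosed_Icc isClosed_Icc
  · rcases le_total t b with htb | htb
    · exact h.2 a ⟨le_rfl, hab⟩ t ⟨ht.1, htb⟩
    · rw [h'.2 b ⟨le_rfl, hbc⟩ t ⟨htb, ht.2⟩, h.2 a ⟨le_rfl, hab⟩ b ⟨hab, le_rfl⟩,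
        integral_conv_split hS hab htb (intervalIntegrable_sub hf ha ht), map_add,
        ← hS.add_apply (by linarith) (by linarith), ← add_assoc]
      congr 4; ring

theorem MildOn.shift {f y : ℝ → X} {a b : ℝ} (h : MildOn S f y a b) (d : ℝ) :
    MildOn S (fun t => f (t - d)) (fun t => y (t - d)) (a + d) (b + d) := by
  refine ⟨?_, fun s hs t ht => ?_⟩
  · refine h.1.comp (by fun_prop) fun t ht => ⟨by linarith [ht.1], by linarith [ht.2]⟩
  · simp only []
    rw [h.2 (s - d) ⟨by linarith [hs.1], by linarith [hs.2]⟩ (t - d)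
      ⟨by linarith [ht.1], by linarith [ht.2]⟩, sub_sub_sub_cancel_right]
    congr 1
    have := intervalIntegral.integral_comp_sub_right (a := s) (b := t)
      (fun r => S (t - d - r) (f r)) d
    rw [← this]
    refine intervalIntegral.integral_congr fun r _ => ?_
    congr 2; ring

theorem MildOn.congr {f f' y y' : ℝ → X} {a b : ℝ} (h : MildOn S f y a b)
    (hf : ∀ᵐ t, t ∈ Ioc a b → f' t = f t) (hy : EqOn y' y (Icc a b)) : MildOn S f' y' a b := by
  refine ⟨h.1.congr hy, fun s hs t ht => ?_⟩
  rw [hy hs, hy ⟨hs.1.trans ht.1, ht.2⟩, h.2 s hs t ht]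
  congr 1
  refine intervalIntegral.integral_congr_ae ?_
  filter_upwards [hf] with r hr hr'
  rw [uIoc_of_le ht.1] at hr'
  rw [hr ⟨hs.1.trans_lt hr'.1, hr'.2.trans ht.2⟩]

theorem MildOn.add (hS : IsClampedSemigroup S) {f f' y y' : ℝ → X} {a b : ℝ}
    (hf : IntervalIntegrable f volume a b) (hf' : IntervalIntegrable f' volume a b)
    (h : MildOn S f y a b) (h' : MildOn S f' y' a b) :
    MildOn S (fun t => f t + f' t) (fun t => y t + y' t) a b := by
  refine ⟨h.1.add h'.1, fun s hs t ht => ?_⟩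
  have hat : t ∈ Icc a b := ⟨hs.1.trans ht.1, ht.2⟩
  simp only [map_add]
  rw [intervalIntegral.integral_add
    (hS.intervalIntegrable_conv (intervalIntegrable_sub hf hs hat) t)
    (hS.intervalIntegrable_conv (intervalIntegrable_sub hf' hs hat) t), h.2 s hs t ht,
    h'.2 s hs t ht]
  abel

theorem MildOn.neg {f y : ℝ → X} {a b : ℝ} (h : MildOn S f y a b) :
    MildOn S (fun t => -f t) (fun t => -y t) a b := by
  refine ⟨h.1.neg, fun s hs t ht => ?_⟩
  simp only [map_neg]
  rw [intervalIntegral.integral_neg, h.2 s hs t ht, neg_add]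

theorem MildOn.sub (hS : IsClampedSemigroup S) {f f' y y' : ℝ → X} {a b : ℝ}
    (hf : IntervalIntegrable f volume a b) (hf' : IntervalIntegrable f' volume a b)
    (h : MildOn S f y a b) (h' : MildOn S f' y' a b) :
    MildOn S (fun t => f t - f' t) (fun t => y t - y' t) a b := by
  simp only [sub_eq_add_neg]
  exact h.add hS hf hf'.neg h'.neg

theorem mildOn_conv (hS : IsClampedSemigroup S) {f : ℝ → X} {a b : ℝ}
    (hf : IntervalIntegrable f volume a b) (x : X) :
    MildOn S f (fun t => S (t - a) x + ∫ r in a..t, S (t - r) (f r)) a b := by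
  refine mildOn_of_initial hS hf ?_ fun t ht => ?_
  · exact (hS.continuous_comp (by fun_prop) continuous_const).continuousOn.add
      (hS.continuousOn_conv hf)
  · simp [hS.zero_apply]

/-- The variation of constants formula expressing the semigroup `R` of `A + L` in terms of the
semigroup `S` of `A`. -/
def IsDuhamel (S : ℝ → X →L[ℝ] X) (L : X →L[ℝ] X) (R : ℝ → X →L[ℝ] X) : Prop :=
  ∀ t : ℝ, 0 ≤ t → ∀ x, R t x = S t x + ∫ s in (0 : ℝ)..t, S (t - s) (L (R s x))

/-- Formally, y' = (A + L)y + f is rewritten as y' = Ay + (f + Ly). For mild solutions, the Duhamel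
formula for R is inserted into the variation of constants formula of y, and the resulting double
integrals match after Fubini. -/
theorem MildOn.change_semigroup (hS : IsClampedSemigroup S) (hR : IsClampedSemigroup R)
    {L : X →L[ℝ] X} (hD : IsDuhamel S L R) {f y : ℝ → X} {a b : ℝ}
    (hf : IntervalIntegrable f volume a b) (h : MildOn R f y a b) :
    MildOn S (fun t => f t + L (y t)) y a b := by
  rcases lt_or_ge b a with hab | hab
  · refine ⟨h.1, fun s hs => ?_⟩
    exact absurd (hs.1.trans hs.2) (not_le.2 hab)
  have hLy : IntervalIntegrable (fun t => L (y t)) volume a b :=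
    ContinuousOn.intervalIntegrable (by
      rw [uIcc_of_le hab]; exact L.continuous.comp_continuousOn h.1)
  refine mildOn_of_initial hS (hf.add hLy) h.1 fun t ht => ?_
  have ha : a ∈ Icc a b := ⟨le_rfl, hab⟩
  have hfat := intervalIntegrable_sub hf ha ht
  have hD' : ∀ r ∈ Icc a t, ∀ x, R (t - r) x
      = S (t - r) x + ∫ s in r..t, S (t - s) (L (R (s - r) x)) := by
    intro r hr x
    rw [hD (t - r) (by linarith [hr.2]) x]
    congr 1
    have := intervalIntegral.integral_comp_sub_right (a := r) (b := t)
      (fun s => S (t - r - s) (L (R s x))) r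
    rw [sub_self] at this
    rw [← this]
    refine intervalIntegral.integral_congr fun s _ => ?_
    congr 2; ring
  obtain ⟨M₁, hM₁, hb₁⟩ := hS.norm_le_of_le (t - a)
  obtain ⟨M₂, hM₂, hb₂⟩ := hR.norm_le_of_le (t - a)
  have hφ : Continuous fun p : ℝ × ℝ × X => S (t - p.1) (L (R (p.1 - p.2.1) p.2.2)) :=
    hS.continuous_comp (by fun_prop)
      (L.continuous.comp (hR.continuous_comp (by fun_prop) (by fun_prop)))
  have hφb : ∀ s ∈ Icc a t, ∀ r ∈ Icc a t, ∀ x,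
      ‖S (t - s) (L (R (s - r) x))‖ ≤ (M₁ * (‖L‖ * M₂)) * ‖x‖ := by
    intro s hs r hr x
    have h1 := (R (s - r)).le_of_opNorm_le (hb₂ _ (by linarith [hs.2, hr.1])) x
    have h2 := L.le_opNorm (R (s - r) x)
    have h3 := (S (t - s)).le_of_opNorm_le (hb₁ _ (by linarith [hs.1])) (L (R (s - r) x))
    calc _ ≤ M₁ * (‖L‖ * (M₂ * ‖x‖)) := by
          refine h3.trans ?_
          gcongr
          exact h2.trans (by gcongr)
      _ = _ := by ring
  have hswap := integral_swap_triangle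
    (φ := fun s r x => S (t - s) (L (R (s - r) x))) hφ ht.1 hfat hφb
  have hfub : IntervalIntegrable (fun r => ∫ s in r..t, S (t - s) (L (R (s - r) (f r))))
      volume a t := by
    have h1 := (hR.intervalIntegrable_conv hfat t).sub (hS.intervalIntegrable_conv hfat t)
    refine h1.congr fun r hr => ?_
    rw [uIoc_of_le ht.1] at hr
    rw [hD' r ⟨hr.1.le, hr.2⟩, add_sub_cancel_left]
  have hLat := intervalIntegrable_sub hLy ha ht
  have e1 : ∫ r in a..t, R (t - r) (f r) = (∫ r in a..t, S (t - r) (f r))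
      + ∫ r in a..t, ∫ s in r..t, S (t - s) (L (R (s - r) (f r))) := by
    rw [← intervalIntegral.integral_add (hS.intervalIntegrable_conv hfat t) hfub]
    refine intervalIntegral.integral_congr fun r hr => ?_
    rw [uIcc_of_le ht.1] at hr
    exact hD' r hr (f r)
  have hRya : IntervalIntegrable (fun s => L (R (s - a) (y a))) volume a t :=
    Continuous.intervalIntegrable
      (L.continuous.comp (hR.continuous_comp (by fun_prop) continuous_const)) _ _
  have e2 : ∫ s in a..t, S (t - s) (L (y s)) = (∫ s in a..t, S (t - s) (L (R (s - a) (y a))))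
      + ∫ s in a..t, ∫ r in a..s, S (t - s) (L (R (s - r) (f r))) := by
    rw [← sub_eq_iff_eq_add', ← intervalIntegral.integral_sub
      (hS.intervalIntegrable_conv hLat t) (hS.intervalIntegrable_conv hRya t)]
    refine intervalIntegral.integral_congr fun s hs => ?_
    rw [uIcc_of_le ht.1] at hs
    have hsb : s ∈ Icc a b := ⟨hs.1, hs.2.trans ht.2⟩
    change S (t - s) (L (y s)) - S (t - s) (L (R (s - a) (y a))) = ∫ r in a..s, _
    rw [← map_sub, ← map_sub, h.2 a ha s ⟨hs.1, hsb.2⟩, add_sub_cancel_left]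
    have := hR.intervalIntegrable_conv (intervalIntegrable_sub hf ha hsb) s
    rw [← ContinuousLinearMap.comp_apply, ← ContinuousLinearMap.intervalIntegral_comp_comm _ this]
    rfl
  simp only [map_add]
  rw [intervalIntegral.integral_add (hS.intervalIntegrable_conv hfat t)
    (hS.intervalIntegrable_conv hLat t), e2, hswap, h.2 a ha t ht, e1,
    hD' a ⟨le_rfl, ht.1⟩ (y a)]
  abel

theorem BackMildOn.eq {g l : ℝ → X} {a b s t : ℝ} (h : BackMildOn S g l a b) (hs : s ∈ Icc a b)
    (ht : t ∈ Icc s b) :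
    l s = (S (t - s)).adjoint (l t) - ∫ r in s..t, (S (r - s)).adjoint (g r) := by
  have h1 := h.2 (-t) ⟨neg_le_neg ht.2, neg_le_neg (hs.1.trans ht.1)⟩ (-s)
    ⟨neg_le_neg ht.1, neg_le_neg hs.1⟩
  simp only [neg_neg, map_neg, intervalIntegral.integral_neg] at h1
  have h2 : ∫ r in (-t)..(-s), (S (-s - r)).adjoint (g (-r))
      = ∫ r in s..t, (S (r - s)).adjoint (g r) := by
    have := intervalIntegral.integral_comp_neg (a := s) (b := t)
      (fun r => (S (-s - r)).adjoint (g (-r)))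
    rw [← this]
    refine intervalIntegral.integral_congr fun r _ => ?_
    simp only [neg_neg]
    congr 3; ring
  rw [h1, h2, show -s - -t = t - s by ring, ← sub_eq_add_neg]

theorem BackMildOn.continuousOn {g l : ℝ → X} {a b : ℝ} (h : BackMildOn S g l a b) :
    ContinuousOn l (Icc a b) := by
  have h1 : ContinuousOn (fun t => l (- -t)) (Icc a b) :=
    h.1.comp (f := fun t => -t) (by fun_prop) fun t ht => ⟨neg_le_neg ht.2, neg_le_neg ht.1⟩
  simpa only [neg_neg] using h1

theorem intervalIntegrable_comp_neg {g : ℝ → X} {a b : ℝ} (hg : IntervalIntegrable g volume a b) :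
    IntervalIntegrable (fun r => g (-r)) volume (-b) (-a) := by
  have := (IntervalIntegrable.iff_comp_neg (f := g) (a := a) (b := b)).1 hg
  exact this.symm

theorem backMildOn_of_final (hS : IsClampedSemigroup S) {g l : ℝ → X} {a b : ℝ}
    (hg : IntervalIntegrable g volume a b) (hc : ContinuousOn l (Icc a b))
    (h : ∀ t ∈ Icc a b,
      l t = (S (b - t)).adjoint (l b) - ∫ r in t..b, (S (r - t)).adjoint (g r)) :
    BackMildOn S g l a b := by
  refine mildOn_of_initial hS.adjoint (intervalIntegrable_comp_neg hg).neg ?_ fun t ht => ?_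
  · exact hc.comp (f := fun t => -t) (by fun_prop) fun t ht =>
      ⟨by linarith [ht.2], by linarith [ht.1]⟩
  · simp only [neg_neg, map_neg, intervalIntegral.integral_neg]
    have h2 : ∫ r in (-b)..t, (S (t - r)).adjoint (g (-r))
        = ∫ r in (-t)..b, (S (r - -t)).adjoint (g r) := by
      have := intervalIntegral.integral_comp_neg (a := -t) (b := b)
        (fun r => (S (t - r)).adjoint (g (-r)))
      rw [neg_neg] at this
      rw [← this]
      refine intervalIntegral.integral_congr fun r _ => ?_
      simp only [neg_neg]
      congr 3; ring
    rw [h (-t) ⟨by linarith [ht.2], by linarith [ht.1]⟩, h2,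
      show b - -t = t - -b by ring, ← sub_eq_add_neg]

theorem backMildOn_iff (hS : IsClampedSemigroup S) {g l : ℝ → X} {T : ℝ}
    (hg : IntervalIntegrable g volume 0 T) :
    IsBackwardMildSolution S T g l ↔ BackMildOn S g l 0 T :=
  ⟨fun h => backMildOn_of_final hS hg h.1 h.2,
    fun h => ⟨h.continuousOn, fun _ ht => h.eq ht ⟨ht.2, le_rfl⟩⟩⟩

theorem BackMildOn.mono {g l : ℝ → X} {a b a' b' : ℝ} (h : BackMildOn S g l a b) (ha : a ≤ a')
    (hb : b' ≤ b) : BackMildOn S g l a' b' :=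
  MildOn.mono h (neg_le_neg hb) (neg_le_neg ha)

theorem BackMildOn.concat (hS : IsClampedSemigroup S) {g l : ℝ → X} {a b c : ℝ}
    (hab : a ≤ b) (hbc : b ≤ c) (hg : IntervalIntegrable g volume a c)
    (h : BackMildOn S g l a b) (h' : BackMildOn S g l b c) : BackMildOn S g l a c :=
  MildOn.concat hS.adjoint (neg_le_neg hbc) (neg_le_neg hab) (intervalIntegrable_comp_neg hg).neg
    h' h

theorem BackMildOn.shift {g l : ℝ → X} {a b : ℝ} (h : BackMildOn S g l a b) (d : ℝ) :
    BackMildOn S (fun t => g (t - d)) (fun t => l (t - d)) (a + d) (b + d) := by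
  have := MildOn.shift h (-d)
  unfold BackMildOn
  convert this using 3 <;> ring_nf

theorem BackMildOn.congr {g g' l l' : ℝ → X} {a b : ℝ} (h : BackMildOn S g l a b)
    (hg : ∀ᵐ t, t ∈ Ioo a b → g' t = g t) (hl : EqOn l' l (Icc a b)) : BackMildOn S g' l' a b := by
  refine MildOn.congr h ?_ fun t ht => hl ⟨by linarith [ht.2], by linarith [ht.1]⟩
  -- Time reversal carries half-open intervals to those open at the other end; working with the open
  -- interval and discarding one point avoids the mismatch.
  have h1 : ∀ᵐ t : ℝ, -t ∈ Ioo a b → g' (-t) = g (-t) :=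
    (Measure.measurePreserving_neg (volume : Measure ℝ)).quasiMeasurePreserving.ae hg
  have h2 : ∀ᵐ t : ℝ, t ≠ -a := by simp [ae_iff, measure_singleton]
  filter_upwards [h1, h2] with t ht h2 hmem
  rw [ht ⟨?_, by linarith [hmem.1]⟩]
  have := lt_of_le_of_ne hmem.2 h2
  linarith

theorem BackMildOn.add (hS : IsClampedSemigroup S) {g g' l l' : ℝ → X} {a b : ℝ}
    (hg : IntervalIntegrable g volume a b) (hg' : IntervalIntegrable g' volume a b)
    (h : BackMildOn S g l a b) (h' : BackMildOn S g' l' a b) :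
    BackMildOn S (fun t => g t + g' t) (fun t => l t + l' t) a b := by
  have := MildOn.add hS.adjoint (intervalIntegrable_comp_neg hg).neg
    (intervalIntegrable_comp_neg hg').neg h h'
  refine this.congr (Eventually.of_forall fun t _ => ?_) fun t _ => rfl
  simp only [Pi.neg_apply]
  abel

theorem BackMildOn.sub (hS : IsClampedSemigroup S) {g g' l l' : ℝ → X} {a b : ℝ}
    (hg : IntervalIntegrable g volume a b) (hg' : IntervalIntegrable g' volume a b)
    (h : BackMildOn S g l a b) (h' : BackMildOn S g' l' a b) :
    BackMildOn S (fun t => g t - g' t) (fun t => l t - l' t) a b := by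
  have := MildOn.sub hS.adjoint (intervalIntegrable_comp_neg hg).neg
    (intervalIntegrable_comp_neg hg').neg h h'
  refine this.congr (Eventually.of_forall fun t _ => ?_) fun t _ => rfl
  simp only [Pi.neg_apply]
  abel

theorem BackMildOn.change_semigroup (hS : IsClampedSemigroup S) (hR : IsClampedSemigroup R)
    {L : X →L[ℝ] X}
    (hD : IsDuhamel (fun t => (S t).adjoint) L.adjoint (fun t => (R t).adjoint)) {g l : ℝ → X}
    {a b : ℝ} (hg : IntervalIntegrable g volume a b) (h : BackMildOn R g l a b) :
    BackMildOn S (fun t => g t - L.adjoint (l t)) l a b := by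
  have := MildOn.change_semigroup hS.adjoint hR.adjoint hD (intervalIntegrable_comp_neg hg).neg h
  refine this.congr (Eventually.of_forall fun t _ => ?_) fun t _ => rfl
  simp only [Pi.neg_apply]
  abel

/-- The integrated form of the operator equation `R* M S - M + ∫ R* N S = 0`. -/
def IsConjugation (S R : ℝ → X →L[ℝ] X) (M N : X →L[ℝ] X) : Prop :=
  ∀ t : ℝ, 0 ≤ t → ∀ x,
    (R t).adjoint (M (S t x)) + ∫ s in (0 : ℝ)..t, (R s).adjoint (N (S s x)) = M x

/-- Formally MA + A_R*M + N = 0, where A and A_R generate S and R, so (My)' = −A_R*(My) + MF − Ny.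
It serves twice: with M = P to pass between w and λ, and with M = −E to pass between z and y. -/
theorem MildOn.conjugate (hS : IsClampedSemigroup S) (hR : IsClampedSemigroup R)
    {M N : X →L[ℝ] X} (hC : IsConjugation S R M N) {F y : ℝ → X} {a b : ℝ}
    (hF : IntervalIntegrable F volume a b) (h : MildOn S F y a b) :
    BackMildOn R (fun t => M (F t) - N (y t)) (fun t => M (y t)) a b := by
  rcases lt_or_ge b a with hab | hab
  · refine ⟨?_, fun s hs => ?_⟩
    · rw [Icc_eq_empty (by simpa using hab)]; exact continuousOn_empty _
    · exact absurd (hs.1.trans hs.2) (by simpa using hab)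
  have hMF : IntervalIntegrable (fun t => M (F t)) volume a b :=
    ⟨M.integrable_comp hF.1, M.integrable_comp hF.2⟩
  have hNy : IntervalIntegrable (fun t => N (y t)) volume a b :=
    ContinuousOn.intervalIntegrable (by
      rw [uIcc_of_le hab]; exact N.continuous.comp_continuousOn h.1)
  refine backMildOn_of_final hR (hMF.sub hNy) (M.continuous.comp_continuousOn h.1) fun t ht => ?_
  have hb : b ∈ Icc a b := ⟨hab, le_rfl⟩
  have hFt := intervalIntegrable_sub hF ht hb
  have hMFt := intervalIntegrable_sub hMF ht hb
  have hNyt := intervalIntegrable_sub hNy ht hb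
  have hR' := hR.adjoint
  have hC' : ∀ r ∈ Icc t b, ∀ x, ∫ s in r..b, (R (s - t)).adjoint (N (S (s - r) x))
      = (R (r - t)).adjoint (M x) - (R (b - t)).adjoint (M (S (b - r) x)) := by
    intro r hr x
    have h1 := hC (b - r) (by linarith [hr.2]) x
    have h2 : (R (b - t)).adjoint (M (S (b - r) x))
        = (R (r - t)).adjoint ((R (b - r)).adjoint (M (S (b - r) x))) := by
      rw [← hR'.add_apply (by linarith [hr.1]) (by linarith [hr.2])]
      congr 3; ring
    have h3 : ∫ s in r..b, (R (s - t)).adjoint (N (S (s - r) x))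
        = (R (r - t)).adjoint (∫ s in (0 : ℝ)..(b - r), (R s).adjoint (N (S s x))) := by
      have h4 : IntervalIntegrable (fun s => (R s).adjoint (N (S s x))) volume 0 (b - r) :=
        Continuous.intervalIntegrable (hR'.continuous_comp continuous_id
          (N.continuous.comp (hS.continuous_comp continuous_id continuous_const))) _ _
      rw [← ContinuousLinearMap.intervalIntegral_comp_comm _ h4]
      have := intervalIntegral.integral_comp_sub_right (a := r) (b := b)
        (fun s => (R (r - t)).adjoint ((R s).adjoint (N (S s x)))) r
      rw [sub_self] at this
      rw [← this]
      refine intervalIntegral.integral_congr fun s hs => ?_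
      rw [uIcc_of_le hr.2] at hs
      rw [← hR'.add_apply (by linarith [hr.1]) (by linarith [hs.1])]
      congr 3; ring
    rw [h3, h2, ← map_sub, eq_sub_of_add_eq' h1]
  obtain ⟨M₁, hM₁, hb₁⟩ := hS.norm_le_of_le (b - t)
  obtain ⟨M₂, hM₂, hb₂⟩ := hR'.norm_le_of_le (b - t)
  have hφ : Continuous fun p : ℝ × ℝ × X =>
      (R (p.1 - t)).adjoint (N (S (p.1 - p.2.1) p.2.2)) :=
    hR'.continuous_comp (by fun_prop)
      (N.continuous.comp (hS.continuous_comp (by fun_prop) (by fun_prop)))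
  have hφb : ∀ s ∈ Icc t b, ∀ r ∈ Icc t b, ∀ x,
      ‖(R (s - t)).adjoint (N (S (s - r) x))‖ ≤ (M₂ * (‖N‖ * M₁)) * ‖x‖ := by
    intro s hs r hr x
    have h1 := (S (s - r)).le_of_opNorm_le (hb₁ _ (by linarith [hs.2, hr.1])) x
    have h2 := N.le_opNorm (S (s - r) x)
    have h3 := ((R (s - t)).adjoint).le_of_opNorm_le (hb₂ _ (by linarith [hs.2]))
      (N (S (s - r) x))
    calc _ ≤ M₂ * (‖N‖ * (M₁ * ‖x‖)) := by
          refine h3.trans ?_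
          gcongr
          exact h2.trans (by gcongr)
      _ = _ := by ring
  have hswap := integral_swap_triangle
    (φ := fun s r x => (R (s - t)).adjoint (N (S (s - r) x))) hφ ht.2 hFt hφb
  have hSyt : IntervalIntegrable (fun s => N (S (s - t) (y t))) volume t b :=
    Continuous.intervalIntegrable
      (N.continuous.comp (hS.continuous_comp (by fun_prop) continuous_const)) _ _
  have e2 : ∫ s in t..b, (R (s - t)).adjoint (N (y s))
      = (∫ s in t..b, (R (s - t)).adjoint (N (S (s - t) (y t))))
        + ∫ s in t..b, ∫ r in t..s, (R (s - t)).adjoint (N (S (s - r) (F r))) := by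
    rw [← sub_eq_iff_eq_add', ← intervalIntegral.integral_sub
      (hR'.intervalIntegrable_corr hNyt t) (hR'.intervalIntegrable_corr hSyt t)]
    refine intervalIntegral.integral_congr fun s hs => ?_
    rw [uIcc_of_le ht.2] at hs
    have hsb : s ∈ Icc a b := ⟨ht.1.trans hs.1, hs.2⟩
    change (R (s - t)).adjoint (N (y s)) - (R (s - t)).adjoint (N (S (s - t) (y t)))
      = ∫ r in t..s, _
    rw [← map_sub, ← map_sub, h.2 t ht s hs, add_sub_cancel_left]
    have := hS.intervalIntegrable_conv (intervalIntegrable_sub hF ht hsb) s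
    rw [← ContinuousLinearMap.comp_apply, ← ContinuousLinearMap.intervalIntegral_comp_comm _ this]
    rfl
  have hSF := hS.intervalIntegrable_conv hFt b
  have hRMS : IntervalIntegrable (fun r => (R (b - t)).adjoint (M (S (b - r) (F r))))
      volume t b :=
    ⟨((R (b - t)).adjoint.comp M).integrable_comp hSF.1,
      ((R (b - t)).adjoint.comp M).integrable_comp hSF.2⟩
  have e3 : ∫ r in t..b, ∫ s in r..b, (R (s - t)).adjoint (N (S (s - r) (F r)))
      = (∫ r in t..b, (R (r - t)).adjoint (M (F r)))
        - (R (b - t)).adjoint (M (∫ r in t..b, S (b - r) (F r))) := by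
    have h1 : (R (b - t)).adjoint (M (∫ r in t..b, S (b - r) (F r)))
        = ∫ r in t..b, (R (b - t)).adjoint (M (S (b - r) (F r))) :=
      (((R (b - t)).adjoint.comp M).intervalIntegral_comp_comm hSF).symm
    rw [h1, ← intervalIntegral.integral_sub (hR'.intervalIntegrable_corr hMFt t) hRMS]
    refine intervalIntegral.integral_congr fun r hr => ?_
    rw [uIcc_of_le ht.2] at hr
    exact hC' r hr (F r)
  simp only [map_sub]
  rw [intervalIntegral.integral_sub (hR'.intervalIntegrable_corr hMFt t)
    (hR'.intervalIntegrable_corr hNyt t), e2, hswap, e3, hC' t ⟨le_rfl, ht.2⟩ (y t),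
    h.2 t ht b ⟨ht.2, le_rfl⟩, sub_self, hR'.zero_apply]
  simp only [map_add]
  abel

/-- The product rule for ⟪l, y⟫, in which the two unbounded terms cancel. Mild solutions need not be
differentiable, so both variation of constants formulas are expanded and the double integrals
exchanged. -/
theorem BackMildOn.inner_sub_inner (hS : IsClampedSemigroup S) {f g y l : ℝ → X} {a b : ℝ}
    (hab : a ≤ b) (hf : IntervalIntegrable f volume a b) (hg : ContinuousOn g (Icc a b))
    (hl : BackMildOn S g l a b) (hy : MildOn S f y a b) :
    ⟪l b, y b⟫ - ⟪l a, y a⟫ = ∫ t in a..b, (⟪l t, f t⟫ + ⟪g t, y t⟫) := by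
  have hS' := hS.adjoint
  have ha : a ∈ Icc a b := ⟨le_rfl, hab⟩
  have hb : b ∈ Icc a b := ⟨hab, le_rfl⟩
  -- A continuous extension of g to the whole line, since the exchange of integrals requires a
  -- kernel continuous everywhere.
  let G : ℝ → X := fun t => g (projIcc a b hab t)
  have hG : Continuous G :=
    hg.comp_continuous (continuous_subtype_val.comp continuous_projIcc) fun t => (projIcc a b hab t).2
  have hGg : ∀ t ∈ Icc a b, G t = g t := fun t ht => by
    change g (projIcc a b hab t) = g t
    rw [projIcc_of_mem hab ht]
  have hgi : IntervalIntegrable g volume a b :=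
    ContinuousOn.intervalIntegrable (by rwa [uIcc_of_le hab])
  obtain ⟨M, hM, hbd⟩ := hS.norm_le_of_le (b - a)
  obtain ⟨Γ, hΓ⟩ := isCompact_Icc.exists_bound_of_continuousOn (s := Icc a b) hG.continuousOn
  have hφ : Continuous fun p : ℝ × ℝ × X => ⟪G p.1, S (p.1 - p.2.1) p.2.2⟫ :=
    (hG.comp continuous_fst).inner (hS.continuous_comp (by fun_prop) (by fun_prop))
  have hφb : ∀ s ∈ Icc a b, ∀ r ∈ Icc a b, ∀ x, ‖⟪G s, S (s - r) x⟫‖ ≤ Γ * M * ‖x‖ := by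
    intro s hs r hr x
    refine (norm_inner_le_norm _ _).trans ?_
    rw [mul_assoc]
    have h1 := hΓ s hs
    exact mul_le_mul h1 ((S _).le_of_opNorm_le (hbd _ (by linarith [hs.2, hr.1])) _)
      (norm_nonneg _) ((norm_nonneg _).trans h1)
  have hswap := integral_swap_triangle (φ := fun s r x => ⟪G s, S (s - r) x⟫) hφ hab hf hφb
  have inner_int : ∀ (v : X) {c d : ℝ} {h : ℝ → X}, IntervalIntegrable h volume c d →
      ∫ t in c..d, ⟪v, h t⟫ = ⟪v, ∫ t in c..d, h t⟫ := fun v c d h hh =>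
    (innerSL ℝ v).intervalIntegral_comp_comm hh
  have inner_ii : ∀ (v : X) {c d : ℝ} {h : ℝ → X}, IntervalIntegrable h volume c d →
      IntervalIntegrable (fun t => ⟪v, h t⟫) volume c d := fun v c d h hh =>
    ⟨(innerSL ℝ v).integrable_comp hh.1, (innerSL ℝ v).integrable_comp hh.2⟩
  have hyc : ContinuousOn y (uIcc a b) := by rw [uIcc_of_le hab]; exact hy.1
  have hgc : ContinuousOn g (uIcc a b) := by rwa [uIcc_of_le hab]
  have hgSy : IntervalIntegrable (fun t => ⟪g t, S (t - a) (y a)⟫) volume a b :=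
    (hgc.inner (hS.continuous_comp (by fun_prop) continuous_const).continuousOn).intervalIntegrable
  have hgy : IntervalIntegrable (fun t => ⟪g t, y t⟫) volume a b :=
    (hgc.inner hyc).intervalIntegrable
  have hconv := hS.intervalIntegrable_conv hf b
  have e1 : ∫ t in a..b, ⟪g t, y t⟫ = (∫ t in a..b, ⟪g t, S (t - a) (y a)⟫)
      + ∫ s in a..b, ∫ r in a..s, ⟪G s, S (s - r) (f r)⟫ := by
    rw [← sub_eq_iff_eq_add', ← intervalIntegral.integral_sub hgy hgSy]
    refine intervalIntegral.integral_congr fun s hs => ?_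
    rw [uIcc_of_le hab] at hs
    change ⟪g s, y s⟫ - ⟪g s, S (s - a) (y a)⟫ = ∫ r in a..s, _
    rw [inner_int _ (hS.intervalIntegrable_conv (intervalIntegrable_sub hf ha hs) s),
      ← inner_sub_right, hGg s hs, hy.2 a ha s hs, add_sub_cancel_left]
  have key : ∀ r ∈ Icc a b, ∀ x, ∫ s in r..b, ⟪G s, S (s - r) x⟫
      = ⟪l b, S (b - r) x⟫ - ⟪l r, x⟫ := by
    intro r hr x
    rw [hl.eq hr ⟨hr.2, le_rfl⟩, inner_sub_left, ContinuousLinearMap.adjoint_inner_left,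
      sub_sub_cancel, real_inner_comm,
      ← inner_int _ (hS'.intervalIntegrable_corr (intervalIntegrable_sub hgi hr hb) r)]
    refine intervalIntegral.integral_congr fun s hs => ?_
    rw [uIcc_of_le hr.2] at hs
    change ⟪G s, S (s - r) x⟫ = ⟪x, (S (s - r)).adjoint (g s)⟫
    rw [ContinuousLinearMap.adjoint_inner_right, hGg s ⟨hr.1.trans hs.1, hs.2⟩, real_inner_comm]
  have hlf : IntervalIntegrable (fun t => ⟪l t, f t⟫) volume a b := by
    obtain ⟨Λ, hΛ⟩ := isCompact_Icc.exists_bound_of_continuousOn hl.continuousOn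
    let l' : ℝ → X := fun t => l (projIcc a b hab t)
    have hl' : Continuous l' := hl.continuousOn.comp_continuous
      (continuous_subtype_val.comp continuous_projIcc) fun t => (projIcc a b hab t).2
    have := intervalIntegrable_of_bound (φ := fun t x => ⟪l' t, x⟫) (M := Λ)
      ((hl'.comp continuous_fst).inner continuous_snd) hf (fun r _ x => by
        refine (norm_inner_le_norm _ _).trans ?_
        gcongr
        exact hΛ _ (projIcc a b hab r).2)
    refine this.congr fun t ht => ?_
    rw [uIoc_of_le hab] at ht
    change ⟪l (projIcc a b hab t), f t⟫ = ⟪l t, f t⟫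
    rw [projIcc_of_mem hab (Ioc_subset_Icc_self ht)]
  have e2 : ∫ r in a..b, ∫ s in r..b, ⟪G s, S (s - r) (f r)⟫
      = ⟪l b, ∫ r in a..b, S (b - r) (f r)⟫ - ∫ r in a..b, ⟪l r, f r⟫ := by
    rw [← inner_int _ hconv, ← intervalIntegral.integral_sub (inner_ii _ hconv) hlf]
    refine intervalIntegral.integral_congr fun r hr => ?_
    rw [uIcc_of_le hab] at hr
    exact key r hr (f r)
  have e3 : ∫ t in a..b, ⟪g t, S (t - a) (y a)⟫ = ⟪l b, S (b - a) (y a)⟫ - ⟪l a, y a⟫ := by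
    rw [← key a ha]
    refine intervalIntegral.integral_congr fun s hs => ?_
    rw [uIcc_of_le hab] at hs
    rw [hGg s hs]
  rw [intervalIntegral.integral_add hlf hgy, e1, hswap, e2, e3, hy.2 a ha b ⟨hab, le_rfl⟩,
    inner_add_right]
  ring

end Mild

/-! ### Bounded perturbations of generators and the Duhamel formula. -/

section Perturbation

open scoped BoundedContinuousFunction

variable {X : Type*} [NormedAddCommGroup X] [InnerProductSpace ℝ X] [CompleteSpace X]

variable {S R : ℝ → X →L[ℝ] X}

theorem integral_exp_conv_le {a t : ℝ} (ha : 0 < a) :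
    ∫ s in (0 : ℝ)..t, Real.exp (-a * (t - s)) ≤ 1 / a := by
  have h1 : ∀ s ∈ uIcc 0 t, HasDerivAt (fun s => Real.exp (-a * (t - s)) / a)
      (Real.exp (-a * (t - s))) s := by
    intro s _
    have h2 : HasDerivAt (fun s => -a * (t - s)) a s := by
      have := ((hasDerivAt_id s).const_sub t).const_mul (-a)
      simpa using this
    have := h2.exp.div_const a
    rwa [mul_div_assoc, div_self ha.ne', mul_one] at this
  rw [intervalIntegral.integral_eq_sub_of_hasDerivAt h1
    (Continuous.intervalIntegrable (by fun_prop) _ _)]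
  have : 0 ≤ Real.exp (-a * (t - 0)) / a := by positivity
  simp only [sub_self, mul_zero, Real.exp_zero]
  linarith

/-- The Duhamel equation is linear on bounded continuous functions of time, with a Volterra operator
of norm at most M‖L‖/a < 1. It is solved by inverting I minus that operator, and uniqueness yields
the semigroup law. -/
theorem exists_duhamel_of_stable (hS : IsClampedSemigroup S) (L : X →L[ℝ] X) {M a : ℝ}
    (hM : 1 ≤ M) (ha : 0 < a) (hb : ∀ t, 0 ≤ t → ‖S t‖ ≤ M * Real.exp (-a * t))
    (hL : M * ‖L‖ < a) : ∃ R, IsClampedSemigroup R ∧ IsDuhamel S L R := by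
  have hM0 : 0 < M := by linarith
  have hSM : ∀ t, ‖S t‖ ≤ M := by
    intro t
    rw [← hS.apply_max]
    refine (hb _ (le_max_right _ _)).trans ?_
    refine mul_le_of_le_one_right hM0.le (Real.exp_le_one_iff.2 ?_)
    have := le_max_right t 0
    nlinarith
  let O : X →L[ℝ] (ℝ →ᵇ X) := LinearMap.mkContinuous
    { toFun := fun x => BoundedContinuousFunction.ofNormedAddCommGroup (fun t => S t x)
        (hS.continuous_orbit x) (M * ‖x‖) (fun t => (S t).le_of_opNorm_le (hSM t) x)
      map_add' := fun x y => by ext t; simp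
      map_smul' := fun c x => by ext t; simp } M
    (fun x => BoundedContinuousFunction.norm_ofNormedAddCommGroup_le _ (by positivity)
      fun t => (S t).le_of_opNorm_le (hSM t) x)
  have hO : ∀ x t, O x t = S t x := fun x t => rfl
  have hcont : ∀ y : ℝ →ᵇ X,
      Continuous fun t : ℝ => ∫ s in (0 : ℝ)..(max t 0), S (max t 0 - s) (L (y s)) := by
    intro y
    refine intervalIntegral.continuous_parametric_intervalIntegral_of_continuous
      (f := fun t s => S (max t 0 - s) (L (y s))) ?_ (by fun_prop)
    exact hS.continuous_comp (by fun_prop)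
      (L.continuous.comp (y.continuous.comp continuous_snd))
  have hint : ∀ (y : ℝ →ᵇ X) (t : ℝ) (c d : ℝ),
      IntervalIntegrable (fun s => S (t - s) (L (y s))) volume c d := fun y t c d =>
    Continuous.intervalIntegrable
      (hS.continuous_comp (by fun_prop) (L.continuous.comp y.continuous)) _ _
  have hbound : ∀ (y : ℝ →ᵇ X) (t : ℝ),
      ‖∫ s in (0 : ℝ)..(max t 0), S (max t 0 - s) (L (y s))‖ ≤ M * ‖L‖ / a * ‖y‖ := by
    intro y t
    have h0 := le_max_right t 0
    have h1 : ‖∫ s in (0 : ℝ)..(max t 0), S (max t 0 - s) (L (y s))‖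
        ≤ ∫ s in (0 : ℝ)..(max t 0), (M * ‖L‖ * ‖y‖) * Real.exp (-a * (max t 0 - s)) := by
      refine intervalIntegral.norm_integral_le_of_norm_le h0 ?_
        (Continuous.intervalIntegrable (by fun_prop) _ _)
      refine Eventually.of_forall fun s hs => ?_
      have h2 := (S (max t 0 - s)).le_of_opNorm_le (hb _ (by linarith [hs.2])) (L (y s))
      have h3 : ‖L (y s)‖ ≤ ‖L‖ * ‖y‖ :=
        (L.le_opNorm _).trans (by gcongr; exact y.norm_coe_le_norm s)
      calc _ ≤ M * Real.exp (-a * (max t 0 - s)) * (‖L‖ * ‖y‖) := h2.trans (by gcongr)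
        _ = _ := by ring
    refine h1.trans ?_
    rw [intervalIntegral.integral_const_mul]
    have h2 := integral_exp_conv_le (t := max t 0) ha
    calc _ ≤ (M * ‖L‖ * ‖y‖) * (1 / a) := by gcongr
      _ = _ := by ring
  let W : (ℝ →ᵇ X) →L[ℝ] (ℝ →ᵇ X) := LinearMap.mkContinuous
    { toFun := fun y => BoundedContinuousFunction.ofNormedAddCommGroup _ (hcont y)
        (M * ‖L‖ / a * ‖y‖) (hbound y)
      map_add' := fun y z => by
        ext t
        simp only [BoundedContinuousFunction.coe_ofNormedAddCommGroup,
          BoundedContinuousFunction.coe_add, Pi.add_apply, map_add]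
        exact intervalIntegral.integral_add (hint _ _ _ _) (hint _ _ _ _)
      map_smul' := fun c y => by
        ext t
        simp only [BoundedContinuousFunction.coe_ofNormedAddCommGroup,
          BoundedContinuousFunction.coe_smul, map_smul, RingHom.id_apply]
        exact intervalIntegral.integral_smul c _ } (M * ‖L‖ / a)
    (fun y => BoundedContinuousFunction.norm_ofNormedAddCommGroup_le _ (by positivity) (hbound y))
  have hW : ∀ y t, W y t = ∫ s in (0 : ℝ)..(max t 0), S (max t 0 - s) (L (y s)) :=
    fun y t => rfl
  have hWn : ‖W‖ < 1 := by
    refine (LinearMap.mkContinuous_norm_le _ (by positivity) _).trans_lt ?_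
    rwa [div_lt_one ha]
  let I : ((ℝ →ᵇ X) →L[ℝ] (ℝ →ᵇ X))ˣ := Units.oneSub W hWn
  have hI : (I : (ℝ →ᵇ X) →L[ℝ] (ℝ →ᵇ X)) = 1 - W := rfl
  let w : X →L[ℝ] (ℝ →ᵇ X) := ((I⁻¹ : _ˣ) : (ℝ →ᵇ X) →L[ℝ] (ℝ →ᵇ X)).comp O
  have hw : ∀ x, w x = O x + W (w x) := by
    intro x
    have h1 : (I : (ℝ →ᵇ X) →L[ℝ] (ℝ →ᵇ X)) (w x) = O x := by
      change ((I : (ℝ →ᵇ X) →L[ℝ] (ℝ →ᵇ X)) * ((I⁻¹ : _ˣ) : (ℝ →ᵇ X) →L[ℝ] (ℝ →ᵇ X))) (O x) = _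
      rw [Units.mul_inv]; rfl
    rw [hI] at h1
    rw [← h1]
    simp
  have huniq : ∀ x (u : ℝ →ᵇ X), u = O x + W u → u = w x := by
    intro x u hu
    have h1 : (I : (ℝ →ᵇ X) →L[ℝ] (ℝ →ᵇ X)) u = O x := by
      rw [hI]
      change u - W u = O x
      rw [sub_eq_iff_eq_add]
      exact hu
    change u = ((I⁻¹ : _ˣ) : (ℝ →ᵇ X) →L[ℝ] (ℝ →ᵇ X)) (O x)
    rw [← h1]
    change u = (((I⁻¹ : _ˣ) : (ℝ →ᵇ X) →L[ℝ] (ℝ →ᵇ X)) * (I : (ℝ →ᵇ X) →L[ℝ] (ℝ →ᵇ X))) u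
    rw [Units.inv_mul]; rfl
  have hwt : ∀ x t, 0 ≤ t → w x t = S t x + ∫ s in (0 : ℝ)..t, S (t - s) (L (w x s)) := by
    intro x t ht
    conv_lhs => rw [hw x]
    rw [BoundedContinuousFunction.coe_add, Pi.add_apply, hO, hW, max_eq_left ht]
  have hwneg : ∀ x t, t ≤ 0 → w x t = x := by
    intro x t ht
    rw [hw x, BoundedContinuousFunction.coe_add, Pi.add_apply, hO, hW, max_eq_right ht,
      intervalIntegral.integral_same, add_zero, hS.clamp t ht]
    rfl
  refine ⟨fun t => (BoundedContinuousFunction.evalCLM ℝ t).comp w, ?_, fun t ht x => hwt x t ht⟩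
  refine { map_zero := ?_, map_add := ?_, tendsto_zero := ?_, clamp := ?_ }
  · ext x; exact hwneg x 0 le_rfl
  · intro t s ht hs
    ext x
    change w x (t + s) = w (w x s) t
    -- The orbit restarted at time s solves the same equation with initial value w(x)(s), so it must
    -- be the orbit of that value.
    let u : ℝ →ᵇ X := BoundedContinuousFunction.ofNormedAddCommGroup (fun t => w x (max t 0 + s))
      ((w x).continuous.comp (by fun_prop)) ‖w x‖ (fun t => (w x).norm_coe_le_norm _)
    have hu : ∀ t, u t = w x (max t 0 + s) := fun t => rfl
    have h1 : u = w (w x s) := by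
      refine huniq _ _ ?_
      ext t
      rw [BoundedContinuousFunction.coe_add, Pi.add_apply, hO, hW, hu]
      have h0 := le_max_right t 0
      rw [← hS.apply_max]
      set τ := max t 0
      have hi : IntervalIntegrable (fun r => L (w x r)) volume 0 (τ + s) :=
        Continuous.intervalIntegrable (L.continuous.comp (w x).continuous) _ _
      rw [hwt x (τ + s) (by linarith), hwt x s hs, integral_conv_split hS hs (by linarith) hi,
        map_add, hS.add_apply h0 hs, add_sub_cancel_right, ← add_assoc]
      congr 1
      have := intervalIntegral.integral_comp_add_right (a := 0) (b := τ)
        (fun r => S (τ + s - r) (L (w x r))) s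
      rw [zero_add] at this
      rw [← this]
      refine intervalIntegral.integral_congr fun r hr => ?_
      rw [uIcc_of_le h0] at hr
      simp only [hu, max_eq_left hr.1]
      congr 2; ring
    rw [← h1, hu, max_eq_left ht]
  · intro x
    have := ((w x).continuous.tendsto 0).mono_left (nhdsWithin_le_nhds (s := Ioi 0))
    rw [hwneg x 0 le_rfl] at this
    exact this
  · intro t ht
    ext x; exact hwneg x t ht

theorem IsClampedSemigroup.exp_smul (hS : IsClampedSemigroup S) (c : ℝ) :
    IsClampedSemigroup fun t => Real.exp (c * max t 0) • S t where
  map_zero := by simp [hS.map_zero]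
  map_add s t hs ht := by
    rw [max_eq_left hs, max_eq_left ht, max_eq_left (add_nonneg hs ht), hS.map_add s t hs ht,
      ContinuousLinearMap.smul_comp, ContinuousLinearMap.comp_smul, smul_smul, ← Real.exp_add,
      mul_add]
  tendsto_zero x := by
    have h1 : Continuous fun t : ℝ => Real.exp (c * max t 0) := by fun_prop
    have h2 := ((h1.smul (hS.continuous_orbit x)).tendsto 0).mono_left
      (nhdsWithin_le_nhds (s := Ioi 0))
    simpa [hS.zero_apply, Pi.smul_def'] using h2
  clamp t ht := by rw [max_eq_right ht, hS.clamp t ht]; simp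

theorem exists_duhamel (hS : IsClampedSemigroup S) (L : X →L[ℝ] X) :
    ∃ R, IsClampedSemigroup R ∧ IsDuhamel S L R := by
  obtain ⟨M, hM, ω, hω, hb⟩ := hS.toIsC0Semigroup.exists_exp_bound
  have hM0 : 0 < M := by linarith
  -- Multiplying S by e^{−(ω+a)t} makes it decay at rate a > M‖L‖, the smallness required above; the
  -- factor is undone at the end.
  set a := M * ‖L‖ + 1 with ha
  have ha0 : 0 < a := by positivity
  obtain ⟨R, hR, hD⟩ := exists_duhamel_of_stable (hS.exp_smul (-(ω + a))) L hM ha0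
    (fun t ht => by
      rw [max_eq_left ht, norm_smul, Real.norm_eq_abs, abs_of_pos (Real.exp_pos _)]
      calc _ ≤ Real.exp (-(ω + a) * t) * (M * Real.exp (ω * t)) := by gcongr; exact hb t ht
        _ = M * (Real.exp (-(ω + a) * t) * Real.exp (ω * t)) := by ring
        _ = _ := by rw [← Real.exp_add]; congr 2; ring) (by linarith)
  refine ⟨_, hR.exp_smul (ω + a), fun t ht x => ?_⟩
  have h1 := hD t ht x
  simp only [smul_apply] at h1 ⊢
  rw [max_eq_left ht] at h1 ⊢
  rw [h1, smul_add, smul_smul, ← Real.exp_add]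
  congr 1
  · rw [show (ω + a) * t + -(ω + a) * t = 0 by ring, Real.exp_zero, one_smul]
  · rw [← intervalIntegral.integral_smul]
    refine intervalIntegral.integral_congr fun s hs => ?_
    rw [uIcc_of_le ht] at hs
    rw [max_eq_left (sub_nonneg.2 hs.2), max_eq_left hs.1, smul_smul, ← Real.exp_add, map_smul,
      map_smul]
    congr 2; ring

/-- `R` is the semigroup generated by `A + L`, where `A` is the generator of `S`. -/
structure IsPerturbation (S : ℝ → X →L[ℝ] X) (L : X →L[ℝ] X) (R : ℝ → X →L[ℝ] X) : Prop where
  left : IsClampedSemigroup S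
  right : IsClampedSemigroup R
  iff : ∀ x y, HasGenerator S x y ↔ HasGenerator R x (y + L x)

theorem IsDuhamel.tendsto (hS : IsClampedSemigroup S) (hR : IsClampedSemigroup R) (L : X →L[ℝ] X)
    (x : X) : Tendsto (fun t : ℝ => t⁻¹ • ∫ s in (0 : ℝ)..t, S (t - s) (L (R s x))) (𝓝[>] 0)
      (𝓝 (L x)) := by
  have hc : Continuous fun p : ℝ × ℝ => S (p.1 - p.2) (L (R p.2 x)) :=
    hS.continuous_comp (by fun_prop)
      (L.continuous.comp (hR.continuous_comp (by fun_prop) continuous_const))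
  have h0 : S (0 - 0) (L (R 0 x)) = L x := by rw [sub_self, hS.zero_apply, hR.zero_apply]
  rw [Metric.tendsto_nhds]
  intro ε hε
  have h1 := hc.tendsto (0, 0)
  simp only [h0] at h1
  obtain ⟨δ, hδ, h2⟩ := Metric.eventually_nhds_iff.1
    (h1.eventually (Metric.ball_mem_nhds (L x) (half_pos hε)))
  filter_upwards [Ioo_mem_nhdsGT hδ] with t ht
  have h3 : ‖∫ s in (0 : ℝ)..t, (S (t - s) (L (R s x)) - L x)‖ ≤ ε / 2 * |t - 0| := by
    refine intervalIntegral.norm_integral_le_of_norm_le_const fun s hs => ?_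
    rw [uIoc_of_le ht.1.le] at hs
    have h4 := h2 (y := (t, s)) (by
      rw [Prod.dist_eq]
      refine max_lt ?_ ?_
      · rw [Real.dist_eq, sub_zero, abs_of_pos ht.1]; exact ht.2
      · rw [Real.dist_eq, sub_zero, abs_of_pos hs.1]; exact hs.2.trans_lt ht.2)
    rw [dist_eq_norm] at h4
    exact h4.le
  have hi : IntervalIntegrable (fun s => S (t - s) (L (R s x))) volume 0 t :=
    (hc.comp (continuous_const.prodMk continuous_id)).intervalIntegrable _ _
  rw [intervalIntegral.integral_sub hi intervalIntegrable_const,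
    intervalIntegral.integral_const, sub_zero, abs_of_pos ht.1] at h3
  rw [dist_eq_norm]
  have h5 : t⁻¹ • (∫ s in (0 : ℝ)..t, S (t - s) (L (R s x))) - L x
      = t⁻¹ • ((∫ s in (0 : ℝ)..t, S (t - s) (L (R s x))) - t • L x) := by
    rw [smul_sub, smul_smul, inv_mul_cancel₀ ht.1.ne', one_smul]
  rw [h5, norm_smul, norm_inv, Real.norm_eq_abs, abs_of_pos ht.1]
  calc _ ≤ t⁻¹ * (ε / 2 * t) := by
        have := ht.1
        gcongr
    _ = ε / 2 := by field_simp [ht.1.ne']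
    _ < ε := by linarith

/-- The mean of the Duhamel integral over [0, t] tends to Lx, so the difference quotients of the two
semigroups at x converge together, with limits differing by Lx. -/
theorem IsDuhamel.isPerturbation (hS : IsClampedSemigroup S) (hR : IsClampedSemigroup R)
    {L : X →L[ℝ] X} (h : IsDuhamel S L R) : IsPerturbation S L R := by
  refine ⟨hS, hR, fun x y => ?_⟩
  have h1 := IsDuhamel.tendsto hS hR L x
  have h2 : ∀ t : ℝ, 0 < t → t⁻¹ • (R t x - x)
      = t⁻¹ • (S t x - x) + t⁻¹ • ∫ s in (0 : ℝ)..t, S (t - s) (L (R s x)) := by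
    intro t ht
    rw [h t ht.le x, ← smul_add]
    congr 1; abel
  constructor
  · intro hx
    refine (hx.add h1).congr' ?_
    filter_upwards [self_mem_nhdsWithin] with t ht using (h2 t ht).symm
  · intro hx
    have h3 := hx.sub h1
    rw [add_sub_cancel_right] at h3
    refine h3.congr' ?_
    filter_upwards [self_mem_nhdsWithin] with t ht
    rw [h2 t ht, add_sub_cancel_right]

theorem exists_isPerturbation (hS : IsClampedSemigroup S) (L : X →L[ℝ] X) :
    ∃ R, IsPerturbation S L R := by
  obtain ⟨R, hR, hD⟩ := exists_duhamel hS L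
  exact ⟨R, hD.isPerturbation hS hR⟩

theorem IsPerturbation.symm {L : X →L[ℝ] X} (h : IsPerturbation S L R) :
    IsPerturbation R (-L) S := by
  refine ⟨h.right, h.left, fun x y => ?_⟩
  rw [h.iff]
  simp

theorem forall_of_dense {D : Set X} (hD : Dense D) {p : X → Prop} (hp : IsClosed {x | p x})
    (h : ∀ x ∈ D, p x) (x : X) : p x :=
  hp.closure_subset_iff.2 h (hD x)

/-- On the domain of the generator, s ↦ S(t − s)R(s)x has right derivative S(t − s)LR(s)x.
Integration gives the formula there, and both sides are continuous in x. -/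
theorem IsPerturbation.duhamel {L : X →L[ℝ] X} (h : IsPerturbation S L R) : IsDuhamel S L R := by
  intro t ht
  have hS := h.left
  have hR := h.right
  have hc : Continuous fun p : X × ℝ => S (t - p.2) (L (R p.2 p.1)) :=
    hS.continuous_comp (by fun_prop)
      (L.continuous.comp (hR.continuous_comp (by fun_prop) (by fun_prop)))
  refine forall_of_dense hS.dense_domain (isClosed_eq (R t).continuous ((S t).continuous.add
    (intervalIntegral.continuous_parametric_intervalIntegral_of_continuous'
      (f := fun x s => S (t - s) (L (R s x))) hc 0 t))) ?_
  rintro x ⟨y, hy⟩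
  have hy' := (h.iff x y).1 hy
  have hderiv : ∀ s ∈ Ioo 0 t, HasDerivWithinAt (fun s => S (t - s) (R s x))
      (S (t - s) (L (R s x))) (Ioi s) s := by
    intro s hs
    have h1 := hR.hasGenerator_apply hy' hs.1.le
    have h2 : HasGenerator S (R s x) (R s (y + L x) - L (R s x)) := by
      rw [h.iff, sub_add_cancel]; exact h1
    have h3 := hS.hasDerivAt_orbit h2 (sub_pos.2 hs.2)
    have h4 : HasDerivAt (fun s' => S (t - s') (R s x))
        (-(S (t - s) (R s (y + L x) - L (R s x)))) s := by
      have := h3.scomp s ((hasDerivAt_id s).const_sub t)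
      simpa [Function.comp_def] using this
    have h5 := hasDerivWithinAt_iff_tendsto_slope' (by simp) |>.1
      (hR.hasDerivWithinAt_orbit hy' hs.1.le)
    -- The product rule by hand: the slope splits into S(t − s') applied to the slope of the
    -- R-orbit, whose limit uses joint continuity of S, plus the slope of S(t − ·) at the fixed
    -- vector R(s)x.
    have h6 : Tendsto (fun s' => S (t - s') (slope (fun s => R s x) s s')) (𝓝[>] s)
        (𝓝 (S (t - s) (R s (y + L x)))) := by
      have h7 : Tendsto (fun s' : ℝ => t - s') (𝓝[>] s) (𝓝 (t - s)) :=
        ((by fun_prop : Continuous fun s' : ℝ => t - s').tendsto s).mono_left nhdsWithin_le_nhds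
      exact (hS.continuous_uncurry.tendsto (t - s, R s (y + L x))).comp (h7.prodMk_nhds h5)
    have h8 := hasDerivWithinAt_iff_tendsto_slope' (by simp) |>.1 (h4.hasDerivWithinAt (s := Ioi s))
    rw [hasDerivWithinAt_iff_tendsto_slope' (by simp)]
    have h9 := h6.add h8
    rw [map_sub, neg_sub, add_sub_cancel] at h9
    refine h9.congr fun s' => ?_
    simp only [slope, vsub_eq_sub, map_smul, map_sub]
    rw [← smul_add]
    congr 1; abel
  have hcx : Continuous fun s => S (t - s) (L (R s x)) :=
    hc.comp (continuous_const.prodMk continuous_id)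
  have hcR : Continuous fun s => S (t - s) (R s x) :=
    hS.continuous_comp (by fun_prop) (hR.continuous_orbit x)
  have := intervalIntegral.integral_eq_sub_of_hasDeriv_right_of_le ht hcR.continuousOn hderiv
    (hcx.intervalIntegrable 0 t)
  rw [this, sub_self, sub_zero, hS.zero_apply, hR.zero_apply]
  abel

/-- Taking adjoints reverses the order of the factors under the integral; after s ↦ t − s the
formula reads with R* as base semigroup and −L* as perturbation. -/
theorem IsDuhamel.adjoint {L : X →L[ℝ] X} (hS : IsClampedSemigroup S) (hR : IsClampedSemigroup R)
    (h : IsDuhamel S L R) :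
    IsDuhamel (fun t => (R t).adjoint) (-L.adjoint) (fun t => (S t).adjoint) := by
  intro t ht x
  have hi : IntervalIntegrable (fun s => (R (t - s)).adjoint (L.adjoint ((S s).adjoint x)))
      volume 0 t :=
    Continuous.intervalIntegrable (hR.adjoint.continuous_comp (by fun_prop)
      (L.adjoint.continuous.comp (hS.adjoint.continuous_orbit x))) _ _
  refine ext_inner_right ℝ fun v => ?_
  have hi' : IntervalIntegrable (fun s => S (t - s) (L (R s v))) volume 0 t :=
    Continuous.intervalIntegrable (hS.continuous_comp (by fun_prop)
      (L.continuous.comp (hR.continuous_orbit v))) _ _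
  have h1 : ⟪∫ s in (0 : ℝ)..t, (R (t - s)).adjoint (L.adjoint ((S s).adjoint x)), v⟫
      = ⟪x, ∫ s in (0 : ℝ)..t, S (t - s) (L (R s v))⟫ := by
    have e1 := (innerSL ℝ v).intervalIntegral_comp_comm hi
    have e2 := (innerSL ℝ x).intervalIntegral_comp_comm hi'
    simp only [innerSL_apply_apply] at e1 e2
    rw [real_inner_comm, ← e1, ← e2]
    have := intervalIntegral.integral_comp_sub_left (a := 0) (b := t)
      (fun s => ⟪x, S (t - s) (L (R s v))⟫) t
    rw [sub_self, sub_zero] at this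
    rw [← this]
    refine intervalIntegral.integral_congr fun s _ => ?_
    simp only [sub_sub_cancel]
    rw [real_inner_comm, ContinuousLinearMap.adjoint_inner_left,
      ContinuousLinearMap.adjoint_inner_left, ContinuousLinearMap.adjoint_inner_left]
  simp only [neg_apply, map_neg, intervalIntegral.integral_neg]
  rw [inner_add_left, inner_neg_left, h1, ContinuousLinearMap.adjoint_inner_left,
    ContinuousLinearMap.adjoint_inner_left, h t ht v, inner_add_right]
  ring

theorem IsPerturbation.duhamel_adjoint {L : X →L[ℝ] X} (h : IsPerturbation S L R) :
    IsDuhamel (fun t => (S t).adjoint) L.adjoint (fun t => (R t).adjoint) := by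
  have := h.symm.duhamel.adjoint h.right h.left
  rwa [map_neg, neg_neg] at this

/-- For x and v in the two domains, ⟪S(t − s)x, D(s)v⟫ has zero derivative in s; its end values give
the claim, and density removes the domain restriction. -/
theorem eq_adjoint_of_formal_adjoint {D : ℝ → X →L[ℝ] X} (hS : IsClampedSemigroup S)
    (hD : IsClampedSemigroup D)
    (h : ∀ x y v w, HasGenerator S x y → HasGenerator D v w → ⟪y, v⟫ = ⟪x, w⟫) {t : ℝ}
    (ht : 0 ≤ t) : D t = (S t).adjoint := by
  have key : ∀ x v, ⟪S t x, v⟫ = ⟪x, D t v⟫ := by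
    refine forall_of_dense hS.dense_domain ?_ ?_
    · simp only [ofPred_forall]
      refine isClosed_iInter fun v => isClosed_eq ?_ ?_ <;> fun_prop
    rintro x ⟨y, hy⟩
    refine forall_of_dense hD.dense_domain (isClosed_eq (by fun_prop) (by fun_prop)) ?_
    rintro v ⟨w, hw⟩
    have hderiv : ∀ s ∈ Ioo 0 t, HasDerivWithinAt (fun s => ⟪S (t - s) x, D s v⟫) 0 (Ioi s) s := by
      intro s hs
      have h3 := hS.hasDerivAt_orbit hy (sub_pos.2 hs.2)
      have h4 : HasDerivAt (fun s' => S (t - s') x) (-(S (t - s) y)) s := by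
        have := h3.scomp s ((hasDerivAt_id s).const_sub t)
        simpa [Function.comp_def] using this
      have h5 := (h4.inner ℝ (hD.hasDerivAt_orbit hw hs.1)).hasDerivWithinAt (s := Ioi s)
      have h6 := h _ _ _ _ (hS.hasGenerator_apply hy (sub_nonneg.2 hs.2.le))
        (hD.hasGenerator_apply hw hs.1.le)
      rwa [inner_neg_left, h6, add_neg_cancel] at h5
    have hc : Continuous fun s => ⟪S (t - s) x, D s v⟫ :=
      (hS.continuous_comp (by fun_prop) continuous_const).inner (hD.continuous_orbit v)
    have := intervalIntegral.integral_eq_sub_of_hasDeriv_right_of_le ht hc.continuousOn hderiv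
      intervalIntegrable_const
    rw [intervalIntegral.integral_zero, sub_self, sub_zero, hS.zero_apply, hD.zero_apply] at this
    linarith
  ext v
  refine ext_inner_left ℝ fun x => ?_
  rw [← key, ContinuousLinearMap.adjoint_inner_right]

end Perturbation

/-! ### Unbounded generators and their bounded perturbations in terms of orbits. -/

section Generator

variable {X : Type*} [NormedAddCommGroup X] [InnerProductSpace ℝ X] [CompleteSpace X]

theorem Generates.hasGenerator {A : X →ₗ.[ℝ] X} {S : ℝ → X →L[ℝ] X} (h : Generates A S)
    (x : A.domain) : HasGenerator S (x : X) (A x) :=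
  (h.2 _ _).1 (A.mem_graph x)

theorem Generates.exists_domain {A : X →ₗ.[ℝ] X} {S : ℝ → X →L[ℝ] X} (h : Generates A S)
    {x y : X} (hxy : HasGenerator S x y) : ∃ z : A.domain, (z : X) = x ∧ A z = y := by
  have := (h.2 x y).2 hxy
  obtain ⟨z, h1, h2⟩ := (LinearPMap.mem_graph_iff A).1 this
  exact ⟨z, h1, h2⟩

theorem Generates.clampSemigroup {A : X →ₗ.[ℝ] X} {S : ℝ → X →L[ℝ] X} (h : Generates A S) :
    Generates A (clampSemigroup S) :=
  ⟨h.1.isClampedSemigroup.toIsC0Semigroup, fun x y =>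
    (h.2 x y).trans hasGenerator_clampSemigroup.symm⟩

theorem mem_graph_addBounded {A : X →ₗ.[ℝ] X} {L : X →L[ℝ] X} {x y : X} :
    (x, y + L x) ∈ (addBounded A L).graph ↔ (x, y) ∈ A.graph := by
  rw [LinearPMap.mem_graph_iff, LinearPMap.mem_graph_iff]
  constructor
  · rintro ⟨z, h1, h2⟩
    refine ⟨z, h1, ?_⟩
    have h3 : addBounded A L z = L (z : X) + A z := LinearPMap.vadd_apply _ _ _
    have h1' : (z : X) = x := h1
    simp only at h2
    rw [h3, h1', add_comm] at h2
    exact add_right_cancel h2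
  · rintro ⟨z, h1, h2⟩
    refine ⟨z, h1, ?_⟩
    have h3 : addBounded A L z = L (z : X) + A z := LinearPMap.vadd_apply _ _ _
    have h1' : (z : X) = x := h1
    simp only at h2 ⊢
    rw [h3, h1', h2, add_comm]

theorem IsPerturbation.generates {A : X →ₗ.[ℝ] X} {S R : ℝ → X →L[ℝ] X} {L : X →L[ℝ] X}
    (h : IsPerturbation S L R) (hA : Generates A S) : Generates (addBounded A L) R := by
  refine ⟨h.right.toIsC0Semigroup, fun x y => ?_⟩
  have h1 := mem_graph_addBounded (A := A) (L := L) (x := x) (y := y - L x)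
  have h2 := h.iff x (y - L x)
  rw [sub_add_cancel] at h1 h2
  rw [h1]
  exact (hA.2 _ _).trans h2

theorem Generates.isPerturbation {A : X →ₗ.[ℝ] X} {S R : ℝ → X →L[ℝ] X} {L : X →L[ℝ] X}
    (hA : Generates A S) (hS : IsClampedSemigroup S) (hR : IsClampedSemigroup R)
    (h : Generates (addBounded A L) R) : IsPerturbation S L R :=
  ⟨hS, hR, fun x y => ((hA.2 x y).symm.trans mem_graph_addBounded.symm).trans (h.2 x (y + L x))⟩

end Generator

/-! ### Positive operators: Cauchy–Schwarz, coercivity, monotone limits. -/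

section PositiveOperators

variable {X U : Type*} [NormedAddCommGroup X] [InnerProductSpace ℝ X] [CompleteSpace X]
  [NormedAddCommGroup U] [InnerProductSpace ℝ U] [CompleteSpace U]

theorem IsPositive.inner_sq_le {T : X →L[ℝ] X} (hT : T.IsPositive) (x y : X) :
    ⟪T x, y⟫ ^ 2 ≤ ⟪T x, x⟫ * ⟪T y, y⟫ := by
  have hs : ⟪T y, x⟫ = ⟪T x, y⟫ := by rw [hT.inner_left_eq_inner_right, real_inner_comm]
  have h : ∀ s : ℝ, 0 ≤ ⟪T y, y⟫ * (s * s) + 2 * ⟪T x, y⟫ * s + ⟪T x, x⟫ := by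
    intro s
    have := hT.inner_nonneg_left (x + s • y)
    simp only [map_add, map_smul, inner_add_left, inner_add_right, real_inner_smul_left,
      real_inner_smul_right, hs] at this
    linarith
  have := discrim_le_zero h
  rw [discrim] at this
  linarith

/-- Cauchy–Schwarz for the form of T with second vector Tx, after division by ‖Tx‖². The constant
comes from the form rather than from ‖T‖, as the monotone limit below needs. -/
theorem IsPositive.norm_sq_le_of_le {T : X →L[ℝ] X} (hT : T.IsPositive) {h : ℝ}
    (hh : ∀ x, ⟪T x, x⟫ ≤ h * ‖x‖ ^ 2) (x : X) : ‖T x‖ ^ 2 ≤ h * ⟪T x, x⟫ := by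
  rcases eq_or_ne (T x) 0 with h0 | h0
  · rw [h0]; simp
  have h1 := IsPositive.inner_sq_le hT x (T x)
  rw [real_inner_self_eq_norm_sq] at h1
  have h2 := hh (T x)
  have h3 := hT.inner_nonneg_left x
  have h4 : 0 < ‖T x‖ ^ 2 := by positivity
  have h5 : ‖T x‖ ^ 2 * ‖T x‖ ^ 2 ≤ (h * ⟪T x, x⟫) * ‖T x‖ ^ 2 := by
    calc _ = (‖T x‖ ^ 2) ^ 2 := by ring
      _ ≤ _ := h1
      _ ≤ ⟪T x, x⟫ * (h * ‖T x‖ ^ 2) := by gcongr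
      _ = _ := by ring
  exact le_of_mul_le_mul_right h5 h4

theorem inner_apply_self_le (T : X →L[ℝ] X) (x : X) : ⟪T x, x⟫ ≤ ‖T‖ * ‖x‖ ^ 2 := by
  refine (real_inner_le_norm _ _).trans ?_
  rw [pow_two, ← mul_assoc]
  gcongr
  exact T.le_opNorm x

theorem IsPositive.norm_sq_le {T : X →L[ℝ] X} (hT : T.IsPositive) (x : X) :
    ‖T x‖ ^ 2 ≤ ‖T‖ * ⟪T x, x⟫ :=
  IsPositive.norm_sq_le_of_le hT (inner_apply_self_le T) x

/-- Bounded invertibility gives ‖v‖ ≤ ‖Q⁻¹‖‖Qv‖, and positivity gives ‖Qv‖² ≤ ‖Q‖⟪Qv, v⟫. The added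
1 keeps the constant finite and positive even on a trivial space. -/
theorem exists_coercive {Q : U ≃L[ℝ] U} (hQ : (Q : U →L[ℝ] U).IsPositive) :
    ∃ q > 0, ∀ v, q * ‖v‖ ^ 2 ≤ ⟪Q v, v⟫ := by
  set a := ‖(Q.symm : U →L[ℝ] U)‖
  set b := ‖(Q : U →L[ℝ] U)‖
  refine ⟨(a ^ 2 * b + 1)⁻¹, by positivity, fun v => ?_⟩
  have h1 : ‖v‖ ≤ a * ‖Q v‖ := by
    have := (Q.symm : U →L[ℝ] U).le_opNorm (Q v)
    simpa using this
  have h2 : ‖Q v‖ ^ 2 ≤ b * ⟪Q v, v⟫ := IsPositive.norm_sq_le hQ v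
  have h3 : 0 ≤ ⟪Q v, v⟫ := hQ.inner_nonneg_left v
  rw [inv_mul_le_iff₀ (by positivity)]
  calc ‖v‖ ^ 2 ≤ (a * ‖Q v‖) ^ 2 := by gcongr
    _ = a ^ 2 * ‖Q v‖ ^ 2 := by ring
    _ ≤ a ^ 2 * (b * ⟪Q v, v⟫) := by gcongr
    _ ≤ _ := by nlinarith

theorem gramian_apply (B : U →L[ℝ] X) (Q : U ≃L[ℝ] U) (x : X) :
    gramian B Q x = B (Q.symm (B.adjoint x)) := rfl

theorem symm_inner_comm {Q : U ≃L[ℝ] U} (hQ : (Q : U →L[ℝ] U).IsPositive) (u v : U) :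
    ⟪Q.symm u, v⟫ = ⟪u, Q.symm v⟫ := by
  have := hQ.isSymmetric (Q.symm u) (Q.symm v)
  simpa using this.symm

theorem gramian_inner (B : U →L[ℝ] X) (Q : U ≃L[ℝ] U) (x y : X) :
    ⟪gramian B Q x, y⟫ = ⟪Q.symm (B.adjoint x), B.adjoint y⟫ := by
  rw [gramian_apply, ContinuousLinearMap.adjoint_inner_right]

theorem gramian_isPositive (B : U →L[ℝ] X) {Q : U ≃L[ℝ] U} (hQ : (Q : U →L[ℝ] U).IsPositive) :
    (gramian B Q).IsPositive := by
  rw [ContinuousLinearMap.isPositive_iff]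
  refine ⟨fun x y => ?_, fun x => ?_⟩
  · change ⟪gramian B Q x, y⟫ = ⟪x, gramian B Q y⟫
    rw [gramian_inner, symm_inner_comm hQ, real_inner_comm, ← gramian_inner, real_inner_comm]
  · rw [gramian_inner]
    have := hQ.inner_nonneg_right (Q.symm (B.adjoint x))
    simpa using this

/-- The scalars ⟪P_n x, x⟫ decrease and are bounded below, hence are Cauchy. The differences are
positive operators whose forms are bounded by ‖P_0‖‖x‖², so the preceding estimate makes P_n x
Cauchy in norm. -/
theorem exists_strong_limit {P : ℕ → X →L[ℝ] X} (hP : ∀ n, (P n).IsPositive)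
    (hanti : ∀ n x, ⟪P (n + 1) x, x⟫ ≤ ⟪P n x, x⟫) :
    ∃ L : X →L[ℝ] X, L.IsPositive ∧ ∀ x, Tendsto (fun n => P n x) atTop (𝓝 (L x)) := by
  have hmono : ∀ x, Antitone fun n => ⟪P n x, x⟫ := fun x => antitone_nat_of_succ_le fun n =>
    hanti n x
  have hdiff : ∀ m n, m ≤ n → ∀ x,
      ‖P m x - P n x‖ ^ 2 ≤ ‖P 0‖ * (⟪P m x, x⟫ - ⟪P n x, x⟫) := by
    intro m n hmn x
    have hpos : (P m - P n).IsPositive := by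
      rw [ContinuousLinearMap.isPositive_iff]
      refine ⟨(hP m).isSymmetric.sub (hP n).isSymmetric, fun x => ?_⟩
      rw [sub_apply, inner_sub_left, sub_nonneg]
      exact hmono x hmn
    have := IsPositive.norm_sq_le_of_le hpos (h := ‖P 0‖) (fun x => by
      rw [sub_apply, inner_sub_left]
      have h1 := (hP n).inner_nonneg_left x
      have h2 := hmono x (Nat.zero_le m)
      have h3 := inner_apply_self_le (P 0) x
      simp only at h2
      linarith) x
    rwa [sub_apply, inner_sub_left] at this
  have hcauchy : ∀ x, CauchySeq fun n => P n x := by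
    intro x
    have hconv : CauchySeq fun n => ⟪P n x, x⟫ :=
      (tendsto_atTop_ciInf (hmono x) ⟨0, by rintro _ ⟨n, rfl⟩; exact (hP n).inner_nonneg_left x⟩
        ).cauchySeq
    rw [Metric.cauchySeq_iff'] at hconv ⊢
    intro ε hε
    obtain ⟨N, hN⟩ := hconv (ε ^ 2 / (‖P 0‖ + 1)) (by positivity)
    refine ⟨N, fun n hn => ?_⟩
    have h1 := hN n hn
    rw [dist_comm, Real.dist_eq, abs_of_nonneg (sub_nonneg.2 (hmono x hn)),
      lt_div_iff₀ (by positivity)] at h1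
    have h2 := hdiff N n hn x
    have h3 := sub_nonneg.2 (hmono x hn)
    rw [dist_comm, dist_eq_norm]
    refine lt_of_pow_lt_pow_left₀ 2 hε.le ?_
    simp only at h3
    nlinarith
  choose l hl using fun x => cauchySeq_tendsto_of_complete (hcauchy x)
  let L : X →L[ℝ] X := continuousLinearMapOfTendsto P (tendsto_pi_nhds.2 hl)
  have hL : ∀ x, Tendsto (fun n => P n x) atTop (𝓝 (L x)) := hl
  refine ⟨L, ?_, hL⟩
  rw [ContinuousLinearMap.isPositive_iff]
  refine ⟨fun x y => ?_, fun x => ?_⟩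
  · exact tendsto_nhds_unique ((hL x).inner tendsto_const_nhds)
      ((tendsto_const_nhds.inner (hL y)).congr fun n => ((hP n).isSymmetric x y).symm)
  · exact ge_of_tendsto' ((hL x).inner tendsto_const_nhds) fun n => (hP n).inner_nonneg_left x

end PositiveOperators

/-! ### Lyapunov equations, and exponential stability from quadratic functionals. -/

section Lyapunov

variable {X : Type*} [NormedAddCommGroup X] [InnerProductSpace ℝ X] [CompleteSpace X]
  {S R : ℝ → X →L[ℝ] X}

/-- The algebraic identity is integrated along orbits starting in the two domains, then extended by
density in each variable. -/
theorem isConjugation_of_generator (hS : IsClampedSemigroup S) (hR : IsClampedSemigroup R)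
    {M N : X →L[ℝ] X} (h : ∀ x y x' y', HasGenerator S x y → HasGenerator R x' y' →
      ⟪M y, x'⟫ + ⟪M x, y'⟫ + ⟪N x, x'⟫ = 0) : IsConjugation S R M N := by
  intro t ht x
  have hc : ∀ x, Continuous fun s => (R s).adjoint (N (S s x)) := fun x =>
    hR.adjoint.continuous_comp continuous_id (N.continuous.comp (hS.continuous_orbit x))
  have key : ∀ x x', ⟪M (S t x), R t x'⟫ + ∫ s in (0 : ℝ)..t, ⟪N (S s x), R s x'⟫ = ⟪M x, x'⟫ := by
    have hc1 : ∀ x', Continuous fun p : X × ℝ => ⟪N (S p.2 p.1), R p.2 x'⟫ := fun x' =>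
      (N.continuous.comp (hS.continuous_comp continuous_snd continuous_fst)).inner
        (hR.continuous_comp continuous_snd continuous_const)
    have hc2 : ∀ x, Continuous fun p : X × ℝ => ⟪N (S p.2 x), R p.2 p.1⟫ := fun x =>
      (N.continuous.comp (hS.continuous_comp continuous_snd continuous_const)).inner
        (hR.continuous_comp continuous_snd continuous_fst)
    refine forall_of_dense hS.dense_domain ?_ ?_
    · rw [ofPred_forall]
      refine isClosed_iInter fun x' => isClosed_eq ?_ (by fun_prop)
      exact Continuous.add (by fun_prop)
        (intervalIntegral.continuous_parametric_intervalIntegral_of_continuous'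
          (f := fun x s => ⟪N (S s x), R s x'⟫) (hc1 x') 0 t)
    rintro x ⟨y, hy⟩
    refine forall_of_dense hR.dense_domain (isClosed_eq ?_ (by fun_prop)) ?_
    · exact Continuous.add (by fun_prop)
        (intervalIntegral.continuous_parametric_intervalIntegral_of_continuous'
          (f := fun x' s => ⟪N (S s x), R s x'⟫) (hc2 x) 0 t)
    rintro x' ⟨y', hy'⟩
    have h1 := integral_inner_orbits hS hR M hy hy' ht
    have h2 : ∫ s in (0 : ℝ)..t, (⟪M (S s x), R s y'⟫ + ⟪M (S s y), R s x'⟫)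
        = ∫ s in (0 : ℝ)..t, -⟪N (S s x), R s x'⟫ := by
      refine intervalIntegral.integral_congr fun s hs => ?_
      rw [uIcc_of_le ht] at hs
      have := h _ _ _ _ (hS.hasGenerator_apply hy hs.1) (hR.hasGenerator_apply hy' hs.1)
      linarith
    rw [h2, intervalIntegral.integral_neg] at h1
    linarith
  refine ext_inner_right ℝ fun x' => ?_
  have e1 : ⟪∫ s in (0 : ℝ)..t, (R s).adjoint (N (S s x)), x'⟫
      = ∫ s in (0 : ℝ)..t, ⟪N (S s x), R s x'⟫ := by
    have := (innerSL ℝ x').intervalIntegral_comp_comm ((hc x).intervalIntegrable (μ := volume) 0 t)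
    simp only [innerSL_apply_apply] at this
    rw [real_inner_comm, ← this]
    refine intervalIntegral.integral_congr fun s _ => ?_
    rw [real_inner_comm, ContinuousLinearMap.adjoint_inner_left]
  rw [inner_add_left, e1, ContinuousLinearMap.adjoint_inner_left, key]

/-- Paired with x', the integrated equation says that a function of t is constant; its right
derivative at 0 is the algebraic identity. -/
theorem IsConjugation.generator (hS : IsClampedSemigroup S) (hR : IsClampedSemigroup R)
    {M N : X →L[ℝ] X} (h : IsConjugation S R M N) {x y x' y' : X} (hx : HasGenerator S x y)
    (hx' : HasGenerator R x' y') : ⟪M y, x'⟫ + ⟪M x, y'⟫ + ⟪N x, x'⟫ = 0 := by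
  have hc : Continuous fun s => (R s).adjoint (N (S s x)) :=
    hR.adjoint.continuous_comp continuous_id (N.continuous.comp (hS.continuous_orbit x))
  have h1 : HasDerivWithinAt (fun t => ⟪M (S t x), R t x'⟫) (⟪M (S 0 x), R 0 y'⟫
      + ⟪M (S 0 y), R 0 x'⟫) (Ioi 0) 0 :=
    (M.hasFDerivAt.comp_hasDerivWithinAt 0 (hS.hasDerivWithinAt_orbit hx le_rfl)).inner ℝ
      (hR.hasDerivWithinAt_orbit hx' le_rfl)
  have h2 := intervalIntegral.integral_hasDerivAt_right (hc.intervalIntegrable 0 0)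
    (hc.stronglyMeasurableAtFilter _ _) hc.continuousAt
  have h3 : HasDerivWithinAt (fun t => ⟪∫ s in (0 : ℝ)..t, (R s).adjoint (N (S s x)), x'⟫)
      (⟪(R 0).adjoint (N (S 0 x)), x'⟫) (Ioi 0) 0 := by
    have := (h2.inner ℝ (hasDerivAt_const 0 x')).hasDerivWithinAt (s := Ioi 0)
    simpa using this
  have h4 : HasDerivWithinAt (fun _ : ℝ => ⟪M x, x'⟫) (⟪M (S 0 x), R 0 y'⟫ + ⟪M (S 0 y), R 0 x'⟫
      + ⟪(R 0).adjoint (N (S 0 x)), x'⟫) (Ioi 0) 0 := by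
    refine (h1.add h3).congr (fun t ht => ?_) ?_
    · rw [← h t (le_of_lt ht) x, inner_add_left, ContinuousLinearMap.adjoint_inner_left]; rfl
    · rw [← h 0 le_rfl x, inner_add_left, ContinuousLinearMap.adjoint_inner_left]; rfl
  have h5 := (uniqueDiffWithinAt_Ioi (0 : ℝ)).eq_deriv _ h4 (hasDerivWithinAt_const 0 _ _)
  rw [hS.zero_apply, hS.zero_apply, hR.zero_apply, hR.zero_apply, hR.adjoint.zero_apply] at h5
  linarith

theorem norm_conj_le {c ν : ℝ} (hc : 0 ≤ c)
    (hb : ∀ t, 0 ≤ t → ‖R t‖ ≤ c * Real.exp (-ν * t)) (N : X →L[ℝ] X) (x : X) {t : ℝ}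
    (ht : 0 ≤ t) :
    ‖(R t).adjoint (N (R t x))‖ ≤ (c ^ 2 * ‖N‖ * ‖x‖) * Real.exp (-(2 * ν) * t) := by
  have h1 := (R t).le_of_opNorm_le (hb t ht) x
  have h3 : ‖(R t).adjoint‖ ≤ c * Real.exp (-ν * t) := by
    rw [LinearIsometryEquiv.norm_map]; exact hb t ht
  have h2 := ((R t).adjoint).le_of_opNorm_le h3 (N (R t x))
  calc _ ≤ c * Real.exp (-ν * t) * (‖N‖ * (c * Real.exp (-ν * t) * ‖x‖)) :=
        h2.trans (mul_le_mul_of_nonneg_left ((N.le_opNorm _).trans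
          (mul_le_mul_of_nonneg_left h1 (norm_nonneg _))) (by positivity))
    _ = (c ^ 2 * ‖N‖ * ‖x‖) * (Real.exp (-ν * t) * Real.exp (-ν * t)) := by ring
    _ = _ := by rw [← Real.exp_add]; congr 2; ring

/-- H is the integral of R*NR over the half-line. Conjugating it by R(t) shifts the integral to
start at t, and the missing piece over (0, t] is the integral term of the equation. -/
theorem exists_lyapunov (hR : IsClampedSemigroup R) (hs : IsExpStable R) (N : X →L[ℝ] X) :
    ∃ H : X →L[ℝ] X, (∀ x, IntegrableOn (fun t => (R t).adjoint (N (R t x))) (Ioi 0) ∧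
      H x = ∫ t in Ioi (0 : ℝ), (R t).adjoint (N (R t x))) ∧
      IsConjugation R R H N ∧ (N.IsPositive → H.IsPositive) := by
  have hcont : ∀ x, Continuous fun t => (R t).adjoint (N (R t x)) := fun x =>
    hR.adjoint.continuous_comp continuous_id (N.continuous.comp (hR.continuous_orbit x))
  obtain ⟨c, hc, ν, hν, hb⟩ := hs
  have hexp : ∀ x : X,
      IntegrableOn (fun t => (c ^ 2 * ‖N‖ * ‖x‖) * Real.exp (-(2 * ν) * t)) (Ioi 0) := fun x =>
    (integrableOn_exp_mul_Ioi (by linarith) 0).const_mul _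
  have hle : ∀ x, ∀ᵐ t ∂volume.restrict (Ioi (0 : ℝ)), ‖(R t).adjoint (N (R t x))‖
      ≤ (c ^ 2 * ‖N‖ * ‖x‖) * Real.exp (-(2 * ν) * t) := fun x =>
    (ae_restrict_mem measurableSet_Ioi).mono fun t ht =>
      norm_conj_le hc.le hb N x (le_of_lt ht)
  have hi : ∀ x, IntegrableOn (fun t => (R t).adjoint (N (R t x))) (Ioi 0) := fun x =>
    (hexp x).mono' (hcont x).aestronglyMeasurable (hle x)
  let H : X →L[ℝ] X := LinearMap.mkContinuousOfExistsBound
    { toFun := fun x => ∫ t in Ioi (0 : ℝ), (R t).adjoint (N (R t x))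
      map_add' := fun x y => by
        simp only [map_add]
        exact integral_add (hi x) (hi y)
      map_smul' := fun c x => by
        simp only [map_smul, RingHom.id_apply]
        exact integral_smul c _ }
    (by
      refine ⟨c ^ 2 * ‖N‖ / (2 * ν), fun x => ?_⟩
      refine (norm_integral_le_of_norm_le (hexp x) (hle x)).trans ?_
      rw [integral_const_mul, integral_exp_mul_Ioi (by linarith)]
      refine le_of_eq ?_
      simp only [mul_zero, Real.exp_zero]
      field_simp)
  have hH : ∀ x, H x = ∫ t in Ioi (0 : ℝ), (R t).adjoint (N (R t x)) := fun x => rfl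
  have hinner : ∀ x y, ⟪H x, y⟫ = ∫ t in Ioi (0 : ℝ), ⟪N (R t x), R t y⟫ := by
    intro x y
    have := (innerSL ℝ y).integral_comp_comm (hi x)
    simp only [innerSL_apply_apply] at this
    rw [hH, real_inner_comm, ← this]
    refine integral_congr_ae (Eventually.of_forall fun t => ?_)
    simp only
    rw [real_inner_comm, ContinuousLinearMap.adjoint_inner_left]
  refine ⟨H, fun x => ⟨hi x, rfl⟩, fun t ht x => ?_, fun hN => ?_⟩
  · rw [hH, hH, ← ContinuousLinearMap.integral_comp_comm _ (hi _)]
    have h1 : ∫ s in Ioi (0 : ℝ), (R t).adjoint ((R s).adjoint (N (R s (R t x))))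
        = ∫ s in Ioi t, (R s).adjoint (N (R s x)) := by
      have := (measurePreserving_add_right (volume : Measure ℝ) t).setIntegral_preimage_emb
        (measurableEmbedding_addRight t) (fun s => (R s).adjoint (N (R s x))) (Ioi t)
      rw [preimage_add_const_Ioi, sub_self] at this
      rw [← this]
      refine setIntegral_congr_fun measurableSet_Ioi fun s hs => ?_
      rw [hR.add_apply (le_of_lt hs) ht, add_comm s t,
        hR.adjoint.add_apply ht (le_of_lt hs)]
    rw [h1, add_comm, intervalIntegral.integral_of_le ht, ← setIntegral_union
      (Ioc_disjoint_Ioi le_rfl) measurableSet_Ioi ((hi x).mono_set Ioc_subset_Ioi_self)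
      ((hi x).mono_set (Ioi_subset_Ioi ht)), Ioc_union_Ioi_eq_Ioi ht]
  · rw [ContinuousLinearMap.isPositive_iff]
    refine ⟨fun x y => ?_, fun x => ?_⟩
    · change ⟪H x, y⟫ = ⟪x, H y⟫
      rw [real_inner_comm _ x, hinner, hinner]
      refine integral_congr_ae (Eventually.of_forall fun t => ?_)
      simp only
      rw [hN.inner_left_eq_inner_right, real_inner_comm]
    · rw [hinner]
      exact integral_nonneg fun t => hN.inner_nonneg_left _

theorem isExpStable_of_norm_le_half (hS : IsClampedSemigroup S) {M t₀ : ℝ} (ht₀ : 0 < t₀)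
    (hM : ∀ t, 0 ≤ t → ‖S t‖ ≤ M) (h : ‖S t₀‖ ≤ 1 / 2) : IsExpStable S := by
  have hM' : ∀ t, 0 ≤ t → ‖S t‖ ≤ M + 1 := fun t ht => (hM t ht).trans (by linarith)
  have hM0 : 0 < M + 1 := by
    have := (norm_nonneg _).trans (hM 0 le_rfl)
    linarith
  -- With this rate each step of length t₀ halves the bound; the prefactor 2 absorbs the last
  -- incomplete step.
  set ν := Real.log 2 / t₀ with hν
  have hν0 : 0 < ν := div_pos (Real.log_pos (by norm_num)) ht₀
  have hexp : Real.exp (-ν * t₀) = 1 / 2 := by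
    rw [hν, neg_mul, div_mul_cancel₀ _ ht₀.ne', Real.exp_neg, Real.exp_log (by norm_num)]
    norm_num
  refine ⟨2 * (M + 1), by positivity, ν, hν0, ?_⟩
  have key : ∀ n : ℕ, ∀ t : ℝ, 0 ≤ t → t ≤ ((n : ℝ) + 1) * t₀ →
      ‖S t‖ ≤ 2 * (M + 1) * Real.exp (-ν * t) := by
    have base : ∀ t : ℝ, 0 ≤ t → t ≤ t₀ → ‖S t‖ ≤ 2 * (M + 1) * Real.exp (-ν * t) := by
      intro t h0 h1
      have h2 : 1 / 2 ≤ Real.exp (-ν * t) := by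
        rw [← hexp]
        exact Real.exp_le_exp.2 (by nlinarith)
      have := hM' t h0
      nlinarith
    intro n
    induction n with
    | zero => intro t h0 h1; exact base t h0 (by simpa using h1)
    | succ n ih =>
      intro t h0 h1
      rcases le_total t t₀ with h2 | h2
      · exact base t h0 h2
      · have h3 := ih (t - t₀) (by linarith) (by push_cast at h1; linarith)
        have h4 : S t = (S t₀).comp (S (t - t₀)) := by
          rw [← hS.map_add t₀ (t - t₀) ht₀.le (by linarith)]; congr 1; ring
        have h5 : 2 * (M + 1) * Real.exp (-ν * t)
            = 1 / 2 * (2 * (M + 1) * Real.exp (-ν * (t - t₀))) := by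
          have : Real.exp (-ν * t) = Real.exp (-ν * t₀) * Real.exp (-ν * (t - t₀)) := by
            rw [← Real.exp_add]; congr 1; ring
          rw [this, hexp]; ring
        rw [h4, h5]
        exact (ContinuousLinearMap.opNorm_comp_le _ _).trans
          (mul_le_mul h h3 (norm_nonneg _) (by norm_num))
  intro t ht
  obtain ⟨n, hn⟩ := exists_nat_gt (t / t₀)
  refine key n t ht ?_
  rw [div_lt_iff₀ ht₀] at hn
  nlinarith

/-- A semigroup with a bounded strict Lyapunov functional is exponentially stable. -/
theorem isExpStable_of_lyapunov (hS : IsClampedSemigroup S) {H : X →L[ℝ] X} (hH : H.IsPositive)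
    (h : ∀ x y, HasGenerator S x y → 2 * ⟪H y, x⟫ ≤ -‖x‖ ^ 2) : IsExpStable S := by
  -- Datko's argument: the functional pays for the energy of the orbit, uniformly in time. Pointwise
  -- decay is then extracted by averaging.
  have hbound : ∀ T, 0 ≤ T → ∀ x, ∫ s in (0 : ℝ)..T, ‖S s x‖ ^ 2 ≤ ⟪H x, x⟫ := by
    intro T hT
    have hc : Continuous fun p : X × ℝ => ‖S p.2 p.1‖ ^ 2 :=
      (hS.continuous_comp continuous_snd continuous_fst).norm.pow 2
    refine forall_of_dense hS.dense_domain (isClosed_le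
      (intervalIntegral.continuous_parametric_intervalIntegral_of_continuous'
        (f := fun x s => ‖S s x‖ ^ 2) hc 0 T) (by fun_prop)) ?_
    rintro x ⟨y, hy⟩
    have hx := hS.continuous_orbit x
    have hyc := hS.continuous_orbit y
    have h1 := integral_inner_orbits hS hS H hy hy hT
    have h2 : ∫ s in (0 : ℝ)..T, (⟪H (S s x), S s y⟫ + ⟪H (S s y), S s x⟫)
        ≤ ∫ s in (0 : ℝ)..T, -‖S s x‖ ^ 2 := by
      refine intervalIntegral.integral_mono_on hT
        (Continuous.intervalIntegrable (by fun_prop) _ _)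
        (Continuous.intervalIntegrable (by fun_prop) _ _) fun s hs => ?_
      have h3 := h _ _ (hS.hasGenerator_apply hy hs.1)
      have h4 : ⟪H (S s x), S s y⟫ = ⟪H (S s y), S s x⟫ := by
        rw [hH.inner_left_eq_inner_right, real_inner_comm]
      linarith
    rw [intervalIntegral.integral_neg] at h2
    have h5 := hH.inner_nonneg_left (S T x)
    linarith
  have hbound' : ∀ T, 0 ≤ T → ∀ x, ∫ s in (0 : ℝ)..T, ‖S s x‖ ^ 2 ≤ ‖H‖ * ‖x‖ ^ 2 :=
    fun T hT x => (hbound T hT x).trans (inner_apply_self_le H x)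
  have hint : ∀ x a b, IntervalIntegrable (fun s => ‖S s x‖ ^ 2) volume a b := fun x a b =>
    ((hS.continuous_orbit x).norm.pow 2).intervalIntegrable a b
  obtain ⟨M, hM, hMb⟩ := hS.norm_le_of_le 1
  set M₂ := M * (‖H‖ + 1) with hM₂
  have hM₂0 : 0 ≤ M₂ := by positivity
  have hH0 := norm_nonneg H
  -- For t ≥ 1, ‖S(t)x‖² is at most M² times its average over [t − 1, t], which the energy bound
  -- controls.
  have hglob : ∀ t, 0 ≤ t → ‖S t‖ ≤ M₂ := by
    intro t ht
    refine ContinuousLinearMap.opNorm_le_bound _ hM₂0 fun x => ?_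
    have h0 : ‖S t x‖ ^ 2 ≤ M ^ 2 * ((‖H‖ + 1) * ‖x‖ ^ 2) := by
      rcases le_total t 1 with h1 | h1
      · have h2 := (S t).le_of_opNorm_le (hMb t h1) x
        calc ‖S t x‖ ^ 2 ≤ (M * ‖x‖) ^ 2 := by gcongr
          _ = M ^ 2 * (1 * ‖x‖ ^ 2) := by ring
          _ ≤ _ := by gcongr; linarith
      · have h2 : ∫ s in (t - 1)..t, ‖S t x‖ ^ 2 ≤ ∫ s in (t - 1)..t, M ^ 2 * ‖S s x‖ ^ 2 := by
          refine intervalIntegral.integral_mono_on (by linarith) intervalIntegrable_const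
            ((hint x _ _).const_mul _) fun s hs => ?_
          have h3 : S t x = S (t - s) (S s x) := by
            rw [← hS.add_apply (by linarith [hs.2]) (by linarith [hs.1]), sub_add_cancel]
          have h4 := (S (t - s)).le_of_opNorm_le (hMb _ (by linarith [hs.1])) (S s x)
          rw [h3, ← mul_pow]
          gcongr
        rw [intervalIntegral.integral_const, intervalIntegral.integral_const_mul, sub_sub_cancel,
          one_smul] at h2
        have h3 : ∫ s in (t - 1)..t, ‖S s x‖ ^ 2 ≤ ∫ s in (0 : ℝ)..t, ‖S s x‖ ^ 2 := by
          rw [← intervalIntegral.integral_add_adjacent_intervals (hint x 0 (t - 1))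
            (hint x (t - 1) t)]
          have := intervalIntegral.integral_nonneg (μ := volume) (f := fun s => ‖S s x‖ ^ 2)
            (show (0 : ℝ) ≤ t - 1 by linarith) (fun s _ => by positivity)
          linarith
        calc _ ≤ _ := h2
          _ ≤ M ^ 2 * ((‖H‖ + 1) * ‖x‖ ^ 2) := by
            gcongr
            have := hbound' t ht x
            nlinarith [sq_nonneg ‖x‖]
    refine le_of_sq_le_sq ?_ (by positivity)
    calc _ ≤ _ := h0
      _ ≤ M ^ 2 * ((‖H‖ + 1) ^ 2 * ‖x‖ ^ 2) := by
        gcongr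
        nlinarith
      _ = _ := by rw [hM₂]; ring
  -- Averaging over [0, t₀] gives t₀‖S(t₀)x‖² ≤ M₂²‖H‖‖x‖², which is at most (t₀/4)‖x‖² for this t₀,
  -- hence ‖S(t₀)‖ ≤ 1/2.
  have ht₀ : 0 < 4 * M₂ ^ 2 * ‖H‖ + 1 := by positivity
  refine isExpStable_of_norm_le_half hS ht₀ hglob ?_
  set t₀ := 4 * M₂ ^ 2 * ‖H‖ + 1 with ht₀def
  refine ContinuousLinearMap.opNorm_le_bound _ (by norm_num) fun x => ?_
  have h2 : ∫ s in (0 : ℝ)..t₀, ‖S t₀ x‖ ^ 2 ≤ ∫ s in (0 : ℝ)..t₀, M₂ ^ 2 * ‖S s x‖ ^ 2 := by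
    refine intervalIntegral.integral_mono_on ht₀.le intervalIntegrable_const
      ((hint x _ _).const_mul _) fun s hs => ?_
    have h3 : S t₀ x = S (t₀ - s) (S s x) := by
      rw [← hS.add_apply (by linarith [hs.2]) (by linarith [hs.1]), sub_add_cancel]
    have h4 := (S (t₀ - s)).le_of_opNorm_le (hglob _ (by linarith [hs.2])) (S s x)
    rw [h3, ← mul_pow]
    gcongr
  rw [intervalIntegral.integral_const, intervalIntegral.integral_const_mul, sub_zero,
    smul_eq_mul] at h2
  have h3 := hbound' t₀ ht₀.le x
  have h4 : t₀ * ‖S t₀ x‖ ^ 2 ≤ t₀ * (1 / 2 * ‖x‖) ^ 2 := by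
    calc _ ≤ _ := h2
      _ ≤ M₂ ^ 2 * (‖H‖ * ‖x‖ ^ 2) := by gcongr
      _ ≤ _ := by rw [ht₀def]; nlinarith [sq_nonneg ‖x‖]
  exact le_of_sq_le_sq (le_of_mul_le_mul_left h4 ht₀) (by positivity)

/-- A quadratic form that decreases along a stable semigroup is nonnegative. -/
theorem inner_nonneg_of_stable (hS : IsClampedSemigroup S) (hs : IsExpStable S) {M : X →L[ℝ] X}
    (h : ∀ x y, HasGenerator S x y → ⟪M y, x⟫ + ⟪M x, y⟫ ≤ 0) (x : X) : 0 ≤ ⟪M x, x⟫ := by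
  refine forall_of_dense (p := fun x => 0 ≤ ⟪M x, x⟫) hS.dense_domain
    (isClosed_le continuous_const (by fun_prop)) ?_ x
  rintro x ⟨y, hy⟩
  have hx := hS.continuous_orbit x
  have hyc := hS.continuous_orbit y
  have h1 : ∀ t, 0 ≤ t → ⟪M (S t x), S t x⟫ ≤ ⟪M x, x⟫ := by
    intro t ht
    have h2 := integral_inner_orbits hS hS M hy hy ht
    have h3 : ∫ s in (0 : ℝ)..t, (⟪M (S s x), S s y⟫ + ⟪M (S s y), S s x⟫)
        ≤ ∫ s in (0 : ℝ)..t, (0 : ℝ) := by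
      refine intervalIntegral.integral_mono_on ht
        (Continuous.intervalIntegrable (by fun_prop) _ _) intervalIntegrable_const fun s hs => ?_
      have := h _ _ (hS.hasGenerator_apply hy hs.1)
      linarith
    rw [intervalIntegral.integral_zero] at h3
    linarith
  obtain ⟨c, hc, ν, hν, hb⟩ := hs
  have hexp : Tendsto (fun t : ℝ => c * Real.exp (-ν * t) * ‖x‖) atTop (𝓝 0) := by
    have h2 : Tendsto (fun t : ℝ => -ν * t) atTop atBot :=
      tendsto_id.const_mul_atTop_of_neg (by linarith)
    have := ((Real.tendsto_exp_atBot.comp h2).const_mul c).mul_const ‖x‖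
    simpa using this
  have h4 : Tendsto (fun t => S t x) atTop (𝓝 0) := by
    refine squeeze_zero_norm' ?_ hexp
    filter_upwards [eventually_ge_atTop 0] with t ht using (S t).le_of_opNorm_le (hb t ht) x
  have h5 : Tendsto (fun t => ⟪M (S t x), S t x⟫) atTop (𝓝 0) := by
    have := ((M.continuous.tendsto 0).comp h4).inner (𝕜 := ℝ) h4
    simpa using this
  exact le_of_tendsto h5 ((eventually_ge_atTop 0).mono h1)

end Lyapunov

/-! ### The Riccati equation: stabilization, uniqueness, and existence by Kleinman's iteration. -/

section Riccati

variable {X U V : Type*}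
  [NormedAddCommGroup X] [InnerProductSpace ℝ X] [CompleteSpace X]
  [NormedAddCommGroup U] [InnerProductSpace ℝ U] [CompleteSpace U]
  [NormedAddCommGroup V] [InnerProductSpace ℝ V] [CompleteSpace V]
  {S R : ℝ → X →L[ℝ] X} {B : U →L[ℝ] X} {C : X →L[ℝ] V} {Q : U ≃L[ℝ] U}

/-- The feedback `-Q⁻¹ B* P`. -/
def feedback (B : U →L[ℝ] X) (Q : U ≃L[ℝ] U) (P : X →L[ℝ] X) : X →L[ℝ] U :=
  -((Q.symm : U →L[ℝ] U).comp (B.adjoint.comp P))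

theorem feedback_apply (P : X →L[ℝ] X) (x : X) :
    feedback B Q P x = -Q.symm (B.adjoint (P x)) := rfl

theorem comp_feedback (P : X →L[ℝ] X) :
    B.comp (feedback B Q P) = -((gramian B Q).comp P) := by
  ext x
  change B (-Q.symm (B.adjoint (P x))) = -B (Q.symm (B.adjoint (P x)))
  rw [map_neg]

/-- `⟪P x, x⟫` is the cost of the feedback control `u = K y` with initial state `x`. -/
def IsFeedbackCost (S : ℝ → X →L[ℝ] X) (B : U →L[ℝ] X) (C : X →L[ℝ] V) (Q : U ≃L[ℝ] U)
    (K : X →L[ℝ] U) (P : X →L[ℝ] X) : Prop :=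
  P.IsPositive ∧ ∀ x y, HasGenerator S x y →
    2 * ⟪P (y + B (K x)), x⟫ = -‖C x‖ ^ 2 - ⟪Q (K x), K x⟫

/-- The Riccati equation tested on the domain of the generator of `S`. -/
def SolvesRiccati (S : ℝ → X →L[ℝ] X) (B : U →L[ℝ] X) (C : X →L[ℝ] V) (Q : U ≃L[ℝ] U)
    (P : X →L[ℝ] X) : Prop :=
  P.IsPositive ∧ ∀ x y, HasGenerator S x y →
    2 * ⟪P y, x⟫ - ⟪P (gramian B Q (P x)), x⟫ + ⟪C x, C x⟫ = 0

/-- `H` is a quadratic Lyapunov functional for the generator `A + G C`. -/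
def IsDetectionFunctional (S : ℝ → X →L[ℝ] X) (C : X →L[ℝ] V) (G : V →L[ℝ] X)
    (H : X →L[ℝ] X) : Prop :=
  H.IsPositive ∧ ∀ x y, HasGenerator S x y → 2 * ⟪H (y + G (C x)), x⟫ = -‖x‖ ^ 2

/-- The feedback `K` stabilizes the generator of `S`. -/
def IsStabilizing (S : ℝ → X →L[ℝ] X) (B : U →L[ℝ] X) (K : X →L[ℝ] U) : Prop :=
  ∃ R, IsPerturbation S (B.comp K) R ∧ IsExpStable R

theorem IsExpStable.exists_lyapunov_eq {L N : X →L[ℝ] X} (h : IsPerturbation S L R)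
    (hs : IsExpStable R) (hN : N.IsPositive) :
    ∃ H : X →L[ℝ] X, H.IsPositive ∧ ∀ x y, HasGenerator S x y →
      2 * ⟪H (y + L x), x⟫ = -⟪N x, x⟫ := by
  obtain ⟨H, -, hC, hpos⟩ := exists_lyapunov h.right hs N
  refine ⟨H, hpos hN, fun x y hxy => ?_⟩
  have h1 := (h.iff x y).1 hxy
  have h2 := hC.generator h.right h.right h1 h1
  have h3 : ⟪H x, y + L x⟫ = ⟪H (y + L x), x⟫ := by
    rw [(hpos hN).inner_left_eq_inner_right, real_inner_comm]
  linarith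

theorem exists_isDetectionFunctional {G : V →L[ℝ] X} (h : IsPerturbation S (G.comp C) R)
    (hs : IsExpStable R) : ∃ H, IsDetectionFunctional S C G H := by
  obtain ⟨H, hH, h1⟩ := hs.exists_lyapunov_eq h ContinuousLinearMap.isPositive_one
  refine ⟨H, hH, fun x y hxy => ?_⟩
  rw [← real_inner_self_eq_norm_sq]
  exact h1 x y hxy

theorem IsStabilizing.exists_isFeedbackCost (hQ : (Q : U →L[ℝ] U).IsPositive) {K : X →L[ℝ] U}
    (h : IsStabilizing S B K) : ∃ P, IsFeedbackCost S B C Q K P := by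
  obtain ⟨R, hR, hs⟩ := h
  have hN : (C.adjoint.comp C + K.adjoint.comp ((Q : U →L[ℝ] U).comp K)).IsPositive :=
    (ContinuousLinearMap.isPositive_adjoint_comp_self C).add (hQ.adjoint_conj K)
  obtain ⟨P, hP, h1⟩ := hs.exists_lyapunov_eq hR hN
  refine ⟨P, hP, fun x y hxy => ?_⟩
  have h2 := h1 x y hxy
  simp only [add_apply, ContinuousLinearMap.comp_apply, inner_add_left,
    ContinuousLinearMap.adjoint_inner_left, real_inner_self_eq_norm_sq] at h2
  have h3 : ⟪(Q : U →L[ℝ] U) (K x), K x⟫ = ⟪Q (K x), K x⟫ := rfl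
  rw [h2, ← h3]
  ring

/-- H is a Lyapunov functional for A + GC, not for A + BK. The discrepancy BKx − GCx is controlled
by ‖Kx‖ and ‖Cx‖, which are exactly what P dissipates, so H plus a large multiple of P works. -/
theorem isStabilizing_of_dissipation (hS : IsClampedSemigroup S)
    (hQ : (Q : U →L[ℝ] U).IsPositive) {G : V →L[ℝ] X} {H : X →L[ℝ] X}
    (hH : IsDetectionFunctional S C G H) {K : X →L[ℝ] U} {P : X →L[ℝ] X} (hP : P.IsPositive)
    (h : ∀ x y, HasGenerator S x y →
      2 * ⟪P (y + B (K x)), x⟫ ≤ -‖C x‖ ^ 2 - ⟪Q (K x), K x⟫) : IsStabilizing S B K := by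
  obtain ⟨R, hR⟩ := exists_isPerturbation hS (B.comp K)
  refine ⟨R, hR, ?_⟩
  obtain ⟨q, hq, hqv⟩ := exists_coercive hQ
  set b := ‖H‖ * ‖B‖ with hb
  set g := ‖H‖ * ‖G‖ with hg
  -- The constant absorbs the ‖Kx‖² and ‖Cx‖² terms left by two Young inequalities, which together
  -- use up half of −‖x‖². Doubling the functional restores the full −‖x‖².
  set α := 4 * b ^ 2 / q + 4 * g ^ 2 with hα
  have hα0 : 0 ≤ α := by positivity
  have hpos : ((2 : ℝ) • (α • P + H)).IsPositive :=
    ((hP.smul_of_nonneg hα0).add hH.1).smul_of_nonneg (by norm_num)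
  refine isExpStable_of_lyapunov hR.right hpos fun x y' hxy' => ?_
  obtain ⟨y, rfl⟩ : ∃ y, y' = y + B (K x) := ⟨y' - B (K x), by abel⟩
  have hxy : HasGenerator S x y := (hR.iff x y).2 hxy'
  have h1 := h x y hxy
  have h2 := hH.2 x y hxy
  have h3 : ⟪H (y + B (K x)), x⟫
      = ⟪H (y + G (C x)), x⟫ + ⟪H (B (K x)), x⟫ - ⟪H (G (C x)), x⟫ := by
    rw [← inner_add_left, ← inner_sub_left, ← map_add, ← map_sub]
    congr 2; abel
  have h4 : ⟪H (B (K x)), x⟫ ≤ b * ‖K x‖ * ‖x‖ := by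
    refine (real_inner_le_norm _ _).trans ?_
    rw [hb, mul_assoc ‖H‖]
    gcongr
    exact (H.le_opNorm _).trans (by gcongr; exact B.le_opNorm _)
  have h5 : -⟪H (G (C x)), x⟫ ≤ g * ‖C x‖ * ‖x‖ := by
    rw [← inner_neg_left]
    refine (real_inner_le_norm _ _).trans ?_
    rw [norm_neg, hg, mul_assoc ‖H‖]
    gcongr
    exact (H.le_opNorm _).trans (by gcongr; exact G.le_opNorm _)
  have h6 := hqv (K x)
  have h7 : 4 * b ^ 2 * ‖K x‖ ^ 2 ≤ 4 * b ^ 2 / q * ⟪Q (K x), K x⟫ := by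
    rw [div_mul_eq_mul_div, le_div_iff₀ hq]
    calc _ = 4 * b ^ 2 * (q * ‖K x‖ ^ 2) := by ring
      _ ≤ _ := by gcongr
  have h8 : 2 * (b * ‖K x‖ * ‖x‖) ≤ ‖x‖ ^ 2 / 4 + 4 * b ^ 2 * ‖K x‖ ^ 2 := by
    nlinarith [sq_nonneg (‖x‖ / 2 - 2 * (b * ‖K x‖))]
  have h9 : 2 * (g * ‖C x‖ * ‖x‖) ≤ ‖x‖ ^ 2 / 4 + 4 * g ^ 2 * ‖C x‖ ^ 2 := by
    nlinarith [sq_nonneg (‖x‖ / 2 - 2 * (g * ‖C x‖))]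
  have h10 : 0 ≤ ⟪Q (K x), K x⟫ := hQ.inner_nonneg_left _
  have h11 : α * (2 * ⟪P (y + B (K x)), x⟫) ≤ α * (-‖C x‖ ^ 2 - ⟪Q (K x), K x⟫) := by gcongr
  have h12 : α * (-‖C x‖ ^ 2 - ⟪Q (K x), K x⟫)
      ≤ -(4 * g ^ 2 * ‖C x‖ ^ 2) - 4 * b ^ 2 / q * ⟪Q (K x), K x⟫ := by
    have e1 : 0 ≤ 4 * b ^ 2 / q * ‖C x‖ ^ 2 := by positivity
    have e2 : 0 ≤ 4 * g ^ 2 * ⟪Q (K x), K x⟫ := by positivity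
    rw [hα]
    linarith
  have h13 : ⟪((2 : ℝ) • (α • P + H)) (y + (B.comp K) x), x⟫
      = 2 * (α * ⟪P (y + B (K x)), x⟫ + ⟪H (y + B (K x)), x⟫) := by
    simp only [smul_apply, add_apply, inner_add_left, real_inner_smul_left,
      ContinuousLinearMap.comp_apply]
  change 2 * ⟪((2 : ℝ) • (α • P + H)) (y + (B.comp K) x), x⟫ ≤ _
  rw [h13]
  linarith

/-- Comparison of the energy balances of `K` and of the feedback associated with `P`. -/
theorem inner_feedback_expand (hQ : (Q : U →L[ℝ] U).IsPositive) {P : X →L[ℝ] X}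
    (hP : P.IsPositive) (K : X →L[ℝ] U) (x y : X) :
    2 * ⟪P (y + B (K x)), x⟫ + ⟪Q (K x), K x⟫
      = 2 * ⟪P (y + B (feedback B Q P x)), x⟫ + ⟪Q (feedback B Q P x), feedback B Q P x⟫
        + ⟪Q (K x - feedback B Q P x), K x - feedback B Q P x⟫ := by
  set F := feedback B Q P x with hF
  have hBP : B.adjoint (P x) = -Q F := by rw [hF, feedback_apply]; simp
  have h1 : ∀ u : U, ⟪P (B u), x⟫ = -⟪Q F, u⟫ := by
    intro u
    rw [hP.inner_left_eq_inner_right, ← ContinuousLinearMap.adjoint_inner_right, hBP,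
      inner_neg_right, real_inner_comm]
  have h2 : ⟪Q (K x), F⟫ = ⟪Q F, K x⟫ := by
    have := hQ.isSymmetric (K x) F
    change ⟪Q (K x), F⟫ = ⟪K x, Q F⟫ at this
    rw [this, real_inner_comm]
  simp only [map_add, map_sub, inner_add_left, inner_sub_left, inner_sub_right, h1, h2]
  ring

/-- The Riccati equation is the Lyapunov equation of its own feedback, because ⟪QFx, Fx⟫ = ⟪PNPx, x⟫
for F = −Q⁻¹B*P. -/
theorem SolvesRiccati.feedbackCost {P : X →L[ℝ] X}
    (h : SolvesRiccati S B C Q P) : IsFeedbackCost S B C Q (feedback B Q P) P := by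
  refine ⟨h.1, fun x y hxy => ?_⟩
  have h1 := h.2 x y hxy
  have h2 : ⟪Q (feedback B Q P x), feedback B Q P x⟫ = ⟪P (gramian B Q (P x)), x⟫ := by
    rw [h.1.inner_left_eq_inner_right, gramian_inner, feedback_apply]
    simp [real_inner_comm]
  have h3 : B (feedback B Q P x) = -gramian B Q (P x) := by
    rw [feedback_apply, map_neg, gramian_apply]
  rw [h2, h3, map_add, map_neg, inner_add_left, inner_neg_left]
  rw [real_inner_self_eq_norm_sq] at h1
  linarith

theorem SolvesRiccati.isStabilizing (hS : IsClampedSemigroup S)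
    (hQ : (Q : U →L[ℝ] U).IsPositive) {G : V →L[ℝ] X} {H : X →L[ℝ] X}
    (hH : IsDetectionFunctional S C G H) {P : X →L[ℝ] X} (h : SolvesRiccati S B C Q P) :
    IsStabilizing S B (feedback B Q P) :=
  isStabilizing_of_dissipation hS hQ hH h.1 fun x y hxy => ((h.feedbackCost).2 x y hxy).le

theorem IsStabilizing.inner_nonneg {K : X →L[ℝ] U} (hK : IsStabilizing S B K) {M : X →L[ℝ] X}
    (hM : M.IsSymmetric) (h : ∀ x y, HasGenerator S x y → ⟪M (y + B (K x)), x⟫ ≤ 0) (x : X) :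
    0 ≤ ⟪M x, x⟫ := by
  obtain ⟨R, hR, hs⟩ := hK
  refine inner_nonneg_of_stable hR.right hs (fun x y' hxy' => ?_) x
  obtain ⟨y, rfl⟩ : ∃ y, y' = y + B (K x) := ⟨y' - B (K x), by abel⟩
  have h1 := h x y ((hR.iff x y).2 hxy')
  have h2 : ⟪M x, y + B (K x)⟫ = ⟪M (y + B (K x)), x⟫ := by
    rw [real_inner_comm]; exact (hM _ _).symm
  linarith

/-- P' is compared with the cost of the feedback built from P: completing the square around the
feedback of P' shows that P − P' does not increase along that stable closed loop. Exchanging the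
roles gives uniqueness. -/
theorem SolvesRiccati.inner_le (hS : IsClampedSemigroup S)
    (hQ : (Q : U →L[ℝ] U).IsPositive) {G : V →L[ℝ] X} {H : X →L[ℝ] X}
    (hH : IsDetectionFunctional S C G H) {P P' : X →L[ℝ] X} (h : SolvesRiccati S B C Q P)
    (h' : SolvesRiccati S B C Q P') (x : X) : ⟪P' x, x⟫ ≤ ⟪P x, x⟫ := by
  have := (h.isStabilizing hS hQ hH).inner_nonneg (M := P - P')
    (h.1.isSymmetric.sub h'.1.isSymmetric) (fun x y hxy => by
      have h1 := (h.feedbackCost).2 x y hxy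
      have h2 := (h'.feedbackCost).2 x y hxy
      have h3 := inner_feedback_expand hQ h'.1 (B := B) (feedback B Q P) x y
      have h4 : 0 ≤ ⟪Q (feedback B Q P x - feedback B Q P' x),
        feedback B Q P x - feedback B Q P' x⟫ := hQ.inner_nonneg_left _
      rw [sub_apply, inner_sub_left]
      linarith) x
  rwa [sub_apply, inner_sub_left, sub_nonneg] at this

theorem SolvesRiccati.unique (hS : IsClampedSemigroup S)
    (hQ : (Q : U →L[ℝ] U).IsPositive) {G : V →L[ℝ] X} {H : X →L[ℝ] X}
    (hH : IsDetectionFunctional S C G H) {P P' : X →L[ℝ] X} (h : SolvesRiccati S B C Q P)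
    (h' : SolvesRiccati S B C Q P') : P' = P := by
  have h1 : ((P' - P : X →L[ℝ] X) : X →ₗ[ℝ] X).IsSymmetric :=
    h'.1.isSymmetric.sub h.1.isSymmetric
  have h2 := h1.inner_map_self_eq_zero.1 (fun x => by
    change ⟪P' x - P x, x⟫ = 0
    rw [inner_sub_left, sub_eq_zero]
    exact le_antisymm (h.inner_le hS hQ hH h' x) (h'.inner_le hS hQ hH h x))
  rw [← sub_eq_zero]
  ext x
  exact congrArg (fun l : X →ₗ[ℝ] X => l x) h2

/-- One step of Kleinman's iteration. -/
theorem exists_kleinman_step (hS : IsClampedSemigroup S) (hQ : (Q : U →L[ℝ] U).IsPositive)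
    {G : V →L[ℝ] X} {H : X →L[ℝ] X} (hH : IsDetectionFunctional S C G H) {K : X →L[ℝ] U}
    {P : X →L[ℝ] X} (h : IsFeedbackCost S B C Q K P) :
    IsStabilizing S B (feedback B Q P) ∧
      ∃ P', IsFeedbackCost S B C Q (feedback B Q P) P' ∧ ∀ x, ⟪P' x, x⟫ ≤ ⟪P x, x⟫ := by
  -- Completing the square: replacing K by the feedback of P can only improve the energy balance.
  -- This gives both stability of the new closed loop and monotonicity of the costs.
  have hdiss : ∀ x y, HasGenerator S x y → 2 * ⟪P (y + B (feedback B Q P x)), x⟫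
      ≤ -‖C x‖ ^ 2 - ⟪Q (feedback B Q P x), feedback B Q P x⟫ := by
    intro x y hxy
    have h1 := h.2 x y hxy
    have h2 := inner_feedback_expand hQ h.1 (B := B) K x y
    have h3 : 0 ≤ ⟪Q (K x - feedback B Q P x), K x - feedback B Q P x⟫ :=
      hQ.inner_nonneg_left _
    linarith
  have hst := isStabilizing_of_dissipation hS hQ hH h.1 hdiss
  refine ⟨hst, ?_⟩
  obtain ⟨P', hP'⟩ := hst.exists_isFeedbackCost (C := C) hQ
  refine ⟨P', hP', fun x => ?_⟩
  have := hst.inner_nonneg (M := P - P') (h.1.isSymmetric.sub hP'.1.isSymmetric)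
    (fun x y hxy => by
      have h1 := hdiss x y hxy
      have h2 := hP'.2 x y hxy
      rw [sub_apply, inner_sub_left]
      linarith) x
  rwa [sub_apply, inner_sub_left, sub_nonneg] at this

theorem exists_solvesRiccati (hS : IsClampedSemigroup S) (hQ : (Q : U →L[ℝ] U).IsPositive)
    {G : V →L[ℝ] X} {H : X →L[ℝ] X} (hH : IsDetectionFunctional S C G H) {K₀ : X →L[ℝ] U}
    (hK₀ : IsStabilizing S B K₀) : ∃ P, SolvesRiccati S B C Q P := by
  obtain ⟨P₀, hP₀⟩ := hK₀.exists_isFeedbackCost (C := C) hQ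
  let St := {p : (X →L[ℝ] U) × (X →L[ℝ] X) // IsFeedbackCost S B C Q p.1 p.2}
  have hstep : ∀ p : St, ∃ p' : St, p'.1.1 = feedback B Q p.1.2 ∧
      ∀ x, ⟪p'.1.2 x, x⟫ ≤ ⟪p.1.2 x, x⟫ := by
    rintro ⟨⟨K, P⟩, h⟩
    obtain ⟨-, P', hP', hle⟩ := exists_kleinman_step hS hQ hH h
    exact ⟨⟨(feedback B Q P, P'), hP'⟩, rfl, hle⟩
  choose next hnext hle using hstep
  let s : ℕ → St := fun n => Nat.rec ⟨(K₀, P₀), hP₀⟩ (fun _ p => next p) n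
  let P : ℕ → X →L[ℝ] X := fun n => (s n).1.2
  obtain ⟨L, hL, hlim⟩ := exists_strong_limit (P := P) (fun n => (s n).2.1) fun n x => hle (s n) x
  refine ⟨L, hL, fun x y hxy => ?_⟩
  have heq : ∀ n, 2 * ⟪P (n + 1) (y + B (feedback B Q (P n) x)), x⟫
      = -‖C x‖ ^ 2 - ⟪Q (feedback B Q (P n) x), feedback B Q (P n) x⟫ := by
    intro n
    have h1 := (s (n + 1)).2.2 x y hxy
    rwa [show (s (n + 1)).1.1 = feedback B Q (P n) from hnext (s n)] at h1
  have hF : Tendsto (fun n => feedback B Q (P n) x) atTop (𝓝 (feedback B Q L x)) := by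
    have hc : Continuous fun v : X => -Q.symm (B.adjoint v) := by fun_prop
    exact (hc.tendsto (L x)).comp (hlim x)
  have hl1 : Tendsto (fun n => 2 * ⟪P (n + 1) (y + B (feedback B Q (P n) x)), x⟫) atTop
      (𝓝 (2 * ⟪L (y + B (feedback B Q L x)), x⟫)) := by
    -- Symmetry moves the operator onto the fixed vector x, so strong convergence at x is all that
    -- the limit requires.
    have e1 : ∀ n, ⟪P (n + 1) (y + B (feedback B Q (P n) x)), x⟫
        = ⟪y + B (feedback B Q (P n) x), P (n + 1) x⟫ := fun n =>
      (s (n + 1)).2.1.inner_left_eq_inner_right _ _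
    simp only [e1, hL.inner_left_eq_inner_right]
    exact (((B.continuous.tendsto _).comp hF).const_add y |>.inner
      ((tendsto_add_atTop_iff_nat 1).2 (hlim x))).const_mul 2
  have hl2 : Tendsto (fun n => -‖C x‖ ^ 2 - ⟪Q (feedback B Q (P n) x), feedback B Q (P n) x⟫)
      atTop (𝓝 (-‖C x‖ ^ 2 - ⟪Q (feedback B Q L x), feedback B Q L x⟫)) :=
    (((Q.continuous.tendsto _).comp hF).inner hF).const_sub _
  have h1 := tendsto_nhds_unique (hl1.congr heq) hl2
  have h2 : ⟪Q (feedback B Q L x), feedback B Q L x⟫ = ⟪L (gramian B Q (L x)), x⟫ := by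
    rw [hL.inner_left_eq_inner_right, gramian_inner, feedback_apply]
    simp [real_inner_comm]
  have h3 : B (feedback B Q L x) = -gramian B Q (L x) := by
    rw [feedback_apply, map_neg, gramian_apply]
  rw [h2, h3, map_add, map_neg, inner_add_left, inner_neg_left] at h1
  rw [real_inner_self_eq_norm_sq]
  linarith

/-- Polarizing the quadratic equation at x, x' and x + x' gives PA_P + A*P + C*C = 0 with A_P = A −
NP: closed loop on one side, original generator on the other. -/
theorem SolvesRiccati.isConjugation {P : X →L[ℝ] X} (hQ : (Q : U →L[ℝ] U).IsPositive)
    (h : SolvesRiccati S B C Q P) (hR : IsPerturbation S (-((gramian B Q).comp P)) R) :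
    IsConjugation R S P (C.adjoint.comp C) := by
  refine isConjugation_of_generator hR.right hR.left fun x y' x' z hxy' hx' => ?_
  obtain ⟨y, rfl⟩ : ∃ y, y' = y + (-((gramian B Q).comp P)) x :=
    ⟨y' - (-((gramian B Q).comp P)) x, by abel⟩
  have hxy : HasGenerator S x y := (hR.iff x y).2 hxy'
  have hsum : HasGenerator S (x + x') (y + z) := by
    refine (hxy.add hx').congr fun t => ?_
    rw [map_add, ← smul_add]
    congr 1; abel
  have e1 := h.2 _ _ hxy
  have e2 := h.2 _ _ hx'
  have e3 := h.2 _ _ hsum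
  have s1 : ⟪P y, x'⟫ = ⟪P x', y⟫ := by rw [h.1.inner_left_eq_inner_right, real_inner_comm]
  have s2 : ∀ a b : X, ⟪P (gramian B Q (P a)), b⟫ = ⟪gramian B Q (P a), P b⟫ := fun a b =>
    h.1.inner_left_eq_inner_right _ _
  have s3 : ⟪gramian B Q (P x'), P x⟫ = ⟪gramian B Q (P x), P x'⟫ := by
    rw [(gramian_isPositive B hQ).inner_left_eq_inner_right, real_inner_comm]
  have s4 : ⟪C x', C x⟫ = ⟪C x, C x'⟫ := real_inner_comm _ _
  have s5 : ⟪P z, x⟫ = ⟪P x, z⟫ := by rw [h.1.inner_left_eq_inner_right, real_inner_comm]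
  simp only [map_add, inner_add_left, inner_add_right, s2, s3, s4, s5] at e1 e2 e3
  simp only [neg_apply, ContinuousLinearMap.comp_apply, map_add, map_neg, inner_add_left,
    inner_neg_left, s2, ContinuousLinearMap.adjoint_inner_left]
  linarith

end Riccati

/-! ### From stabilizability of the adjoint pair to a stable semigroup for A + GC. -/

section Detectability

variable {X V : Type*}
  [NormedAddCommGroup X] [InnerProductSpace ℝ X] [CompleteSpace X]
  [NormedAddCommGroup V] [InnerProductSpace ℝ V] [CompleteSpace V]

/-- If A* + C*K generates a stable D, take G = K*. The generators of A + K*C and D are formally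
adjoint, so the semigroups are adjoint to each other and have equal norms. -/
theorem IsExpDetectable.exists_perturbation {A : X →ₗ.[ℝ] X} {S : ℝ → X →L[ℝ] X}
    {C : X →L[ℝ] V} (hA : Generates A S) (hS : IsClampedSemigroup S) (h : IsExpDetectable A C) :
    ∃ (G : V →L[ℝ] X) (R : ℝ → X →L[ℝ] X), IsPerturbation S (G.comp C) R ∧ IsExpStable R := by
  obtain ⟨K, D, hD, hs⟩ := h
  obtain ⟨R, hR⟩ := exists_isPerturbation hS (K.adjoint.comp C)
  refine ⟨K.adjoint, R, hR, ?_⟩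
  have hdense : Dense (A.domain : Set X) := by
    refine hS.dense_domain.mono ?_
    rintro x ⟨y, hy⟩
    obtain ⟨z, hz, -⟩ := hA.exists_domain hy
    rw [← hz]; exact z.2
  have hpair : ∀ x y v w, HasGenerator R x y → HasGenerator (clampSemigroup D) v w →
      ⟪y, v⟫ = ⟪x, w⟫ := by
    intro x y v w hx hv
    have hx' := (hR.iff x (y - (K.adjoint.comp C) x)).2 (by rwa [sub_add_cancel])
    obtain ⟨a, ha, hAa⟩ := hA.exists_domain hx'
    obtain ⟨b, hb, hAb⟩ := hD.exists_domain (hasGenerator_clampSemigroup.1 hv)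
    have h1 : addBounded A.adjoint (C.adjoint.comp K) b
        = (C.adjoint.comp K) (b : X) + A.adjoint b := LinearPMap.vadd_apply _ _ _
    have h2 := LinearPMap.adjoint_isFormalAdjoint hdense b a
    rw [h1, hb] at hAb
    have h3 : (b : X) = v := hb
    rw [hAa, ha, h3] at h2
    have h4 : ⟪(K.adjoint.comp C) x, v⟫ = ⟪x, (C.adjoint.comp K) v⟫ := by
      simp only [ContinuousLinearMap.comp_apply, ContinuousLinearMap.adjoint_inner_left,
        ContinuousLinearMap.adjoint_inner_right]
    have h5 : ⟪x, A.adjoint b⟫ = ⟪y, v⟫ - ⟪(K.adjoint.comp C) x, v⟫ := by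
      rw [real_inner_comm, h2, inner_sub_right, real_inner_comm v, real_inner_comm v]
    rw [← hAb, inner_add_right, h5, h4]
    ring
  obtain ⟨c, hc, ν, hν, hb⟩ := hs.clampSemigroup
  refine ⟨c, hc, ν, hν, fun t ht => ?_⟩
  have := eq_adjoint_of_formal_adjoint hR.right hD.1.isClampedSemigroup hpair ht
  rw [← LinearIsometryEquiv.norm_map ContinuousLinearMap.adjoint (R t), ← this]
  exact hb t ht

end Detectability

/-! ### Invertibility of I − R(p) for a stable semigroup. -/

section Stable

variable {X : Type*} [NormedAddCommGroup X] [InnerProductSpace ℝ X] [CompleteSpace X]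
  {R : ℝ → X →L[ℝ] X}

theorem IsExpStable.adjoint (h : IsExpStable R) : IsExpStable fun t => (R t).adjoint := by
  obtain ⟨c, hc, ν, hν, hb⟩ := h
  exact ⟨c, hc, ν, hν, fun t ht => by rw [LinearIsometryEquiv.norm_map]; exact hb t ht⟩

/-- ‖R(p)‖ may exceed 1, but some power R(p)^n = R(np) has norm below 1. Then I − R(p)^n is
invertible, and I − R(p) is a commuting factor of it. -/
theorem IsExpStable.isUnit_one_sub (hR : IsClampedSemigroup R) (h : IsExpStable R) {p : ℝ}
    (hp : 0 < p) : IsUnit (1 - R p) := by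
  obtain ⟨c, hc, ν, hν, hb⟩ := h
  have hpow : ∀ n : ℕ, R p ^ n = R (n * p) := by
    intro n
    induction n with
    | zero => rw [pow_zero, Nat.cast_zero, zero_mul, hR.map_zero]; rfl
    | succ n ih =>
      rw [pow_succ, ih, Nat.cast_succ, add_mul, one_mul, hR.map_add _ _ (by positivity) hp.le]
      rfl
  have hlim : Tendsto (fun n : ℕ => c * Real.exp (-ν * (n * p))) atTop (𝓝 0) := by
    have h1 : Tendsto (fun n : ℕ => -ν * ((n : ℝ) * p)) atTop atBot :=
      (tendsto_natCast_atTop_atTop.atTop_mul_const hp).const_mul_atTop_of_neg (by linarith)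
    simpa using (Real.tendsto_exp_atBot.comp h1).const_mul c
  obtain ⟨n, hn⟩ := (hlim.eventually (gt_mem_nhds (zero_lt_one' ℝ))).exists
  have hlt : ‖R p ^ n‖ < 1 := by
    rw [hpow]
    exact (hb _ (by positivity)).trans_lt hn
  have hu : IsUnit (1 - R p ^ n) := (Units.oneSub _ hlt).isUnit
  have h1 := mul_neg_geom_sum (R p) n
  have h2 := geom_sum_mul_neg (R p) n
  rw [← h1] at hu
  exact ((Commute.isUnit_mul_iff (h1.trans h2.symm)).1 hu).1

theorem IsExpStable.eq_zero_of_fixed (hR : IsClampedSemigroup R) (h : IsExpStable R) {p : ℝ}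
    (hp : 0 < p) {x : X} (hx : R p x = x) : x = 0 := by
  obtain ⟨v, hv⟩ := h.isUnit_one_sub hR hp
  have h1 : (v : X →L[ℝ] X) x = 0 := by
    rw [hv]
    change x - R p x = 0
    rw [hx, sub_self]
  have h2 : ((v⁻¹ : (X →L[ℝ] X)ˣ) : X →L[ℝ] X) ((v : X →L[ℝ] X) x) = x :=
    congrArg (fun L : X →L[ℝ] X => L x) v.inv_mul
  rw [← h2, h1, map_zero]

end Stable

/-! ### Integrability of inner products. -/

section SquareIntegrable

variable {α U W : Type*} [MeasurableSpace α] {μ : Measure α}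
  [NormedAddCommGroup U] [InnerProductSpace ℝ U]

theorem memLp_two_integrable_inner {f g : α → U} (hf : MemLp f 2 μ) (hg : MemLp g 2 μ) :
    Integrable (fun t => ⟪f t, g t⟫) μ :=
  (hf.norm.integrable_mul hg.norm).mono' (hf.1.inner hg.1)
    (Eventually.of_forall fun _ => norm_inner_le_norm _ _)

end SquareIntegrable

/-! ### The Hamiltonian system, sufficiency of extremality, and uniqueness. -/

section Hamiltonian

variable {X U V : Type*}
  [NormedAddCommGroup X] [InnerProductSpace ℝ X] [CompleteSpace X]
  [NormedAddCommGroup U] [InnerProductSpace ℝ U] [CompleteSpace U]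
  [NormedAddCommGroup V] [InnerProductSpace ℝ V] [CompleteSpace V]
  {S R D : ℝ → X →L[ℝ] X} {B : U →L[ℝ] X} {C : X →L[ℝ] V} {Q : U ≃L[ℝ] U} {P : X →L[ℝ] X}
  {G : V →L[ℝ] X}

/-- `P` solves the Riccati equation of a linear quadratic problem, `R` is the stable semigroup of
the closed loop, and `D` is the stable semigroup generated by `A + G C`. -/
structure IsLQSetting (S : ℝ → X →L[ℝ] X) (B : U →L[ℝ] X) (C : X →L[ℝ] V) (Q : U ≃L[ℝ] U)
    (P : X →L[ℝ] X) (R : ℝ → X →L[ℝ] X) (G : V →L[ℝ] X) (D : ℝ → X →L[ℝ] X) : Prop where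
  pos : (Q : U →L[ℝ] U).IsPositive
  riccati : SolvesRiccati S B C Q P
  closedLoop : IsPerturbation S (-((gramian B Q).comp P)) R
  stable : IsExpStable R
  detector : IsPerturbation S (G.comp C) D
  stable_detector : IsExpStable D

theorem intervalIntegrable_clm {Y Z : Type*} [NormedAddCommGroup Y] [NormedSpace ℝ Y]
    [NormedAddCommGroup Z] [NormedSpace ℝ Z] {f : ℝ → Y} {a b : ℝ}
    (hf : IntervalIntegrable f volume a b) (L : Y →L[ℝ] Z) :
    IntervalIntegrable (fun t => L (f t)) volume a b :=
  ⟨L.integrable_comp hf.1, L.integrable_comp hf.2⟩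

theorem adjoint_gramian_comp (hQ : (Q : U →L[ℝ] U).IsPositive) (hP : P.IsPositive) (x : X) :
    (-((gramian B Q).comp P)).adjoint x = -P (gramian B Q x) := by
  rw [map_neg, ContinuousLinearMap.adjoint_comp, hP.isSelfAdjoint.adjoint_eq,
    (gramian_isPositive B hQ).isSelfAdjoint.adjoint_eq]
  rfl

/-- From the decoupled unknowns (y, w) back to (y, λ), λ = w − Py. Both equations are rewritten with
S instead of R, conjugation by P makes Py a backward solution for S, and subtraction cancels the
terms PNw. -/
theorem IsLQSetting.hamiltonian (h : IsLQSetting S B C Q P R G D) {a b : ℝ} (hab : a ≤ b)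
    {h₁ h₂ y w : ℝ → X} (hh₁ : IntervalIntegrable h₁ volume a b)
    (hh₂ : IntervalIntegrable h₂ volume a b)
    (hy : MildOn R (fun t => gramian B Q (w t) + h₁ t) y a b)
    (hw : BackMildOn R (fun t => h₂ t + P (h₁ t)) w a b) :
    MildOn S (fun t => gramian B Q (w t - P (y t)) + h₁ t) y a b ∧
      BackMildOn S (fun t => C.adjoint (C (y t)) + h₂ t) (fun t => w t - P (y t)) a b := by
  have hS := h.closedLoop.left
  have hR := h.closedLoop.right
  have hwi : IntervalIntegrable w volume a b :=
    ContinuousOn.intervalIntegrable (by rw [uIcc_of_le hab]; exact hw.continuousOn)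
  have hyi : IntervalIntegrable y volume a b :=
    ContinuousOn.intervalIntegrable (by rw [uIcc_of_le hab]; exact hy.1)
  have hF : IntervalIntegrable (fun t => gramian B Q (w t) + h₁ t) volume a b :=
    (intervalIntegrable_clm hwi _).add hh₁
  have hg : IntervalIntegrable (fun t => h₂ t + P (h₁ t)) volume a b :=
    hh₂.add (intervalIntegrable_clm hh₁ _)
  constructor
  · refine (hy.change_semigroup hS hR h.closedLoop.duhamel hF).congr
      (Eventually.of_forall fun t _ => ?_) fun t _ => rfl
    change _ = _ + -(gramian B Q (P (y t)))
    rw [map_sub]; abel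
  · have h1 := hw.change_semigroup hS hR h.closedLoop.duhamel_adjoint hg
    simp only [adjoint_gramian_comp h.pos h.riccati.1] at h1
    have h2 := hy.conjugate hR hS (h.riccati.isConjugation h.pos h.closedLoop) hF
    refine (h1.sub hS ?_ ?_ h2).congr (Eventually.of_forall fun t _ => ?_) fun t _ => rfl
    · exact hg.sub (intervalIntegrable_clm (intervalIntegrable_clm hwi _) P).neg
    · exact (intervalIntegrable_clm hF P).sub (intervalIntegrable_clm hyi (C.adjoint.comp C))
    · simp only [map_add, ContinuousLinearMap.comp_apply]
      abel

/-- A pair `(y, u)` with an adjoint state `l` satisfying the Hamiltonian system. -/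
structure IsExtremalOn (S : ℝ → X →L[ℝ] X) (B : U →L[ℝ] X) (C : X →L[ℝ] V) (Q : U ≃L[ℝ] U)
    (yd : ℝ → X) (ud : ℝ → U) (T : ℝ) (y : ℝ → X) (u : ℝ → U) (l : ℝ → X) : Prop where
  mild : MildOn S (fun t => B (u t)) y 0 T
  back : BackMildOn S (fun t => C.adjoint (C (y t)) - C.adjoint (C (yd t))) l 0 T
  control : ∀ᵐ t ∂volume.restrict (Ioc 0 T), u t = ud t + Q.symm (B.adjoint (l t))

variable {yd : ℝ → X} {ud : ℝ → U} {T : ℝ} {y : ℝ → X} {u : ℝ → U} {l : ℝ → X}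

theorem MemLp.intervalIntegrable_two (hT : 0 ≤ T) (hu : MemLp u 2 (volume.restrict (Ioc 0 T))) :
    IntervalIntegrable u volume 0 T :=
  (intervalIntegrable_iff_integrableOn_Ioc_of_le hT).2 (hu.integrable one_le_two)

theorem ContinuousOn.memLp_Ioc {l : ℝ → X} (hl : ContinuousOn l (Icc 0 T)) :
    MemLp l 2 (volume.restrict (Ioc 0 T)) := by
  obtain ⟨M, hM⟩ := isCompact_Icc.exists_bound_of_continuousOn hl
  refine MemLp.of_bound ((hl.mono Ioc_subset_Icc_self).aestronglyMeasurable measurableSet_Ioc) M ?_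
  filter_upwards [ae_restrict_mem measurableSet_Ioc] with t ht
    using hM t (Ioc_subset_Icc_self ht)

theorem memLp_control (hud : MemLp ud 2 (volume.restrict (Ioc 0 T)))
    (hl : ContinuousOn l (Icc 0 T))
    (hu : ∀ᵐ t ∂volume.restrict (Ioc 0 T), u t = ud t + Q.symm (B.adjoint (l t))) :
    MemLp u 2 (volume.restrict (Ioc 0 T)) := by
  have h1 := hud.add (((Q.symm : U →L[ℝ] U).comp B.adjoint).comp_memLp'
    (ContinuousOn.memLp_Ioc hl))
  exact (memLp_congr_ae hu).2 h1

theorem ae_Ioc_iff {p : ℝ → Prop} {a b : ℝ} :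
    (∀ᵐ t ∂volume.restrict (Ioc a b), p t) ↔ ∀ᵐ t, t ∈ Ioc a b → p t :=
  ae_restrict_iff' measurableSet_Ioc

theorem isTrajectory_iff (hS : IsClampedSemigroup S) (hT : 0 ≤ T) :
    IsTrajectory S B T y u ↔
      MemLp u 2 (volume.restrict (Ioc 0 T)) ∧ MildOn S (fun t => B (u t)) y 0 T := by
  refine and_congr_right fun hu => ?_
  exact mildOn_iff hS hT (intervalIntegrable_clm (MemLp.intervalIntegrable_two hT hu) B)

theorem isExtremal_iff (hS : IsClampedSemigroup S) (hT : 0 ≤ T)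
    (hud : MemLp ud 2 (volume.restrict (Ioc 0 T))) (hyd : ContinuousOn yd (Icc 0 T)) :
    IsExtremal S B C Q yd ud T y u l ↔ IsExtremalOn S B C Q yd ud T y u l := by
  have hudi := intervalIntegrable_clm (MemLp.intervalIntegrable_two hT hud) B
  have hcont : ∀ {f : ℝ → X}, ContinuousOn f (Icc 0 T) → IntervalIntegrable f volume 0 T :=
    fun hf => ContinuousOn.intervalIntegrable (by rwa [uIcc_of_le hT])
  have hg : ContinuousOn y (Icc 0 T) → IntervalIntegrable
      (fun t => C.adjoint (C (y t)) - C.adjoint (C (yd t))) volume 0 T := fun hy =>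
    (intervalIntegrable_clm (hcont hy) (C.adjoint.comp C)).sub
      (intervalIntegrable_clm (hcont hyd) (C.adjoint.comp C))
  have hf : ContinuousOn l (Icc 0 T) → IntervalIntegrable
      (fun t => gramian B Q (l t) + B (ud t)) volume 0 T := fun hl =>
    (intervalIntegrable_clm (hcont hl) _).add hudi
  constructor
  · rintro ⟨h1, h2, h3⟩
    refine ⟨?_, (backMildOn_iff hS (hg h1.1)).1 h2, h3⟩
    refine ((mildOn_iff hS hT (hf h2.1)).1 h1).congr ?_ fun t _ => rfl
    filter_upwards [ae_Ioc_iff.1 h3] with t ht hm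
    rw [ht hm, map_add, gramian_apply, add_comm]
  · rintro ⟨h1, h2, h3⟩
    refine ⟨?_, (backMildOn_iff hS (hg h1.1)).2 h2, h3⟩
    refine (mildOn_iff hS hT (hf h2.continuousOn)).2 (h1.congr ?_ fun t _ => rfl)
    filter_upwards [ae_Ioc_iff.1 h3] with t ht hm
    rw [ht hm, map_add, gramian_apply, add_comm]

/-- The second variation of the cost, evaluated at a variation `(y, u)`. -/
def costVariation (C : X →L[ℝ] V) (Q : U ≃L[ℝ] U) (T : ℝ) (y : ℝ → X) (u : ℝ → U) : ℝ :=
  ∫ t in (0 : ℝ)..T, (‖C (y t)‖ ^ 2 + ⟪Q (u t), u t⟫)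

theorem integrable_costVariation (hy : ContinuousOn y (Icc 0 T))
    (hu : MemLp u 2 (volume.restrict (Ioc 0 T))) :
    Integrable (fun t => ‖C (y t)‖ ^ 2 + ⟪Q (u t), u t⟫) (volume.restrict (Ioc 0 T)) := by
  have h1 : MemLp (fun t => C (y t)) 2 (volume.restrict (Ioc 0 T)) :=
    C.comp_memLp' (ContinuousOn.memLp_Ioc hy)
  have h2 : MemLp (fun t => Q (u t)) 2 (volume.restrict (Ioc 0 T)) :=
    (Q : U →L[ℝ] U).comp_memLp' hu
  have h3 := memLp_two_integrable_inner h1 h1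
  simp only [real_inner_self_eq_norm_sq] at h3
  exact h3.add (memLp_two_integrable_inner h2 hu)

theorem costVariation_eq_zero (hT : 0 ≤ T) (hQ : (Q : U →L[ℝ] U).IsPositive)
    (hy : ContinuousOn y (Icc 0 T)) (hu : MemLp u 2 (volume.restrict (Ioc 0 T)))
    (h : costVariation C Q T y u ≤ 0) :
    ∀ᵐ t ∂volume.restrict (Ioc 0 T), C (y t) = 0 ∧ u t = 0 := by
  have hnn : ∀ t, 0 ≤ ⟪Q (u t), u t⟫ := fun t => hQ.inner_nonneg_left (u t)
  rw [costVariation, intervalIntegral.integral_of_le hT] at h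
  have h0 : 0 ≤ᵐ[volume.restrict (Ioc 0 T)] fun t => ‖C (y t)‖ ^ 2 + ⟪Q (u t), u t⟫ :=
    Eventually.of_forall fun t => add_nonneg (sq_nonneg _) (hnn t)
  have h1 := (integral_eq_zero_iff_of_nonneg_ae h0 (integrable_costVariation hy hu)).1
    (le_antisymm h (integral_nonneg_of_ae h0))
  obtain ⟨q, hq, hqv⟩ := exists_coercive hQ
  filter_upwards [h1] with t ht
  have h2 : ‖C (y t)‖ ^ 2 + ⟪Q (u t), u t⟫ = 0 := ht
  have h3 := hqv (u t)
  have h4 : ‖C (y t)‖ ^ 2 = 0 := le_antisymm (by linarith [hnn t]) (sq_nonneg _)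
  have h5 : q * ‖u t‖ ^ 2 ≤ 0 := by linarith
  have h6 : ‖u t‖ ^ 2 = 0 := le_antisymm (by nlinarith) (sq_nonneg _)
  exact ⟨norm_eq_zero.1 (pow_eq_zero_iff two_ne_zero |>.1 h4),
    norm_eq_zero.1 (pow_eq_zero_iff two_ne_zero |>.1 h6)⟩

theorem costVariation_nonneg (hT : 0 ≤ T) (hQ : (Q : U →L[ℝ] U).IsPositive) :
    0 ≤ costVariation C Q T y u :=
  intervalIntegral.integral_nonneg hT fun t _ =>
    add_nonneg (sq_nonneg _) (hQ.inner_nonneg_left (u t))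

/-- The cost is quadratic, so its second-order expansion is exact. The linear term is integrated by
duality against λ, thanks to Q(u − u_d) = B*λ, and the boundary condition on l makes it vanish. -/
theorem IsExtremalOn.cost_eq (hS : IsClampedSemigroup S) (hT : 0 ≤ T)
    (hQ : (Q : U →L[ℝ] U).IsPositive) (hud : MemLp ud 2 (volume.restrict (Ioc 0 T)))
    (hyd : ContinuousOn yd (Icc 0 T)) (h : IsExtremalOn S B C Q yd ud T y u l) {y' : ℝ → X}
    {u' : ℝ → U} (hu' : MemLp u' 2 (volume.restrict (Ioc 0 T)))
    (hy' : MildOn S (fun t => B (u' t)) y' 0 T)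
    (hbd : ⟪l T, y' T - y T⟫ = ⟪l 0, y' 0 - y 0⟫) :
    cost C Q yd ud T y' u' = cost C Q yd ud T y u
      + 1 / 2 * costVariation C Q T (fun t => y' t - y t) (fun t => u' t - u t) := by
  have hu : MemLp u 2 (volume.restrict (Ioc 0 T)) :=
    memLp_control hud h.back.continuousOn h.control
  have hBu := intervalIntegrable_clm (MemLp.intervalIntegrable_two hT hu) B
  have hBu' := intervalIntegrable_clm (MemLp.intervalIntegrable_two hT hu') B
  have hδ := hy'.sub hS hBu' hBu h.mild
  have hgc : ContinuousOn (fun t => C.adjoint (C (y t)) - C.adjoint (C (yd t))) (Icc 0 T) :=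
    ((C.adjoint.comp C).continuous.comp_continuousOn h.mild.1).sub
      ((C.adjoint.comp C).continuous.comp_continuousOn hyd)
  have hdual := h.back.inner_sub_inner hS hT (hBu'.sub hBu) hgc hδ
  rw [hbd, sub_self] at hdual
  have hlδ : Integrable (fun t => ⟪l t, B (u' t) - B (u t)⟫) (volume.restrict (Ioc 0 T)) :=
    memLp_two_integrable_inner (ContinuousOn.memLp_Ioc h.back.continuousOn)
      ((B.comp_memLp' hu').sub (B.comp_memLp' hu))
  have hgδ : Integrable (fun t => ⟪C.adjoint (C (y t)) - C.adjoint (C (yd t)), y' t - y t⟫)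
      (volume.restrict (Ioc 0 T)) :=
    memLp_two_integrable_inner (ContinuousOn.memLp_Ioc hgc) (ContinuousOn.memLp_Ioc hδ.1)
  have hi0 : Integrable (fun t => ‖C (y t - yd t)‖ ^ 2 + ⟪Q (u t - ud t), u t - ud t⟫)
      (volume.restrict (Ioc 0 T)) := integrable_costVariation (h.mild.1.sub hyd) (hu.sub hud)
  have hi2 : Integrable (fun t => ‖C (y' t - y t)‖ ^ 2 + ⟪Q (u' t - u t), u' t - u t⟫)
      (volume.restrict (Ioc 0 T)) := integrable_costVariation hδ.1 (hu'.sub hu)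
  have hi3 : Integrable (fun t => 2 * (⟪l t, B (u' t) - B (u t)⟫
      + ⟪C.adjoint (C (y t)) - C.adjoint (C (yd t)), y' t - y t⟫)) (volume.restrict (Ioc 0 T)) :=
    (hlδ.add hgδ).const_mul 2
  have hi23 : Integrable (fun t => (‖C (y' t - y t)‖ ^ 2 + ⟪Q (u' t - u t), u' t - u t⟫)
      + 2 * (⟪l t, B (u' t) - B (u t)⟫
      + ⟪C.adjoint (C (y t)) - C.adjoint (C (yd t)), y' t - y t⟫)) (volume.restrict (Ioc 0 T)) :=
    hi2.add hi3
  simp only [cost, costVariation]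
  rw [intervalIntegral.integral_of_le hT] at hdual ⊢
  rw [intervalIntegral.integral_of_le hT, intervalIntegral.integral_of_le hT]
  have hsum : ∫ t in Ioc 0 T, (‖C (y' t - yd t)‖ ^ 2 + ⟪Q (u' t - ud t), u' t - ud t⟫)
      = ∫ t in Ioc 0 T, ((‖C (y t - yd t)‖ ^ 2 + ⟪Q (u t - ud t), u t - ud t⟫)
        + ((‖C (y' t - y t)‖ ^ 2 + ⟪Q (u' t - u t), u' t - u t⟫)
        + 2 * (⟪l t, B (u' t) - B (u t)⟫
          + ⟪C.adjoint (C (y t)) - C.adjoint (C (yd t)), y' t - y t⟫))) := by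
    refine integral_congr_ae ?_
    filter_upwards [h.control] with t ht
    have e1 : C (y' t - yd t) = C (y t - yd t) + C (y' t - y t) := by
      rw [← map_add]; congr 1; abel
    have e2 : u' t - ud t = (u t - ud t) + (u' t - u t) := by abel
    have e3 : ⟪l t, B (u' t) - B (u t)⟫ = ⟪Q (u t - ud t), u' t - u t⟫ := by
      rw [ht, add_sub_cancel_left, ContinuousLinearEquiv.apply_symm_apply,
        ContinuousLinearMap.adjoint_inner_left, map_sub, ← ht]
    have e4 : ⟪C.adjoint (C (y t)) - C.adjoint (C (yd t)), y' t - y t⟫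
        = ⟪C (y t - yd t), C (y' t - y t)⟫ := by
      rw [← map_sub, ← map_sub, ContinuousLinearMap.adjoint_inner_left]
    have e5 : ⟪Q (u' t - u t), u t - ud t⟫ = ⟪Q (u t - ud t), u' t - u t⟫ := by
      have := hQ.isSymmetric (u' t - u t) (u t - ud t)
      change ⟪Q (u' t - u t), u t - ud t⟫ = ⟪u' t - u t, Q (u t - ud t)⟫ at this
      rw [this, real_inner_comm]
    rw [e1, e2, e3, e4, norm_add_sq_real, map_add]
    simp only [inner_add_left, inner_add_right, e5]
    ring
  rw [hsum, integral_add hi0 hi23, integral_add hi2 hi3, integral_const_mul, ← hdual]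
  ring

/-- Since Cy = 0, adding the output injection GCy changes nothing, so y is also an orbit of the
detector semigroup. -/
theorem IsLQSetting.eq_of_unobserved (h : IsLQSetting S B C Q P R G D) {f : ℝ → X}
    (hT : 0 ≤ T) (hf : IntervalIntegrable f volume 0 T)
    (hy : MildOn S f y 0 T) (hf0 : ∀ᵐ t, t ∈ Ioc 0 T → f t = 0)
    (hC : ∀ᵐ t, t ∈ Ioc 0 T → C (y t) = 0) {t : ℝ} (ht : t ∈ Icc 0 T) : y t = D t (y 0) := by
  have h1 := hy.change_semigroup h.detector.right h.detector.left h.detector.symm.duhamel hf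
  have h2 : MildOn D (fun _ => 0) y 0 T := by
    refine h1.congr ?_ fun t _ => rfl
    filter_upwards [hf0, hC] with t h1 h2 hm
    simp [h1 hm, h2 hm]
  have h3 := h2.2 0 ⟨le_rfl, hT⟩ t ht
  simpa using h3

theorem IsLQSetting.periodic_unique (h : IsLQSetting S B C Q P R G D) {p : ℝ} (hp : 0 < p)
    (hud : MemLp ud 2 (volume.restrict (Ioc 0 p))) (hyd : ContinuousOn yd (Icc 0 p))
    (he : IsExtremalOn S B C Q yd ud p y u l) (hyp : y 0 = y p) (hlp : l 0 = l p) :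
    IsUniqueOptimalTriple p (IsPeriodicOptimal S B C Q yd ud p)
      (IsPeriodicLift S B C Q yd ud p) y u l := by
  have hS := h.closedLoop.left
  have hu : MemLp u 2 (volume.restrict (Ioc 0 p)) :=
    memLp_control hud he.back.continuousOn he.control
  have hexp : ∀ y' u', IsTrajectory S B p y' u' → y' 0 = y' p →
      cost C Q yd ud p y' u' = cost C Q yd ud p y u
        + 1 / 2 * costVariation C Q p (fun t => y' t - y t) (fun t => u' t - u t) := by
    intro y' u' ht hy'p
    obtain ⟨hu', hy'⟩ := (isTrajectory_iff hS hp.le).1 ht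
    exact he.cost_eq hS hp.le h.pos hud hyd hu' hy' (by rw [hyp, hlp, hy'p])
  have hopt : IsPeriodicOptimal S B C Q yd ud p y u := by
    refine ⟨⟨(isTrajectory_iff hS hp.le).2 ⟨hu, he.mild⟩, hyp⟩, fun y' u' ht hy'p => ?_⟩
    have h1 := costVariation_nonneg (C := C) (y := fun t => y' t - y t)
      (u := fun t => u' t - u t) hp.le h.pos
    rw [hexp y' u' ht hy'p]
    linarith
  refine ⟨⟨hopt, fun y' u' h' => ?_⟩, ⟨⟨(isExtremal_iff hS hp.le hud hyd).2 he, hyp, hlp⟩,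
    fun l' hl' => ?_⟩⟩
  · obtain ⟨hu', hy'⟩ := (isTrajectory_iff hS hp.le).1 h'.1.1
    have hle := h'.2 y u hopt.1.1 hyp
    rw [hexp y' u' h'.1.1 h'.1.2] at hle
    have hBu := intervalIntegrable_clm (MemLp.intervalIntegrable_two hp.le hu) B
    have hBu' := intervalIntegrable_clm (MemLp.intervalIntegrable_two hp.le hu') B
    have hδ := hy'.sub hS hBu' hBu he.mild
    have hz := costVariation_eq_zero hp.le h.pos hδ.1 (hu'.sub hu) (by
      change costVariation C Q p (fun t => y' t - y t) (fun t => u' t - u t) ≤ 0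
      linarith)
    have hz' := ae_Ioc_iff.1 hz
    have hδt : ∀ t ∈ Icc 0 p, y' t - y t = D t (y' 0 - y 0) := fun t ht =>
      h.eq_of_unobserved hp.le (hBu'.sub hBu) hδ (by
        filter_upwards [hz'] with t h1 hm
        have h2 : u' t - u t = 0 := (h1 hm).2
        rw [← map_sub, h2, map_zero]) (by
        filter_upwards [hz'] with t h1 hm using (h1 hm).1) ht
    -- Periodicity makes the initial difference a fixed vector of D(p), and stability leaves only
    -- zero.
    have h0 : y' 0 - y 0 = 0 := by
      refine h.stable_detector.eq_zero_of_fixed h.detector.right hp ?_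
      rw [← hδt p ⟨hp.le, le_rfl⟩, hyp, h'.1.2]
    refine ⟨fun t ht => ?_, ?_⟩
    · have := hδt t ht
      rw [h0, map_zero] at this
      exact sub_eq_zero.1 this
    · filter_upwards [hz] with t h1 using sub_eq_zero.1 h1.2
  · have he' := (isExtremal_iff hS hp.le hud hyd).1 hl'.1
    have hR := h.closedLoop.right
    have hgc : ContinuousOn (fun t => C.adjoint (C (y t)) - C.adjoint (C (yd t))) (Icc 0 p) :=
      ((C.adjoint.comp C).continuous.comp_continuousOn he.mild.1).sub
        ((C.adjoint.comp C).continuous.comp_continuousOn hyd)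
    have hgi : IntervalIntegrable (fun t => C.adjoint (C (y t)) - C.adjoint (C (yd t)))
        volume 0 p := ContinuousOn.intervalIntegrable (by rwa [uIcc_of_le hp.le])
    have hμ := he'.back.sub hS hgi hgi he.back
    -- Two adjoint states of one pair give the same control, so N(l' − l) = 0 almost everywhere. The
    -- term separating S* from R* then vanishes, and l' − l is a periodic backward orbit of the
    -- stable R.
    have h1 := hμ.change_semigroup hR hS h.closedLoop.symm.duhamel_adjoint (hgi.sub hgi)
    have h2 : BackMildOn R (fun _ => 0) (fun t => l' t - l t) 0 p := by
      refine h1.congr ?_ fun t _ => rfl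
      filter_upwards [ae_Ioc_iff.1 he.control, ae_Ioc_iff.1 he'.control] with t e1 e2 hm
      have hm' : t ∈ Ioc 0 p := ⟨hm.1, hm.2.le⟩
      have e3 : Q.symm (B.adjoint (l' t)) = Q.symm (B.adjoint (l t)) :=
        add_left_cancel ((e2 hm').symm.trans (e1 hm'))
      have e4 : gramian B Q (l' t - l t) = 0 := by
        rw [map_sub, gramian_apply, gramian_apply, e3, sub_self]
      rw [map_neg, neg_apply, adjoint_gramian_comp h.pos h.riccati.1, e4]
      simp
    have h3 : ∀ t ∈ Icc 0 p, l' t - l t = (R (p - t)).adjoint (l' p - l p) := by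
      intro t ht
      have := h2.eq ht ⟨ht.2, le_rfl⟩
      simpa using this
    have h4 : l' p - l p = 0 := by
      refine h.stable.adjoint.eq_zero_of_fixed hR.adjoint hp ?_
      have := h3 0 ⟨le_rfl, hp.le⟩
      rw [sub_zero, hlp, hl'.2.2] at this
      exact this.symm
    intro t ht
    have := h3 t ht
    rw [h4, map_zero] at this
    exact sub_eq_zero.1 this

/-- The boundary terms vanish because λ(T) = 0 and the initial state is fixed. The lift is
determined by y alone, its backward equation having terminal value 0. -/
theorem IsLQSetting.initial_unique (h : IsLQSetting S B C Q P R G D) (hT : 0 < T)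
    (hud : MemLp ud 2 (volume.restrict (Ioc 0 T))) (hyd : ContinuousOn yd (Icc 0 T)) {y₀ : X}
    (he : IsExtremalOn S B C Q yd ud T y u l) (hy0 : y 0 = y₀) (hlT : l T = 0) :
    IsUniqueOptimalTriple T (IsOptimalOn S B C Q yd ud y₀ T)
      (IsLiftOn S B C Q yd ud y₀ T) y u l := by
  have hS := h.closedLoop.left
  have hu : MemLp u 2 (volume.restrict (Ioc 0 T)) :=
    memLp_control hud he.back.continuousOn he.control
  have hexp : ∀ y' u', IsTrajectory S B T y' u' → y' 0 = y₀ →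
      cost C Q yd ud T y' u' = cost C Q yd ud T y u
        + 1 / 2 * costVariation C Q T (fun t => y' t - y t) (fun t => u' t - u t) := by
    intro y' u' ht hy'0
    obtain ⟨hu', hy'⟩ := (isTrajectory_iff hS hT.le).1 ht
    exact he.cost_eq hS hT.le h.pos hud hyd hu' hy' (by rw [hlT, hy0, hy'0]; simp)
  have hopt : IsOptimalOn S B C Q yd ud y₀ T y u := by
    refine ⟨⟨(isTrajectory_iff hS hT.le).2 ⟨hu, he.mild⟩, hy0⟩, fun y' u' ht hy'0 => ?_⟩
    have h1 := costVariation_nonneg (C := C) (y := fun t => y' t - y t)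
      (u := fun t => u' t - u t) hT.le h.pos
    rw [hexp y' u' ht hy'0]
    linarith
  refine ⟨⟨hopt, fun y' u' h' => ?_⟩, ⟨⟨(isExtremal_iff hS hT.le hud hyd).2 he, hy0, hlT⟩,
    fun l' hl' => ?_⟩⟩
  · obtain ⟨hu', hy'⟩ := (isTrajectory_iff hS hT.le).1 h'.1.1
    have hle := h'.2 y u hopt.1.1 hy0
    rw [hexp y' u' h'.1.1 h'.1.2] at hle
    have hBu := intervalIntegrable_clm (MemLp.intervalIntegrable_two hT.le hu) B
    have hBu' := intervalIntegrable_clm (MemLp.intervalIntegrable_two hT.le hu') B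
    have hδ := hy'.sub hS hBu' hBu he.mild
    have hz := costVariation_eq_zero hT.le h.pos hδ.1 (hu'.sub hu) (by
      change costVariation C Q T (fun t => y' t - y t) (fun t => u' t - u t) ≤ 0
      linarith)
    have hz' := ae_Ioc_iff.1 hz
    refine ⟨fun t ht => ?_, ?_⟩
    · have := h.eq_of_unobserved hT.le (hBu'.sub hBu) hδ (by
        filter_upwards [hz'] with t h1 hm
        have h2 : u' t - u t = 0 := (h1 hm).2
        rw [← map_sub, h2, map_zero]) (by
        filter_upwards [hz'] with t h1 hm using (h1 hm).1) ht
      simp only [h'.1.2, hy0, sub_self, map_zero] at this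
      exact sub_eq_zero.1 this
    · filter_upwards [hz] with t h1 using sub_eq_zero.1 h1.2
  · have he' := (isExtremal_iff hS hT.le hud hyd).1 hl'.1
    intro t ht
    rw [he'.back.eq ht ⟨ht.2, le_rfl⟩, he.back.eq ht ⟨ht.2, le_rfl⟩, hl'.2.2, hlT]

end Hamiltonian

/-! ### Periodic extension of mild solutions. -/

section PeriodicExtension

variable {X Z : Type*} [NormedAddCommGroup X] [InnerProductSpace ℝ X] [CompleteSpace X]
  {R : ℝ → X →L[ℝ] X} {p : ℝ}

/-- The right endpoint is included because f 0 = f p, which is what lets consecutive copies be glued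
on closed intervals. -/
theorem periodicExt_eq_sub (hp : 0 < p) (f : ℝ → Z) (hf : f 0 = f p) (n : ℕ) {t : ℝ}
    (ht : t ∈ Icc (n * p) (n * p + p)) : periodicExt p f t = f (t - n * p) := by
  rcases eq_or_lt_of_le ht.2 with h | h
  · have h1 : t / p = ((n + 1 : ℤ) : ℝ) := by
      rw [h]; push_cast; field_simp
    rw [periodicExt, h1, Int.floor_intCast]
    have h2 : t - ((n + 1 : ℤ) : ℝ) * p = 0 := by rw [h]; push_cast; ring
    have h3 : t - n * p = p := by rw [h]; ring
    rw [h2, h3, hf]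
  · have h1 : ⌊t / p⌋ = (n : ℤ) := by
      rw [Int.floor_eq_iff]
      refine ⟨?_, ?_⟩
      · rw [le_div_iff₀ hp]; exact_mod_cast ht.1
      · rw [div_lt_iff₀ hp]; push_cast; linarith
    rw [periodicExt, h1, Int.cast_natCast]

theorem periodicExt_add_period (hp : 0 < p) (f : ℝ → Z) (t : ℝ) :
    periodicExt p f (t + p) = periodicExt p f t := by
  have h1 : (t + p) / p = t / p + 1 := by field_simp
  rw [periodicExt, periodicExt, h1, Int.floor_add_one]
  congr 1
  push_cast; ring

theorem ae_periodic_sub {f : ℝ → Z} (hp : 0 < p)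
    (hf : ∀ᵐ t ∂volume.restrict (Ioi (0 : ℝ)), f (t + p) = f t) (n : ℕ) :
    ∀ᵐ t : ℝ, t ∈ Ioi (n * p) → f t = f (t - n * p) := by
  rw [ae_restrict_iff' measurableSet_Ioi] at hf
  induction n with
  | zero => exact Eventually.of_forall fun t _ => by simp
  | succ n ih =>
    have h1 : ∀ᵐ t : ℝ, t - (n + 1) * p ∈ Ioi (0 : ℝ) →
        f (t - (n + 1) * p + p) = f (t - (n + 1) * p) :=
      (measurePreserving_sub_right volume (((n : ℝ) + 1) * p)).quasiMeasurePreserving.ae hf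
    filter_upwards [ih, h1] with t h2 h3 ht
    have ht' : (n + 1) * p < t := by have := mem_Ioi.1 ht; push_cast at this; exact this
    rw [h2 (mem_Ioi.2 (by linarith))]
    have h4 := h3 (mem_Ioi.2 (by linarith))
    rw [Nat.cast_succ, ← h4]
    congr 1; ring

/-- Shifted copies of the solution are concatenated; the forcing agrees almost everywhere with its
shifts and the end values match. -/
theorem MildOn.periodicExt (hR : IsClampedSemigroup R) (hp : 0 < p) {f y : ℝ → X}
    (hfi : ∀ T, 0 ≤ T → IntervalIntegrable f volume 0 T)
    (hf : ∀ᵐ t ∂volume.restrict (Ioi (0 : ℝ)), f (t + p) = f t) (h : MildOn R f y 0 p)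
    (hy : y 0 = y p) (T : ℝ) : MildOn R f (periodicExt p y) 0 T := by
  have hn : ∀ n : ℕ, MildOn R f (PeriodicLQ.periodicExt p y) 0 (n * p) := by
    intro n
    induction n with
    | zero =>
      rw [Nat.cast_zero, zero_mul]
      refine ⟨by simp, fun s hs t ht => ?_⟩
      obtain rfl : s = 0 := le_antisymm hs.2 hs.1
      obtain rfl : t = 0 := le_antisymm ht.2 ht.1
      simp [hR.zero_apply]
    | succ n ih =>
      have h1 : MildOn R f (PeriodicLQ.periodicExt p y) (n * p) ((n + 1 : ℕ) * p) := by
        have h2 := h.shift (n * p)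
        rw [zero_add, show p + n * p = n * p + p by ring] at h2
        rw [show ((n + 1 : ℕ) : ℝ) * p = n * p + p by push_cast; ring]
        refine h2.congr ?_ fun t ht => periodicExt_eq_sub hp y hy n ht
        filter_upwards [ae_periodic_sub hp hf n] with t ht hm using ht hm.1
      refine ih.concat hR (by positivity) ?_ (hfi _ (by positivity)) h1
      push_cast; nlinarith
  obtain ⟨n, hnT⟩ := exists_nat_ge (T / p)
  exact (hn n).mono le_rfl (by rwa [div_le_iff₀ hp] at hnT)

theorem BackMildOn.periodicExt (hR : IsClampedSemigroup R) (hp : 0 < p) {g l : ℝ → X}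
    (hgi : ∀ T, 0 ≤ T → IntervalIntegrable g volume 0 T)
    (hg : ∀ᵐ t ∂volume.restrict (Ioi (0 : ℝ)), g (t + p) = g t) (h : BackMildOn R g l 0 p)
    (hl : l 0 = l p) (T : ℝ) : BackMildOn R g (periodicExt p l) 0 T := by
  have hn : ∀ n : ℕ, BackMildOn R g (PeriodicLQ.periodicExt p l) 0 (n * p) := by
    intro n
    induction n with
    | zero =>
      rw [Nat.cast_zero, zero_mul]
      refine backMildOn_of_final hR (by simp) (by simp) fun t ht => ?_
      obtain rfl : t = 0 := le_antisymm ht.2 ht.1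
      simp [hR.adjoint.zero_apply]
    | succ n ih =>
      have h1 : BackMildOn R g (PeriodicLQ.periodicExt p l) (n * p) ((n + 1 : ℕ) * p) := by
        have h2 := h.shift (n * p)
        rw [zero_add, show p + n * p = n * p + p by ring] at h2
        rw [show ((n + 1 : ℕ) : ℝ) * p = n * p + p by push_cast; ring]
        refine h2.congr ?_ fun t ht => periodicExt_eq_sub hp l hl n ht
        filter_upwards [ae_periodic_sub hp hg n] with t ht hm using ht hm.1
      refine ih.concat hR (by positivity) ?_ (hgi _ (by positivity)) h1
      push_cast; nlinarith
  obtain ⟨n, hnT⟩ := exists_nat_ge (T / p)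
  exact (hn n).mono le_rfl (by rwa [div_le_iff₀ hp] at hnT)

end PeriodicExtension

/-! ### The Lyapunov operator E and the explicit periodic trajectories. -/

section PeriodicSolution

variable {X U V : Type*}
  [NormedAddCommGroup X] [InnerProductSpace ℝ X] [CompleteSpace X]
  [NormedAddCommGroup U] [InnerProductSpace ℝ U] [CompleteSpace U]
  [NormedAddCommGroup V] [InnerProductSpace ℝ V] [CompleteSpace V]
  {S R D : ℝ → X →L[ℝ] X} {B : U →L[ℝ] X} {C : X →L[ℝ] V} {Q : U ≃L[ℝ] U} {P E : X →L[ℝ] X}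
  {G : V →L[ℝ] X} {yd : ℝ → X} {ud : ℝ → U} {T p : ℝ}

theorem exists_isLyapunovOperator (hR : IsClampedSemigroup R) (hs : IsExpStable R)
    (hQ : (Q : U →L[ℝ] U).IsPositive) :
    ∃ E : X →L[ℝ] X, IsLyapunovOperator R B Q E ∧ (-E).IsPositive ∧
      IsConjugation (fun t => (R t).adjoint) (fun t => (R t).adjoint) (-E) (gramian B Q) := by
  obtain ⟨H, hH, hc, hpos⟩ := exists_lyapunov hR.adjoint hs.adjoint (gramian B Q)
  simp only [ContinuousLinearMap.adjoint_adjoint] at hH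
  refine ⟨-H, fun x => ⟨(hH x).1, ?_⟩, ?_, ?_⟩
  · rw [neg_apply, (hH x).2]
  · rw [neg_neg]; exact hpos (gramian_isPositive B hQ)
  · rwa [neg_neg]

/-- Conjugation applied in reversed time to the adjoint semigroup: the two reversals compose to a
forward equation for R. With M = −E and N the Gramian it absorbs the coupling term Nq. -/
theorem BackMildOn.conjugate (hR : IsClampedSemigroup R) {M N : X →L[ℝ] X}
    (hC : IsConjugation (fun t => (R t).adjoint) (fun t => (R t).adjoint) M N) {g q : ℝ → X}
    {a b : ℝ} (hg : IntervalIntegrable g volume a b) (h : BackMildOn R g q a b) :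
    MildOn R (fun t => M (g t) + N (q t)) (fun t => M (q t)) a b := by
  have h1 := MildOn.conjugate hR.adjoint hR.adjoint hC (intervalIntegrable_comp_neg hg).neg h
  unfold BackMildOn at h1
  simp only [ContinuousLinearMap.adjoint_adjoint, neg_neg, Pi.neg_apply, map_neg] at h1
  refine h1.congr (Eventually.of_forall fun t _ => ?_) fun t _ => rfl
  abel

theorem inverse_one_sub_apply {L : X →L[ℝ] X} (h : IsUnit (1 - L)) (x : X) :
    L (Ring.inverse (1 - L) x) + x = Ring.inverse (1 - L) x := by
  have h1 : (1 - L) (Ring.inverse (1 - L) x) = x :=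
    congrArg (fun M : X →L[ℝ] X => M x) (Ring.mul_inverse_cancel _ h)
  have h2 : Ring.inverse (1 - L) x - L (Ring.inverse (1 - L) x) = x := h1
  nth_rw 2 [← h2]
  abel

theorem mildOn_zTraj (hR : IsClampedSemigroup R)
    (hf : IntervalIntegrable (zForcing B C P E yd ud) volume 0 p) :
    MildOn R (zForcing B C P E yd ud) (zTraj R B C P E yd ud p) 0 p :=
  (mildOn_conv hR hf (Ring.inverse (1 - R p)
    (∫ τ in (0 : ℝ)..p, R (p - τ) (zForcing B C P E yd ud τ)))).congr
      (Eventually.of_forall fun _ _ => rfl) fun t _ => by simp only [sub_zero]; rfl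

theorem zTraj_periodic (hR : IsClampedSemigroup R) (hu : IsUnit (1 - R p)) :
    zTraj R B C P E yd ud p 0 = zTraj R B C P E yd ud p p := by
  simp only [zTraj]
  rw [inverse_one_sub_apply hu, hR.zero_apply, intervalIntegral.integral_same, add_zero]

theorem backMildOn_qTraj (hR : IsClampedSemigroup R)
    (hg : IntervalIntegrable (qForcing B C P yd ud) volume 0 p) :
    BackMildOn R (fun t => -qForcing B C P yd ud t) (qTraj R B C P yd ud p) 0 p := by
  have h1 : IntervalIntegrable (fun t => qForcing B C P yd ud (p - t)) volume 0 p := by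
    have := hg.comp_sub_left p
    rw [sub_zero, sub_self] at this
    exact this.symm
  -- With time measured backward from p, q is a forward solution for the adjoint semigroup on [0,
  -- p]; the shift by −p moves it to [−p, 0], where backward solutions on [0, p] are defined.
  have h2 := (mildOn_conv hR.adjoint h1 (Ring.inverse (1 - (R p).adjoint)
      (∫ τ in (0 : ℝ)..p, (R (p - τ)).adjoint (qForcing B C P yd ud (p - τ))))).shift (-p)
  rw [zero_add, add_neg_cancel, ← neg_zero] at h2
  refine h2.congr (Eventually.of_forall fun t _ => ?_) fun t _ => ?_
  · simp only [neg_neg]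
    congr 1; ring
  · simp only [qTraj]
    rw [show t - -p - -0 = p - -t by ring, show t - -p = p - -t by ring, neg_zero]

theorem qTraj_periodic (hR : IsClampedSemigroup R) (hu : IsUnit (1 - (R p).adjoint)) :
    qTraj R B C P yd ud p 0 = qTraj R B C P yd ud p p := by
  simp only [qTraj, sub_zero, sub_self]
  rw [inverse_one_sub_apply hu, hR.adjoint.zero_apply, intervalIntegral.integral_same, add_zero]

theorem IsLQSetting.isExtremalOn (h : IsLQSetting S B C Q P R G D) (hT : 0 ≤ T)
    (hud : MemLp ud 2 (volume.restrict (Ioc 0 T))) (hyd : ContinuousOn yd (Icc 0 T))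
    {y w : ℝ → X} (hy : MildOn R (fun t => gramian B Q (w t) + B (ud t)) y 0 T)
    (hw : BackMildOn R (fun t => -qForcing B C P yd ud t) w 0 T) :
    IsExtremalOn S B C Q yd ud T y (fun t => ud t + Q.symm (B.adjoint (w t - P (y t))))
      (fun t => w t - P (y t)) := by
  have h1 := intervalIntegrable_clm (MemLp.intervalIntegrable_two hT hud) B
  have h2 : IntervalIntegrable (fun t => -C.adjoint (C (yd t))) volume 0 T :=
    (ContinuousOn.intervalIntegrable (by
      rw [uIcc_of_le hT]
      exact (C.adjoint.comp C).continuous.comp_continuousOn hyd)).neg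
  obtain ⟨h3, h4⟩ := h.hamiltonian hT h1 h2 hy
    (hw.congr (Eventually.of_forall fun t _ => by simp only [qForcing]; abel) fun _ _ => rfl)
  refine ⟨h3.congr (Eventually.of_forall fun t _ => ?_) fun _ _ => rfl,
    h4.congr (Eventually.of_forall fun t _ => sub_eq_add_neg _ _) fun _ _ => rfl,
    Eventually.of_forall fun _ => rfl⟩
  rw [map_add, ← gramian_apply, add_comm]

theorem intervalIntegrable_qForcing (hT : 0 ≤ T)
    (hud : MemLp ud 2 (volume.restrict (Ioc 0 T))) (hyd : ContinuousOn yd (Icc 0 T)) :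
    IntervalIntegrable (qForcing B C P yd ud) volume 0 T := by
  have h1 := intervalIntegrable_clm (MemLp.intervalIntegrable_two hT hud) (P.comp B)
  have h2 : IntervalIntegrable (fun t => C.adjoint (C (yd t))) volume 0 T :=
    ContinuousOn.intervalIntegrable (by
      rw [uIcc_of_le hT]
      exact (C.adjoint.comp C).continuous.comp_continuousOn hyd)
  exact h1.neg.add h2

theorem zForcing_eq (t : ℝ) :
    zForcing B C P E yd ud t = B (ud t) - E (qForcing B C P yd ud t) := by
  simp only [zForcing, qForcing, map_add, map_neg]
  abel

/-- The periodic trajectory in the coordinates that decouple the Hamiltonian system. -/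
theorem mildOn_sub_qTraj (hR : IsClampedSemigroup R) (hp : 0 ≤ p)
    (hE : IsConjugation (fun t => (R t).adjoint) (fun t => (R t).adjoint) (-E) (gramian B Q))
    (hud : MemLp ud 2 (volume.restrict (Ioc 0 p))) (hyd : ContinuousOn yd (Icc 0 p)) :
    MildOn R (fun t => gramian B Q (qTraj R B C P yd ud p t) + B (ud t))
      (fun t => zTraj R B C P E yd ud p t - E (qTraj R B C P yd ud p t)) 0 p := by
  have hq := intervalIntegrable_qForcing (B := B) (C := C) (P := P) hp hud hyd
  have hB := intervalIntegrable_clm (MemLp.intervalIntegrable_two hp hud) B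
  have hz : IntervalIntegrable (zForcing B C P E yd ud) volume 0 p :=
    (hB.sub (intervalIntegrable_clm hq E)).congr fun t _ => (zForcing_eq t).symm
  have h1 := backMildOn_qTraj hR hq
  have h2 := h1.conjugate hR hE hq.neg
  have h3 : IntervalIntegrable (qTraj R B C P yd ud p) volume 0 p :=
    ContinuousOn.intervalIntegrable (by rw [uIcc_of_le hp]; exact h1.continuousOn)
  -- The forcings add up to f + Eg + Nq = Bu_d + Nq, since f = Bu_d − Eg.
  refine ((mildOn_zTraj hR hz).add hR hz ((intervalIntegrable_clm hq.neg (-E)).add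
    (intervalIntegrable_clm h3 (gramian B Q))) h2).congr
      (Eventually.of_forall fun t _ => ?_) fun t _ => ?_
  · rw [zForcing_eq]
    simp only [neg_apply, map_neg, Pi.neg_apply]
    abel
  · simp only [neg_apply]
    abel

end PeriodicSolution

/-! ### Uniform solvability of the terminal condition on [0, T]. -/

section FiniteHorizon

variable {X U V : Type*}
  [NormedAddCommGroup X] [InnerProductSpace ℝ X] [CompleteSpace X]
  [NormedAddCommGroup U] [InnerProductSpace ℝ U] [CompleteSpace U]
  [NormedAddCommGroup V] [InnerProductSpace ℝ V] [CompleteSpace V]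
  {S R D : ℝ → X →L[ℝ] X} {B : U →L[ℝ] X} {C : X →L[ℝ] V} {Q : U ≃L[ℝ] U} {P E : X →L[ℝ] X}
  {G : V →L[ℝ] X} {yd : ℝ → X} {ud : ℝ → U} {T p : ℝ}

/-- A solution starting from `0` of an exponentially stable equation is controlled by the
energy of the forcing term. -/
theorem MildOn.norm_le_of_energy {c ν K η : ℝ} (hν : 0 < ν)
    (hb : ∀ t : ℝ, 0 ≤ t → ‖D t‖ ≤ c * Real.exp (-ν * t)) (hc : 0 < c) (hη : 0 < η) (hT : 0 ≤ T)
    {f y : ℝ → X} {φ : ℝ → ℝ} (hφ : IntervalIntegrable φ volume 0 T)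
    (hf : ∀ t ∈ Icc 0 T, ‖f t‖ ^ 2 ≤ K * φ t) (hy : MildOn D f y 0 T) (hy0 : y 0 = 0) :
    ‖y T‖ ≤ c / 2 * (η / ν + K / η * ∫ t in (0 : ℝ)..T, φ t) := by
  have h1 := hy.2 0 ⟨le_rfl, hT⟩ T ⟨hT, le_rfl⟩
  rw [hy0, map_zero, zero_add] at h1
  have hexp : IntervalIntegrable (fun s => Real.exp (-ν * (T - s))) volume 0 T :=
    Continuous.intervalIntegrable (by fun_prop) _ _
  have h2 : ‖∫ s in (0 : ℝ)..T, D (T - s) (f s)‖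
      ≤ ∫ s in (0 : ℝ)..T, (c / 2 * η * Real.exp (-ν * (T - s)) + c / 2 * (K / η) * φ s) := by
    refine intervalIntegral.norm_integral_le_of_norm_le hT
      (Eventually.of_forall fun s hs => ?_) ((hexp.const_mul _).add (hφ.const_mul _))
    have hs0 : 0 ≤ T - s := by linarith [hs.2]
    refine ((D (T - s)).le_of_opNorm_le (hb _ hs0) _).trans ?_
    set e := Real.exp (-ν * (T - s)) with he
    have he0 : 0 < e := Real.exp_pos _
    have he1 : e ≤ 1 := Real.exp_le_one_iff.2 (by nlinarith)
    have h3 := hf s ⟨hs.1.le, hs.2⟩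
    -- Young's inequality with a free weight η; since e ≤ 1, one factor e can be kept, so the first
    -- term stays integrable uniformly in T.
    have h4 : e * ‖f s‖ ≤ (η * e + ‖f s‖ ^ 2 / η) / 2 := by
      have h5 : 2 * η * (e * ‖f s‖) ≤ η ^ 2 * e + ‖f s‖ ^ 2 := by
        nlinarith [sq_nonneg (η * e - ‖f s‖), mul_nonneg (sq_nonneg η)
          (mul_nonneg he0.le (sub_nonneg.2 he1))]
      have h6 : (η * e + ‖f s‖ ^ 2 / η) / 2 = (η ^ 2 * e + ‖f s‖ ^ 2) / (2 * η) := by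
        field_simp
      rw [h6, le_div_iff₀ (by positivity)]
      linarith
    have h7 : ‖f s‖ ^ 2 / η ≤ K / η * φ s := by
      rw [div_mul_eq_mul_div]
      gcongr
    calc c * e * ‖f s‖ = c * (e * ‖f s‖) := by ring
      _ ≤ c * ((η * e + K / η * φ s) / 2) := by gcongr; linarith
      _ = _ := by ring
  rw [intervalIntegral.integral_add (hexp.const_mul _) (hφ.const_mul _),
    intervalIntegral.integral_const_mul, intervalIntegral.integral_const_mul] at h2
  have h8 := integral_exp_conv_le hν (t := T)
  rw [h1]
  refine h2.trans ?_
  calc _ ≤ c / 2 * η * (1 / ν) + c / 2 * (K / η) * ∫ t in (0 : ℝ)..T, φ t := by gcongr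
    _ = _ := by ring

/-- The operator `∫₀ᵀ R(t) B Q⁻¹ B* R(t)* dt`, expressed by the solution `E` of the
Lyapunov equation. -/
def horizonGramian (R : ℝ → X →L[ℝ] X) (E : X →L[ℝ] X) (T : ℝ) : X →L[ℝ] X :=
  -E - (R T).comp ((-E).comp (R T).adjoint)

theorem backMildOn_adjoint_orbit (hR : IsClampedSemigroup R) (T : ℝ) (ω : X) :
    BackMildOn R (fun _ => 0) (fun t => (R (T - t)).adjoint ω) 0 T := by
  refine backMildOn_of_final hR intervalIntegrable_const
    (hR.adjoint.continuous_comp (by fun_prop) continuous_const).continuousOn fun t _ => ?_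
  simp [hR.adjoint.zero_apply]

theorem mildOn_orbit (hR : IsClampedSemigroup R) (T : ℝ) (x : X) :
    MildOn R (fun _ => 0) (fun t => R t x) 0 T := by
  refine mildOn_of_initial hR intervalIntegrable_const
    (hR.continuous_comp continuous_id continuous_const).continuousOn fun t _ => ?_
  simp [hR.zero_apply]

/-- The response of the closed loop to the adjoint orbit ending at `ω`. -/
def response (R : ℝ → X →L[ℝ] X) (E : X →L[ℝ] X) (T : ℝ) (ω : X) (t : ℝ) : X :=
  (-E) ((R (T - t)).adjoint ω) - R t ((-E) ((R T).adjoint ω))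

/-- Conjugation by −E gives a particular solution for the adjoint orbit; subtracting the free orbit
from its initial value makes the response start at zero. -/
theorem mildOn_response (hR : IsClampedSemigroup R)
    (hE : IsConjugation (fun t => (R t).adjoint) (fun t => (R t).adjoint) (-E) (gramian B Q))
    (T : ℝ) (ω : X) :
    MildOn R (fun t => gramian B Q ((R (T - t)).adjoint ω)) (response R E T ω) 0 T := by
  have h1 := (backMildOn_adjoint_orbit hR T ω).conjugate hR hE intervalIntegrable_const
  have h2 : Continuous fun t => (R (T - t)).adjoint ω :=
    hR.adjoint.continuous_comp (by fun_prop) continuous_const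
  simp only [map_zero, zero_add] at h1
  have h3 : Continuous fun t => gramian B Q ((R (T - t)).adjoint ω) :=
    (gramian B Q).continuous.comp h2
  refine (h1.sub hR (h3.intervalIntegrable _ _) intervalIntegrable_const
    (mildOn_orbit hR T ((-E) ((R T).adjoint ω)))).congr
    (Eventually.of_forall fun t _ => (sub_zero _).symm) fun t _ => rfl

theorem response_zero (hR : IsClampedSemigroup R) (ω : X) : response R E T ω 0 = 0 := by
  simp [response, hR.zero_apply]

theorem response_final (hR : IsClampedSemigroup R) (ω : X) :
    response R E T ω T = horizonGramian R E T ω := by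
  simp [response, horizonGramian, hR.adjoint.zero_apply]

theorem norm_response_le {c ν : ℝ} (hb : ∀ t : ℝ, 0 ≤ t → ‖R t‖ ≤ c * Real.exp (-ν * t))
    (hc : 0 < c) (hν : 0 < ν) {t : ℝ} (ht : t ∈ Icc 0 T) (ω : X) :
    ‖response R E T ω t‖ ≤ ‖E‖ * (c + c ^ 2) * ‖ω‖ * Real.exp (-ν * (T - t)) := by
  have hadj : ∀ s : ℝ, 0 ≤ s → ‖(R s).adjoint‖ ≤ c * Real.exp (-ν * s) := fun s hs => by
    rw [LinearIsometryEquiv.norm_map]; exact hb s hs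
  have h1 : ‖(-E) ((R (T - t)).adjoint ω)‖ ≤ ‖E‖ * (c * Real.exp (-ν * (T - t)) * ‖ω‖) := by
    refine ((-E).le_opNorm _).trans ?_
    rw [norm_neg]
    gcongr
    exact ContinuousLinearMap.le_of_opNorm_le _ (hadj _ (by linarith [ht.2])) _
  have h2 : ‖R t ((-E) ((R T).adjoint ω))‖
      ≤ c * 1 * (‖E‖ * (c * Real.exp (-ν * (T - t)) * ‖ω‖)) := by
    refine (ContinuousLinearMap.le_of_opNorm_le _ (hb t ht.1) _).trans ?_
    gcongr
    · exact Real.exp_le_one_iff.2 (by nlinarith [ht.1])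
    · refine ((-E).le_opNorm _).trans ?_
      rw [norm_neg]
      gcongr
      refine (ContinuousLinearMap.le_of_opNorm_le _ (hadj T (ht.1.trans ht.2)) _).trans ?_
      gcongr _ * Real.exp ?_ * _
      nlinarith [ht.1]
  refine (norm_sub_le _ _).trans ((add_le_add h1 h2).trans (le_of_eq ?_))
  ring

/-- The terminal condition of the two-point boundary value problem is solvable, uniformly with
respect to the horizon. -/
theorem IsLQSetting.exists_norm_le (h : IsLQSetting S B C Q P R G D)
    (hE : IsConjugation (fun t => (R t).adjoint) (fun t => (R t).adjoint) (-E) (gramian B Q)) :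
    ∃ κ > 0, ∀ T : ℝ, 0 ≤ T → ∀ ω : X, ‖ω‖ ≤ κ * ‖ω - P (horizonGramian R E T ω)‖ := by
  have hS := h.closedLoop.left
  have hR := h.closedLoop.right
  have hN := gramian_isPositive B h.pos
  obtain ⟨c, hc, ν, hν, hb⟩ := h.stable_detector
  set N := gramian B Q with hNdef
  set K : ℝ := 2 * (‖N‖ + ‖G‖ ^ 2) with hK
  have hK0 : 0 ≤ K := by positivity
  refine ⟨1 + ‖P‖ * (c ^ 2 * K / ν), by positivity, fun T hT ω => ?_⟩
  set μ := ω - P (horizonGramian R E T ω) with hμ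
  set y := response R E T ω with hy
  set l : ℝ → X := fun t => (R (T - t)).adjoint ω - P (y t) with hl
  have hyR := mildOn_response hR hE T ω
  have hwR := backMildOn_adjoint_orbit hR T ω
  -- The pair (y, l) solves the Hamiltonian system with zero data, y(0) = 0 and l(T) = μ. Bounding
  -- y(T) by μ bounds ω = μ + Py(T).
  obtain ⟨h1, h2⟩ := h.hamiltonian (h₁ := fun _ => 0) (h₂ := fun _ => 0) hT
    intervalIntegrable_const intervalIntegrable_const
    (hyR.congr (Eventually.of_forall fun t _ => add_zero _) fun _ _ => rfl)
    (hwR.congr (Eventually.of_forall fun t _ => by simp) fun _ _ => rfl)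
  have hlc : ContinuousOn l (Icc 0 T) := h2.continuousOn
  have hyc : ContinuousOn y (Icc 0 T) := h1.1
  have hNl : IntervalIntegrable (fun t => N (l t) + 0) volume 0 T := by
    refine ContinuousOn.intervalIntegrable ?_
    rw [uIcc_of_le hT]
    exact (N.continuous.comp_continuousOn hlc).add continuousOn_const
  have hg : ContinuousOn (fun t => C.adjoint (C (y t)) + 0) (Icc 0 T) :=
    ((C.adjoint.comp C).continuous.comp_continuousOn hyc).add continuousOn_const
  have hdual := h2.inner_sub_inner hS hT hNl hg h1
  have hyT : y T = horizonGramian R E T ω := response_final hR ω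
  have hy0 : y 0 = 0 := response_zero hR ω
  have hlT : l T = μ := by
    simp only [hl, hμ]
    rw [sub_self, hR.adjoint.zero_apply, hyT]
  change ⟪l T, y T⟫ - ⟪l 0, y 0⟫ = ∫ t in (0 : ℝ)..T,
    (⟪l t, N (l t) + 0⟫ + ⟪C.adjoint (C (y t)) + 0, y t⟫) at hdual
  set φ : ℝ → ℝ := fun t => ⟪l t, N (l t) + 0⟫ + ⟪C.adjoint (C (y t)) + 0, y t⟫ with hφ
  have hφi : IntervalIntegrable φ volume 0 T := by
    refine ContinuousOn.intervalIntegrable ?_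
    rw [uIcc_of_le hT]
    exact (hlc.inner ((N.continuous.comp_continuousOn hlc).add continuousOn_const)).add
      (hg.inner hyc)
  -- Viewed through the detector semigroup, y is driven by Nl − GCy, whose squared norm is at most K
  -- times the energy density φ. Duality bounds the total energy by ‖μ‖‖y(T)‖, independently of T.
  have hyD := h1.change_semigroup h.detector.right h.detector.left h.detector.symm.duhamel hNl
  have hfb : ∀ t ∈ Icc 0 T, ‖N (l t) + 0 + (-(G.comp C)) (y t)‖ ^ 2 ≤ K * φ t := by
    intro t _
    have e1 : φ t = ⟪N (l t), l t⟫ + ‖C (y t)‖ ^ 2 := by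
      simp only [hφ, add_zero]
      rw [ContinuousLinearMap.adjoint_inner_left, real_inner_self_eq_norm_sq, real_inner_comm]
    have e2 : ‖N (l t)‖ ^ 2 ≤ ‖N‖ * ⟪N (l t), l t⟫ := IsPositive.norm_sq_le hN _
    have e3 : ‖G (C (y t))‖ ^ 2 ≤ ‖G‖ ^ 2 * ‖C (y t)‖ ^ 2 := by
      rw [← mul_pow]
      gcongr
      exact G.le_opNorm _
    have e4 : ‖N (l t) + 0 + (-(G.comp C)) (y t)‖ ≤ ‖N (l t)‖ + ‖G (C (y t))‖ := by
      rw [add_zero]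
      refine (norm_add_le _ _).trans_eq ?_
      rw [neg_apply, norm_neg]; rfl
    have e5 : 0 ≤ ⟪N (l t), l t⟫ := hN.inner_nonneg_left _
    calc ‖N (l t) + 0 + (-(G.comp C)) (y t)‖ ^ 2
        ≤ (‖N (l t)‖ + ‖G (C (y t))‖) ^ 2 := by gcongr
      _ ≤ 2 * (‖N (l t)‖ ^ 2 + ‖G (C (y t))‖ ^ 2) := by
          nlinarith [sq_nonneg (‖N (l t)‖ - ‖G (C (y t))‖)]
      _ ≤ 2 * (‖N‖ * ⟪N (l t), l t⟫ + ‖G‖ ^ 2 * ‖C (y t)‖ ^ 2) := by gcongr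
      _ ≤ K * φ t := by
          rw [e1, hK]
          nlinarith [mul_nonneg (norm_nonneg N) (sq_nonneg ‖C (y t)‖),
            mul_nonneg (sq_nonneg ‖G‖) e5]
  have hI : ∫ t in (0 : ℝ)..T, φ t ≤ ‖μ‖ * ‖y T‖ := by
    rw [← hdual, hy0, inner_zero_right, sub_zero, hlT]
    exact real_inner_le_norm _ _
  have hm : ∀ ε > 0, ‖y T‖ ≤ c ^ 2 * K / ν * ‖μ‖ + ε := by
    intro ε hε
    -- The first summand makes the energy term at most ‖y(T)‖/2, to be absorbed on the left; the
    -- second keeps η positive when μ = 0 and contributes exactly ε.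
    set η := c * K * ‖μ‖ + ε * ν / c with hηdef
    have hη : 0 < η := by positivity
    have h3 := hyD.norm_le_of_energy hν hb hc hη hT hφi hfb hy0
    have h4 : c / 2 * (K / η * (‖μ‖ * ‖y T‖)) ≤ ‖y T‖ / 2 := by
      have : c * K * ‖μ‖ / η ≤ 1 := by
        rw [div_le_one hη, hηdef]
        have : 0 < ε * ν / c := by positivity
        linarith
      calc c / 2 * (K / η * (‖μ‖ * ‖y T‖)) = (c * K * ‖μ‖ / η) * (‖y T‖ / 2) := by ring
        _ ≤ 1 * (‖y T‖ / 2) := by gcongr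
        _ = _ := one_mul _
    have h5 : c / 2 * (η / ν + K / η * ∫ t in (0 : ℝ)..T, φ t)
        ≤ c / 2 * (η / ν) + c / 2 * (K / η * (‖μ‖ * ‖y T‖)) := by
      rw [mul_add]; gcongr
    have h6 : c * (η / ν) = c ^ 2 * K / ν * ‖μ‖ + ε := by
      rw [hηdef]; field_simp
    linarith
  have hm' : ‖y T‖ ≤ c ^ 2 * K / ν * ‖μ‖ := le_of_forall_pos_le_add hm
  have hω : ω = μ + P (y T) := by rw [hμ, hyT]; abel
  calc ‖ω‖ = ‖μ + P (y T)‖ := by rw [← hω]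
    _ ≤ ‖μ‖ + ‖P‖ * ‖y T‖ := (norm_add_le _ _).trans (by gcongr; exact P.le_opNorm _)
    _ ≤ ‖μ‖ + ‖P‖ * (c ^ 2 * K / ν * ‖μ‖) := by gcongr
    _ = _ := by ring

/-- The lower bound makes the range of I − MN closed. Its adjoint is I − NM by self-adjointness; if
v = NMv, then Mv is killed by I − MN, so Mv = 0 and v = 0, and the range is dense. -/
theorem surjective_one_sub {M N : X →L[ℝ] X} (hM : IsSelfAdjoint M) (hN : IsSelfAdjoint N)
    {κ : ℝ} (hκ : 0 < κ) (h : ∀ x, ‖x‖ ≤ κ * ‖x - M (N x)‖) :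
    Function.Surjective fun x => x - M (N x) := by
  set L : X →L[ℝ] X := 1 - M.comp N with hL
  have hLx : ∀ x, L x = x - M (N x) := fun x => rfl
  have hanti : AntilipschitzWith ⟨κ, hκ.le⟩ L :=
    L.antilipschitz_of_bound fun x => h x
  have hclosed : IsClosed (L.range : Set X) := hanti.isClosed_range L.uniformContinuous
  have hker : L.adjoint.ker = ⊥ := by
    refine (Submodule.eq_bot_iff _).2 fun v hv => ?_
    have h1 : v - N (M v) = 0 := by
      have h2 : L.adjoint v = 0 := hv
      rw [hL, map_sub, ContinuousLinearMap.adjoint_comp, hM.adjoint_eq, hN.adjoint_eq] at h2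
      have h3 : (1 : X →L[ℝ] X).adjoint = 1 := ContinuousLinearMap.adjoint_id
      rw [h3] at h2
      exact h2
    have h2 : M v = 0 := by
      have h3 := h (M v)
      rw [← map_sub, h1, map_zero, norm_zero, mul_zero] at h3
      exact norm_le_zero_iff.1 h3
    rw [h2, map_zero, sub_zero] at h1
    exact h1
  have htop : L.range = ⊤ := by
    have h1 := ContinuousLinearMap.orthogonal_range L
    rw [hker] at h1
    have h2 := Submodule.topologicalClosure_eq_top_iff.2 h1
    rwa [IsClosed.submodule_topologicalClosure_eq hclosed] at h2
  exact LinearMap.range_eq_top.1 htop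

end FiniteHorizon

/-! ### The finite-horizon extremal near a reference solution of the Hamiltonian system. -/

section Turnpike

variable {X U V : Type*}
  [NormedAddCommGroup X] [InnerProductSpace ℝ X] [CompleteSpace X]
  [NormedAddCommGroup U] [InnerProductSpace ℝ U] [CompleteSpace U]
  [NormedAddCommGroup V] [InnerProductSpace ℝ V] [CompleteSpace V]
  {S R D : ℝ → X →L[ℝ] X} {B : U →L[ℝ] X} {C : X →L[ℝ] V} {Q : U ≃L[ℝ] U} {P E : X →L[ℝ] X}
  {G : V →L[ℝ] X} {yd : ℝ → X} {ud : ℝ → U} {p : ℝ}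

theorem isSelfAdjoint_horizonGramian (hE : (-E).IsPositive) (T : ℝ) :
    IsSelfAdjoint (horizonGramian R E T) := by
  refine hE.isSelfAdjoint.sub ?_
  rw [ContinuousLinearMap.isSelfAdjoint_iff', ContinuousLinearMap.adjoint_comp,
    ContinuousLinearMap.adjoint_comp, ContinuousLinearMap.adjoint_adjoint,
    hE.isSelfAdjoint.adjoint_eq]
  rfl

/-- The finite horizon problem has an extremal which stays close to a given bounded solution of
the Hamiltonian system, except near the endpoints of the time interval. -/
theorem IsLQSetting.exists_turnpike (h : IsLQSetting S B C Q P R G D)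
    (hEpos : (-E).IsPositive)
    (hE : IsConjugation (fun t => (R t).adjoint) (fun t => (R t).adjoint) (-E) (gramian B Q))
    (hyd : ContinuousOn yd (Ici 0))
    (hud : ∀ T : ℝ, 0 < T → MemLp ud 2 (volume.restrict (Ioc 0 T))) {Y W : ℝ → X}
    (hY : ∀ T, 0 < T → MildOn R (fun t => gramian B Q (W t) + B (ud t)) Y 0 T)
    (hW : ∀ T, 0 < T → BackMildOn R (fun t => -qForcing B C P yd ud t) W 0 T) {M : ℝ}
    (hM : ∀ t, ‖W t - P (Y t)‖ ≤ M) (y₀ : X) :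
    ∃ c > 0, ∃ ν > 0, ∀ T : ℝ, 0 < T → ∃ (y : ℝ → X) (u : ℝ → U) (l : ℝ → X),
      IsUniqueOptimalTriple T (IsOptimalOn S B C Q yd ud y₀ T) (IsLiftOn S B C Q yd ud y₀ T)
        y u l ∧
      ∀ t ∈ Icc 0 T, ‖y t - Y t‖ + ‖u t - (ud t + Q.symm (B.adjoint (W t - P (Y t))))‖
          + ‖l t - (W t - P (Y t))‖
        ≤ c * (Real.exp (-ν * t) + Real.exp (-ν * (T - t))) := by
  have hR := h.closedLoop.right
  obtain ⟨κ, hκ, hinv⟩ := h.exists_norm_le hE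
  obtain ⟨c, hc, ν, hν, hb⟩ := h.stable
  set x := y₀ - Y 0 with hx
  set F : X →L[ℝ] U := (Q.symm : U →L[ℝ] U).comp B.adjoint with hF
  have hM0 : 0 ≤ M := (norm_nonneg _).trans (hM 0)
  -- A bound for the terminal parameter ω that is independent of T, because the reference adjoint
  -- state is bounded by M and κ is uniform.
  set Ω := κ * (M + ‖P‖ * (c * ‖x‖)) with hΩ
  set a := c * ‖x‖ + ‖E‖ * (c + c ^ 2) * Ω with ha
  set b := c * Ω with hbdef
  have hΩ0 : 0 ≤ Ω := by positivity
  refine ⟨a + (‖F‖ + 1) * (b + ‖P‖ * a) + 1, by positivity, ν, hν, fun T hT => ?_⟩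
  -- This is the condition λ(T) = 0 for W + dw − P(Y + dy), where dw(T) = ω and dy(T) = R(T)x plus
  -- the horizon Gramian applied to ω.
  obtain ⟨ω, hω⟩ := surjective_one_sub h.riccati.1.isSelfAdjoint
    (isSelfAdjoint_horizonGramian hEpos T) hκ (hinv T hT.le) (-(W T - P (Y T)) + P (R T x))
  have hω' : ω - P (horizonGramian R E T ω) = -(W T - P (Y T)) + P (R T x) := hω
  have hexp1 : ∀ t : ℝ, 0 ≤ t → Real.exp (-ν * t) ≤ 1 := fun t ht =>
    Real.exp_le_one_iff.2 (by nlinarith)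
  have hωn : ‖ω‖ ≤ Ω := by
    refine (hinv T hT.le ω).trans ?_
    rw [hω', hΩ]
    gcongr
    refine (norm_add_le _ _).trans (add_le_add (by rw [norm_neg]; exact hM T) ?_)
    refine (P.le_opNorm _).trans ?_
    gcongr
    refine (ContinuousLinearMap.le_of_opNorm_le _ (hb T hT.le) _).trans ?_
    gcongr
    exact mul_le_of_le_one_right hc.le (hexp1 T hT.le)
  set dy : ℝ → X := fun t => R t x + response R E T ω t with hdy
  set dw : ℝ → X := fun t => (R (T - t)).adjoint ω with hdw
  have hdwc : Continuous dw := hR.adjoint.continuous_comp (by fun_prop) continuous_const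
  have hi1 : IntervalIntegrable (fun t => gramian B Q (dw t)) volume 0 T :=
    ((gramian B Q).continuous.comp hdwc).intervalIntegrable _ _
  have hi2 : IntervalIntegrable (fun t => gramian B Q (W t) + B (ud t)) volume 0 T := by
    refine IntervalIntegrable.add ?_
      (intervalIntegrable_clm (MemLp.intervalIntegrable_two hT.le (hud T hT)) B)
    refine intervalIntegrable_clm (ContinuousOn.intervalIntegrable ?_) _
    rw [uIcc_of_le hT.le]
    exact (hW T hT).continuousOn
  have hydT : ContinuousOn yd (Icc 0 T) := hyd.mono Icc_subset_Ici_self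
  have hdym : MildOn R (fun t => 0 + gramian B Q (dw t)) dy 0 T :=
    (mildOn_orbit hR T x).add hR intervalIntegrable_const hi1 (mildOn_response hR hE T ω)
  have hym : MildOn R (fun t => gramian B Q (W t + dw t) + B (ud t)) (fun t => Y t + dy t) 0 T := by
    refine ((hY T hT).add hR hi2 (intervalIntegrable_const.add hi1) hdym).congr
      (Eventually.of_forall fun t _ => ?_) fun _ _ => rfl
    rw [map_add]
    change _ = _ + (0 + gramian B Q (dw t))
    abel
  have hwm : BackMildOn R (fun t => -qForcing B C P yd ud t) (fun t => W t + dw t) 0 T :=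
    ((hW T hT).add hR (intervalIntegrable_qForcing hT.le (hud T hT) hydT).neg
      intervalIntegrable_const (backMildOn_adjoint_orbit hR T ω)).congr
      (Eventually.of_forall fun t _ => (add_zero _).symm) fun _ _ => rfl
  have hext := h.isExtremalOn hT.le (hud T hT) hydT hym hwm
  have hl : W T + dw T - P (Y T + dy T) = 0 := by
    simp only [hdw, hdy]
    rw [sub_self, hR.adjoint.zero_apply, response_final hR, map_add, map_add]
    have h1 : ω = P (horizonGramian R E T ω) + (-(W T - P (Y T)) + P (R T x)) := by
      rw [← hω']; abel
    nth_rw 1 [h1]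
    abel
  refine ⟨_, _, _, h.initial_unique hT (hud T hT) hydT hext ?_ hl, fun t ht => ?_⟩
  · simp only [hdy]
    rw [hR.zero_apply, response_zero hR, hx]
    abel
  set e := Real.exp (-ν * t) + Real.exp (-ν * (T - t)) with he
  have he1 : Real.exp (-ν * t) ≤ e := le_add_of_nonneg_right (Real.exp_pos _).le
  have he2 : Real.exp (-ν * (T - t)) ≤ e := le_add_of_nonneg_left (Real.exp_pos _).le
  have he0 : 0 ≤ e := by positivity
  -- The free orbit decays from time 0, the response from time T.
  have hyn : ‖dy t‖ ≤ a * e := by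
    refine (norm_add_le _ _).trans ?_
    rw [ha, add_mul]
    refine add_le_add ?_ ?_
    · refine (ContinuousLinearMap.le_of_opNorm_le _ (hb t ht.1) _).trans ?_
      rw [mul_right_comm]
      gcongr
    · refine (norm_response_le hb hc hν ht ω).trans ?_
      gcongr
  have hwn : ‖dw t‖ ≤ b * e := by
    have h1 : ‖(R (T - t)).adjoint‖ ≤ c * Real.exp (-ν * (T - t)) := by
      rw [LinearIsometryEquiv.norm_map]
      exact hb _ (by linarith [ht.2])
    refine (ContinuousLinearMap.le_of_opNorm_le _ h1 _).trans ?_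
    rw [hbdef, mul_right_comm]
    gcongr
  have hln : ‖dw t - P (dy t)‖ ≤ (b + ‖P‖ * a) * e := by
    refine (norm_sub_le _ _).trans ?_
    rw [add_mul, mul_assoc ‖P‖]
    refine add_le_add hwn ((P.le_opNorm _).trans ?_)
    gcongr
  have e1 : W t + dw t - P (Y t + dy t) - (W t - P (Y t)) = dw t - P (dy t) := by
    rw [map_add]; abel
  have e2 : ud t + Q.symm (B.adjoint (W t + dw t - P (Y t + dy t)))
      - (ud t + Q.symm (B.adjoint (W t - P (Y t)))) = F (dw t - P (dy t)) := by
    rw [add_sub_add_left_eq_sub, ← map_sub, ← map_sub, e1]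
    rfl
  rw [e1, e2, add_sub_cancel_left]
  have h3 : ‖F (dw t - P (dy t))‖ ≤ ‖F‖ * ((b + ‖P‖ * a) * e) :=
    (F.le_opNorm _).trans (by gcongr)
  nlinarith

end Turnpike

/-! ### Values of the semigroup at negative times do not affect the problems. -/

section Clamp

variable {X U V : Type*}
  [NormedAddCommGroup X] [InnerProductSpace ℝ X] [CompleteSpace X]
  [NormedAddCommGroup U] [InnerProductSpace ℝ U] [CompleteSpace U]
  [NormedAddCommGroup V] [InnerProductSpace ℝ V] [CompleteSpace V]

theorem isMildSolution_clampSemigroup (S : ℝ → X →L[ℝ] X) :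
    IsMildSolution (clampSemigroup S) = IsMildSolution S := by
  funext T f y
  refine propext (and_congr_right fun _ => forall₂_congr fun t ht => ?_)
  have h1 : ∫ s in (0 : ℝ)..t, clampSemigroup S (t - s) (f s)
      = ∫ s in (0 : ℝ)..t, S (t - s) (f s) := by
    refine intervalIntegral.integral_congr fun s hs => ?_
    rw [uIcc_of_le ht.1] at hs
    simp only [clampSemigroup_of_nonneg S (sub_nonneg.2 hs.2)]
  rw [h1, clampSemigroup_of_nonneg S ht.1]

theorem isBackwardMildSolution_clampSemigroup (S : ℝ → X →L[ℝ] X) :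
    IsBackwardMildSolution (clampSemigroup S) = IsBackwardMildSolution S := by
  funext T g l
  refine propext (and_congr_right fun _ => forall₂_congr fun t ht => ?_)
  have h1 : ∫ s in t..T, (clampSemigroup S (s - t)).adjoint (g s)
      = ∫ s in t..T, (S (s - t)).adjoint (g s) := by
    refine intervalIntegral.integral_congr fun s hs => ?_
    rw [uIcc_of_le ht.2] at hs
    simp only [clampSemigroup_of_nonneg S (sub_nonneg.2 hs.1)]
  rw [h1, clampSemigroup_of_nonneg S (sub_nonneg.2 ht.2)]

variable (S : ℝ → X →L[ℝ] X) (B : U →L[ℝ] X) (C : X →L[ℝ] V) (Q : U ≃L[ℝ] U)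

theorem isPeriodicOptimal_clampSemigroup :
    IsPeriodicOptimal (clampSemigroup S) B C Q = IsPeriodicOptimal S B C Q := by
  funext yd ud p y u
  simp only [IsPeriodicOptimal, IsTrajectory, isMildSolution_clampSemigroup]

theorem isPeriodicLift_clampSemigroup :
    IsPeriodicLift (clampSemigroup S) B C Q = IsPeriodicLift S B C Q := by
  funext yd ud p y u l
  simp only [IsPeriodicLift, IsExtremal, isMildSolution_clampSemigroup,
    isBackwardMildSolution_clampSemigroup]

theorem isOptimalOn_clampSemigroup :
    IsOptimalOn (clampSemigroup S) B C Q = IsOptimalOn S B C Q := by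
  funext yd ud y₀ T y u
  simp only [IsOptimalOn, IsTrajectory, isMildSolution_clampSemigroup]

theorem isLiftOn_clampSemigroup :
    IsLiftOn (clampSemigroup S) B C Q = IsLiftOn S B C Q := by
  funext yd ud y₀ T y u l
  simp only [IsLiftOn, IsExtremal, isMildSolution_clampSemigroup,
    isBackwardMildSolution_clampSemigroup]

variable {S B C Q}

theorem isRiccatiSolution_iff {A : X →ₗ.[ℝ] X} (hA : Generates A S) {P : X →L[ℝ] X} :
    IsRiccatiSolution A B C Q P ↔ SolvesRiccati S B C Q P := by
  refine and_congr_right fun _ => ⟨fun h x y hxy => ?_, fun h x => h _ _ (hA.hasGenerator x)⟩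
  obtain ⟨z, rfl, rfl⟩ := hA.exists_domain hxy
  exact h z

end Clamp

/-! ### Values of periodic extensions, and almost everywhere periodic functions. -/

section PeriodicValues

variable {Z : Type*} {p : ℝ}

theorem exists_periodicExt_eq (hp : 0 < p) (f : ℝ → Z) (t : ℝ) :
    ∃ s ∈ Icc 0 p, periodicExt p f t = f s := by
  refine ⟨t - ⌊t / p⌋ * p, ⟨?_, ?_⟩, rfl⟩
  · have := (le_div_iff₀ hp).1 (Int.floor_le (t / p))
    linarith
  · have := (div_lt_iff₀ hp).1 (Int.lt_floor_add_one (t / p))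
    linarith

/-- The exceptional sets for the countably many shifts, and the multiples of p, are null, so one
full-measure set serves every period. The target control u_d, periodic only almost everywhere, needs
this. -/
theorem ae_periodicExt_eq (hp : 0 < p) {f : ℝ → Z}
    (hf : ∀ᵐ t ∂volume.restrict (Ioi (0 : ℝ)), f (t + p) = f t) :
    ∀ᵐ t : ℝ, 0 ≤ t → periodicExt p f t = f t := by
  have h1 := ae_all_iff.2 fun n : ℕ => ae_periodic_sub hp hf n
  have h2 : ∀ᵐ t : ℝ, ∀ n : ℕ, t ≠ n * p :=
    ae_all_iff.2 fun n => by simp [ae_iff, measure_singleton]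
  filter_upwards [h1, h2] with t h3 h4 ht
  have h5 : ((⌊t / p⌋ : ℤ) : ℝ) = (⌊t / p⌋₊ : ℝ) := (natCast_floor_eq_intCast_floor (by positivity)).symm
  have h6 : (⌊t / p⌋₊ : ℝ) * p ≤ t := (le_div_iff₀ hp).1 (Nat.floor_le (by positivity))
  rw [periodicExt, h5]
  exact (h3 _ (lt_of_le_of_ne h6 (h4 _).symm)).symm

end PeriodicValues

/-! ### The Riccati operator, closed loop and detector produced by the hypotheses. -/

section Setting

variable {X U V : Type*}
  [NormedAddCommGroup X] [InnerProductSpace ℝ X] [CompleteSpace X]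
  [NormedAddCommGroup U] [InnerProductSpace ℝ U] [CompleteSpace U]
  [NormedAddCommGroup V] [InnerProductSpace ℝ V] [CompleteSpace V]
  {A : X →ₗ.[ℝ] X} {S : ℝ → X →L[ℝ] X} {B : U →L[ℝ] X} {C : X →L[ℝ] V} {Q : U ≃L[ℝ] U}

theorem exists_isLQSetting (hA : Generates A S) (hS : IsClampedSemigroup S)
    (hQ : (Q : U →L[ℝ] U).IsPositive) (hstab : IsExpStabilizable A B)
    (hdet : IsExpDetectable A C) :
    ∃ (P : X →L[ℝ] X) (R : ℝ → X →L[ℝ] X) (G : V →L[ℝ] X) (D : ℝ → X →L[ℝ] X),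
      IsLQSetting S B C Q P R G D ∧ ∀ P', SolvesRiccati S B C Q P' → P' = P := by
  obtain ⟨G, D, hD, hDs⟩ := hdet.exists_perturbation hA hS
  obtain ⟨H, hH⟩ := exists_isDetectionFunctional hD hDs
  obtain ⟨K, R₀, hR₀, hs₀⟩ := hstab
  have hK : IsStabilizing S B K :=
    ⟨clampSemigroup R₀, hA.isPerturbation hS hR₀.1.isClampedSemigroup hR₀.clampSemigroup,
      hs₀.clampSemigroup⟩
  obtain ⟨P, hP⟩ := exists_solvesRiccati (C := C) hS hQ hH hK
  obtain ⟨R, hR, hRs⟩ := hP.isStabilizing hS hQ hH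
  rw [comp_feedback] at hR
  exact ⟨P, R, G, D, ⟨hQ, hP, hR, hRs, hD, hDs⟩, fun P' hP' => hP.unique hS hQ hH hP'⟩

end Setting

end PeriodicLQ

end

/-! ### Assembly of the three conclusions. -/

theorem theorem2p2 {X U V : Type*}
    [NormedAddCommGroup X] [InnerProductSpace ℝ X] [CompleteSpace X]
    [NormedAddCommGroup U] [InnerProductSpace ℝ U] [CompleteSpace U]
    [NormedAddCommGroup V] [InnerProductSpace ℝ V] [CompleteSpace V]
    (A : X →ₗ.[ℝ] X) (S : ℝ → X →L[ℝ] X) (hA : PeriodicLQ.Generates A S)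
    (B : U →L[ℝ] X) (C : X →L[ℝ] V)
    (Q : U ≃L[ℝ] U) (hQ : (Q : U →L[ℝ] U).IsPositive)
    (p : ℝ) (hp : 0 < p)
    (yd : ℝ → X) (hyd : ContinuousOn yd (Ici 0))
    (hyd_per : ∀ᵐ t ∂volume.restrict (Ioi (0 : ℝ)), yd (t + p) = yd t)
    (ud : ℝ → U) (hud : ∀ T : ℝ, 0 < T → MemLp ud 2 (volume.restrict (Ioc 0 T)))
    (hud_per : ∀ᵐ t ∂volume.restrict (Ioi (0 : ℝ)), ud (t + p) = ud t)
    (hstab : PeriodicLQ.IsExpStabilizable A B)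
    (hdet : PeriodicLQ.IsExpDetectable A C) :
    ∃ (yP : ℝ → X) (uP : ℝ → U) (lP : ℝ → X),
      PeriodicLQ.IsUniqueOptimalTriple p
        (PeriodicLQ.IsPeriodicOptimal S B C Q yd ud p)
        (PeriodicLQ.IsPeriodicLift S B C Q yd ud p) yP uP lP ∧
      (∃ (P : X →L[ℝ] X) (SP : ℝ → X →L[ℝ] X) (E : X →L[ℝ] X),
        (PeriodicLQ.IsRiccatiSolution A B C Q P ∧
          ∀ P' : X →L[ℝ] X, PeriodicLQ.IsRiccatiSolution A B C Q P' → P' = P) ∧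
        PeriodicLQ.Generates
          (PeriodicLQ.addBounded A (-((PeriodicLQ.gramian B Q).comp P))) SP ∧
        PeriodicLQ.IsExpStable SP ∧
        PeriodicLQ.IsLyapunovOperator SP B Q E ∧
        IsUnit (1 - SP p) ∧ IsUnit (1 - (SP p).adjoint) ∧
        (∀ t ∈ Icc 0 p,
          yP t = PeriodicLQ.zTraj SP B C P E yd ud p t
            - E (PeriodicLQ.qTraj SP B C P yd ud p t) ∧
          lP t = -P (PeriodicLQ.zTraj SP B C P E yd ud p t)
            + (PeriodicLQ.qTraj SP B C P yd ud p t
              + P (E (PeriodicLQ.qTraj SP B C P yd ud p t)))) ∧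
        (∀ᵐ t ∂volume.restrict (Icc 0 p), uP t = ud t + Q.symm (B.adjoint (lP t)))) ∧
      ∀ y0 : X, ∃ c > 0, ∃ ν > 0, ∀ T : ℝ, 0 < T →
        ∃ (yT : ℝ → X) (uT : ℝ → U) (lT : ℝ → X),
          PeriodicLQ.IsUniqueOptimalTriple T
            (PeriodicLQ.IsOptimalOn S B C Q yd ud y0 T)
            (PeriodicLQ.IsLiftOn S B C Q yd ud y0 T) yT uT lT ∧
          ∀ᵐ t ∂volume.restrict (Icc 0 T),
            ‖yT t - PeriodicLQ.periodicExt p yP t‖ + ‖uT t - PeriodicLQ.periodicExt p uP t‖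
                + ‖lT t - PeriodicLQ.periodicExt p lP t‖
              ≤ c * (Real.exp (-ν * t) + Real.exp (-ν * (T - t))) := by
  have hA' := hA.clampSemigroup
  have hS := hA.1.isClampedSemigroup
  obtain ⟨P, R, G, D, h, huniq⟩ := PeriodicLQ.exists_isLQSetting hA' hS hQ hstab hdet
  have hR := h.closedLoop.right
  obtain ⟨E, hEl, hEpos, hE⟩ := PeriodicLQ.exists_isLyapunovOperator (B := B) hR h.stable hQ
  have hu1 := h.stable.isUnit_one_sub hR hp
  have hu2 : IsUnit (1 - (R p).adjoint) := h.stable.adjoint.isUnit_one_sub hR.adjoint hp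
  have hydT : ∀ T, ContinuousOn yd (Icc 0 T) := fun T => hyd.mono Icc_subset_Ici_self
  set q := PeriodicLQ.qTraj R B C P yd ud p with hq
  -- Inverting z = y + Eq; the adjoint state is then q − Py = −Pz + (I + PE)q.
  set y : ℝ → X := fun t => PeriodicLQ.zTraj R B C P E yd ud p t - E (q t) with hy
  have hqm : PeriodicLQ.BackMildOn R (fun t => -PeriodicLQ.qForcing B C P yd ud t) q 0 p :=
    PeriodicLQ.backMildOn_qTraj hR
      (PeriodicLQ.intervalIntegrable_qForcing hp.le (hud p hp) (hydT p))
  have hym : PeriodicLQ.MildOn R (fun t => PeriodicLQ.gramian B Q (q t) + B (ud t)) y 0 p :=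
    PeriodicLQ.mildOn_sub_qTraj hR hp.le hE (hud p hp) (hydT p)
  have hq0 : q 0 = q p := PeriodicLQ.qTraj_periodic hR hu2
  have hy0 : y 0 = y p := by
    simp only [hy, PeriodicLQ.zTraj_periodic hR hu1, hq0]
  have hext := h.isExtremalOn hp.le (hud p hp) (hydT p) hym hqm
  have huP := h.periodic_unique hp (hud p hp) (hydT p) hext hy0 (by simp only [hq0, hy0])
  rw [PeriodicLQ.isPeriodicOptimal_clampSemigroup, PeriodicLQ.isPeriodicLift_clampSemigroup]
    at huP
  refine ⟨y, fun t => ud t + Q.symm (B.adjoint (q t - P (y t))), fun t => q t - P (y t), huP,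
    ⟨P, R, E, ⟨(PeriodicLQ.isRiccatiSolution_iff hA').2 h.riccati, fun P' hP' =>
      huniq P' ((PeriodicLQ.isRiccatiSolution_iff hA').1 hP')⟩,
      h.closedLoop.generates hA', h.stable, hEl, hu1, hu2, fun t _ => ⟨rfl, ?_⟩,
      Filter.Eventually.of_forall fun _ => rfl⟩, fun y₀ => ?_⟩
  · simp only [hy, map_sub]
    abel
  have hgi : ∀ T, 0 ≤ T → IntervalIntegrable (fun t => -PeriodicLQ.qForcing B C P yd ud t)
      volume 0 T := fun T hT => by
    rcases hT.eq_or_lt with rfl | hT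
    · simp
    · exact (PeriodicLQ.intervalIntegrable_qForcing hT.le (hud T hT) (hydT T)).neg
  have hgper : ∀ᵐ t ∂volume.restrict (Ioi (0 : ℝ)),
      -PeriodicLQ.qForcing B C P yd ud (t + p) = -PeriodicLQ.qForcing B C P yd ud t := by
    filter_upwards [hyd_per, hud_per] with t h1 h2
    simp only [PeriodicLQ.qForcing, h1, h2]
  have hqT := hqm.periodicExt hR hp hgi hgper hq0
  have hfi : ∀ T, 0 ≤ T → IntervalIntegrable
      (fun t => PeriodicLQ.gramian B Q (PeriodicLQ.periodicExt p q t) + B (ud t)) volume 0 T :=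
    fun T hT => by
    rcases hT.eq_or_lt with rfl | hT
    · simp
    · refine IntervalIntegrable.add (PeriodicLQ.intervalIntegrable_clm
        (ContinuousOn.intervalIntegrable ?_) _) (PeriodicLQ.intervalIntegrable_clm
          (PeriodicLQ.MemLp.intervalIntegrable_two hT.le (hud T hT)) B)
      rw [uIcc_of_le hT.le]
      exact (hqT T).continuousOn
  have hfper : ∀ᵐ t ∂volume.restrict (Ioi (0 : ℝ)),
      PeriodicLQ.gramian B Q (PeriodicLQ.periodicExt p q (t + p)) + B (ud (t + p))
        = PeriodicLQ.gramian B Q (PeriodicLQ.periodicExt p q t) + B (ud t) := by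
    filter_upwards [hud_per] with t h2
    rw [h2, PeriodicLQ.periodicExt_add_period hp]
  -- On one period q may be replaced by its periodic extension in the forcing, which then is
  -- periodic almost everywhere, as the extension of y requires.
  have hym' : PeriodicLQ.MildOn R
      (fun t => PeriodicLQ.gramian B Q (PeriodicLQ.periodicExt p q t) + B (ud t)) y 0 p := by
    refine hym.congr (Filter.Eventually.of_forall fun t ht => ?_) fun _ _ => rfl
    rw [PeriodicLQ.periodicExt_eq_sub hp q hq0 0 (by simpa using ⟨ht.1.le, ht.2⟩)]
    simp
  have hyT := hym'.periodicExt hR hp hfi hfper hy0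
  -- The adjoint state is bounded on one period, hence its extension is bounded at all times; this
  -- is the T-independent bound used by the turnpike estimate.
  obtain ⟨M, hM⟩ := isCompact_Icc.exists_bound_of_continuousOn hext.back.continuousOn
  obtain ⟨c, hc, ν, hν, hturn⟩ := h.exists_turnpike hEpos hE hyd hud (fun T _ => hyT T)
    (fun T _ => hqT T) (M := M) (fun t => by
      obtain ⟨s, hs, hts⟩ := PeriodicLQ.exists_periodicExt_eq hp (fun t => q t - P (y t)) t
      have h1 := hM s hs
      rw [← hts] at h1
      exact h1) y₀
  rw [PeriodicLQ.isOptimalOn_clampSemigroup, PeriodicLQ.isLiftOn_clampSemigroup] at hturn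
  refine ⟨c, hc, ν, hν, fun T hT => ?_⟩
  obtain ⟨yT, uT, lT, h1, h2⟩ := hturn T hT
  refine ⟨yT, uT, lT, h1, ?_⟩
  rw [ae_restrict_iff' measurableSet_Icc]
  -- The extended optimal control contains the periodic extension of u_d, which equals u_d only
  -- almost everywhere; hence the estimate holds for almost every t.
  filter_upwards [PeriodicLQ.ae_periodicExt_eq hp hud_per] with t h3 ht
  have h4 := h2 t ht
  rw [← h3 ht.1] at h4
  exact h4
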